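/- Conventions. Let $(X,d,\mu)$ be a proper metric space (closed balls are compact) with a locally finite Borel measure $\mu$ that is positive on nonempty open sets, and let $Q>0$. It is locally Ahlfors $Q$-regular if for every compact $K\subseteq X$ there are $R>0$ and $C\ge 1$ with $r^Q/C\le\mu(B(x,r))\le Cr^Q$ for all $x\in K$ and $0<r<R$. A Borel function $g:X\to[0,\infty]$ is an upper gradient of $f:X\to\mathbb{R}^N$ if $|f(\gamma(0))-f(\gamma(1))|\le\int_\gamma g\,ds$ for every rectifiable curve $\gamma:[0,1]\to X$. Let ${\rm N}^{1,p}(X;\mathbb{R}^N)$ be the space of Borel functions $f\in{\rm L}^p(X;\mathbb{R}^N)$ that have an upper gradient in ${\rm L}^p(X)$, modulo the functions $f$ with $\|f\|=0$, where $\|f\|=\|f\|_{{\rm L}^p}+\inf_g\|g\|_{{\rm L}^p}$, the infimum being over all upper gradients $g$ of $f$ (if $p<1$, both ${\rm L}^p$-norms are replaced by their $p$-th powers, which gives a translation-invariant metric). A Borel set $A\subseteq X$ is $p$-exceptional if $\|\chi_A\|=0$. A subset $S$ of ${\rm N}^{1,p}(X;\mathbb{R}^N)$ is prevalent if the complement of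 $S$ is contained in a Borel set $T$ for which there is a Borel probability measure $\lambda$ with compact support such that $\lambda(T+x)=0$ for all $x\in{\rm N}^{1,p}(X;\mathbb{R}^N)$. Finally, $\dim$ is Hausdorff dimension and $\mathcal{H}^s$ is Hausdorff measure. Theorem. Let $(X,d,\mu)$ be as above and locally Ahlfors $Q$-regular for some $Q>0$. For $0\le s\le Q$ and $p>Q$ set $$\alpha=\frac{ps}{p-Q+s}.$$ Let $E\subseteq X$ be compact with $\mathcal{H}^s(E)>0$, and let $N\in\mathbb{N}$ be greater than $\alpha$. Then there is a continuous map $f:X\to\mathbb{R}^N$ that has an upper gradient in ${\rm L}^p(X)$ and satisfies $\dim f(E)\ge\alpha$. Moreover, the set of all classes $u\in{\rm N}^{1,p}(X;\mathbb{R}^N)$ with the following three properties is prevalent in ${\rm N}^{1,p}(X;\mathbb{R}^N)$: (a) some representative $f$ of $u$ satisfies $\dim f(E)\ge\alpha$; (b) every continuous representative $f$ of $u$ (there is at most one) satisfies $\dim f(E)\ge\alpha$; (c) if $\mathcal{H}^s(E\cap A)=0$ for every $p$-exceptional set $A$, then every representative $f$ of $u$ satisfies $\dim f(E)\ge\alpha$.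 -/

import Mathlib

open MeasureTheory Set
open scoped ENNReal

set_option linter.unusedSectionVars false

noncomputable section

/-- The metric measure space `(X, d, μ)` is locally Ahlfors `Q`-regular. -/
def LocallyAhlforsRegular {X : Type*} [MetricSpace X] [MeasurableSpace X]
    (μ : Measure X) (Q : ℝ) : Prop :=
  ∀ K : Set X, IsCompact K → ∃ R : ℝ, 0 < R ∧ ∃ C : ℝ, 1 ≤ C ∧
    ∀ x ∈ K, ∀ r : ℝ, 0 < r → r < R →
      ENNReal.ofReal (r ^ Q / C) ≤ μ (Metric.ball x r) ∧
      μ (Metric.ball x r) ≤ ENNReal.ofReal (C * r ^ Q)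

/-! ### Rectifiable curves and upper gradients -/

/-- The length of a curve parametrized by `[0,1]`. -/
def curveLength {X : Type*} [MetricSpace X] (γ : C(unitInterval, X)) : ℝ≥0∞ :=
  eVariationOn γ univ

/-- The line integral `∫_γ g ds` of a nonnegative function along a rectifiable curve,
computed in the arc length parametrization of `γ`. -/
def lineIntegral {X : Type*} [MetricSpace X] (γ : C(unitInterval, X)) (g : X → ℝ≥0∞) : ℝ≥0∞ :=
  ∫⁻ t in Icc (0 : ℝ) (curveLength γ).toReal, g (naturalParameterization γ univ 0 t)

/-- The Borel function `g : X → [0, ∞]` is an upper gradient of `f`. -/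
def IsUpperGradient {X Y : Type*} [MetricSpace X] [MeasurableSpace X] [MetricSpace Y]
    (f : X → Y) (g : X → ℝ≥0∞) : Prop :=
  Measurable g ∧
    ∀ γ : C(unitInterval, X), curveLength γ ≠ ∞ → edist (f (γ 0)) (f (γ 1)) ≤ lineIntegral γ g

/-- The size of a nonnegative function in `L^p`: the usual `(∫ h ^ p) ^ (1 / p)` if `1 ≤ p`, and
`∫ h ^ p` if `0 < p < 1`, where only the latter satisfies the triangle inequality. -/
def lpSize {X : Type*} [MeasurableSpace X] (μ : Measure X) (p : ℝ) (h : X → ℝ≥0∞) : ℝ≥0∞ :=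
  (∫⁻ x, h x ^ p ∂μ) ^ (1 / max 1 p)

/-- A nonnegative function is in `L^p` (measurability aside). -/
def FiniteLp {X : Type*} [MeasurableSpace X] (μ : Measure X) (p : ℝ) (h : X → ℝ≥0∞) : Prop :=
  ∫⁻ x, h x ^ p ∂μ < ∞

section helpers

variable {X : Type*} [MeasurableSpace X] {μ : Measure X} {p : ℝ}

theorem lpSize_lt_top_iff {h : X → ℝ≥0∞} : lpSize μ p h < ∞ ↔ FiniteLp μ p h := by
  have : 0 < 1 / max 1 p := by positivity
  rw [lpSize, FiniteLp, ENNReal.rpow_lt_top_iff_of_pos this]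

theorem lpSize_mono (hp : 0 < p) {h k : X → ℝ≥0∞} (hk : ∀ x, h x ≤ k x) :
    lpSize μ p h ≤ lpSize μ p k := by
  unfold lpSize
  gcongr
  exact hk _

theorem lpSize_zero (hp : 0 < p) : lpSize μ p (fun _ => 0) = 0 := by
  have : 0 < 1 / max 1 p := by positivity
  simp [lpSize, ENNReal.zero_rpow_of_pos hp, ENNReal.zero_rpow_of_pos]

theorem lpSize_add_le (hp : 0 < p) {h k : X → ℝ≥0∞} (hh : Measurable h) (hk : Measurable k) :
    lpSize μ p (h + k) ≤ lpSize μ p h + lpSize μ p k := by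
  unfold lpSize
  rcases le_total 1 p with h1 | h1
  · rw [max_eq_right h1]
    exact ENNReal.lintegral_Lp_add_le hh.aemeasurable hk.aemeasurable h1
  · rw [max_eq_left h1]
    simp only [div_one, ENNReal.rpow_one]
    rw [← lintegral_add_left (hh.pow_const p)]
    exact lintegral_mono fun x => ENNReal.rpow_add_le_add_rpow _ _ hp.le h1

theorem FiniteLp.add (hp : 0 < p) {h k : X → ℝ≥0∞} (mh : Measurable h) (mk : Measurable k)
    (hh : FiniteLp μ p h) (hk : FiniteLp μ p k) : FiniteLp μ p (h + k) := by
  rw [← lpSize_lt_top_iff] at *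
  exact (lpSize_add_le hp mh mk).trans_lt (ENNReal.add_lt_top.2 ⟨hh, hk⟩)

theorem FiniteLp.mono (hp : 0 < p) {h k : X → ℝ≥0∞} (hk : FiniteLp μ p k) (hle : ∀ x, h x ≤ k x) :
    FiniteLp μ p h := by
  rw [← lpSize_lt_top_iff] at *
  exact (lpSize_mono hp hle).trans_lt hk

theorem FiniteLp.const_mul (hp : 0 < p) {h : X → ℝ≥0∞} (mh : Measurable h)
    (hh : FiniteLp μ p h) {c : ℝ≥0∞} (hc : c ≠ ∞) : FiniteLp μ p (fun x => c * h x) := by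
  unfold FiniteLp at *
  simp only [ENNReal.mul_rpow_of_nonneg _ _ hp.le]
  rw [lintegral_const_mul _ (mh.pow_const p)]
  exact ENNReal.mul_lt_top (ENNReal.rpow_lt_top_of_nonneg hp.le hc) hh

variable [MetricSpace X] {F : Type*} [NormedAddCommGroup F] [NormedSpace ℝ F]

theorem IsUpperGradient.zero : IsUpperGradient (0 : X → F) (fun _ => 0) :=
  ⟨measurable_const, fun γ _ => by simp⟩

theorem IsUpperGradient.add {f₁ f₂ : X → F} {g₁ g₂ : X → ℝ≥0∞} (h₁ : IsUpperGradient f₁ g₁)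
    (h₂ : IsUpperGradient f₂ g₂) : IsUpperGradient (f₁ + f₂) (g₁ + g₂) := by
  refine ⟨h₁.1.add h₂.1, fun γ hγ => ?_⟩
  refine (edist_add_add_le _ _ _ _).trans ((add_le_add (h₁.2 γ hγ) (h₂.2 γ hγ)).trans ?_)
  exact le_lintegral_add _ _

theorem IsUpperGradient.smul {f : X → F} {g : X → ℝ≥0∞} (h : IsUpperGradient f g) (c : ℝ) :
    IsUpperGradient (c • f) (fun x => ‖c‖ₑ * g x) := by
  refine ⟨h.1.const_mul _, fun γ hγ => ?_⟩
  have h1 : edist ((c • f) (γ 0)) ((c • f) (γ 1)) = ‖c‖ₑ * edist (f (γ 0)) (f (γ 1)) := by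
    simp only [Pi.smul_apply, edist_eq_enorm_sub, ← smul_sub, enorm_smul]
  rw [h1]
  refine (mul_le_mul_right (h.2 γ hγ) _).trans ?_
  exact lintegral_const_mul_le _ _

theorem IsUpperGradient.neg {f : X → F} {g : X → ℝ≥0∞} (h : IsUpperGradient f g) :
    IsUpperGradient (-f) g := by
  simpa using h.smul (-1)

end helpers

/-! ### The Newtonian-Sobolev space -/

section Newtonian

variable {X : Type*} [MetricSpace X] [MeasurableSpace X] (μ : Measure X)
  (p : ℝ) [hp : Fact (0 < p)]
  (F : Type*) [NormedAddCommGroup F] [NormedSpace ℝ F] [MeasurableSpace F] [BorelSpace F]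
  [SecondCountableTopology F]

/-- The vector space of all (everywhere defined, not necessarily continuous) Borel functions
`f : X → F` in `L^p` that have an upper gradient in `L^p`. -/
def newtonianSubmodule : Submodule ℝ (X → F) where
  carrier := {f | Measurable f ∧ FiniteLp μ p (fun x => ‖f x‖ₑ) ∧
    ∃ g : X → ℝ≥0∞, IsUpperGradient f g ∧ FiniteLp μ p g}
  zero_mem' := by
    have h0 : FiniteLp μ p (fun _ => 0) := by
      simp [FiniteLp, ENNReal.zero_rpow_of_pos hp.out]
    exact ⟨measurable_const, by simpa using h0, _, IsUpperGradient.zero, h0⟩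
  add_mem' := by
    rintro f₁ f₂ ⟨m₁, i₁, g₁, u₁, j₁⟩ ⟨m₂, i₂, g₂, u₂, j₂⟩
    exact ⟨m₁.add m₂,
      (FiniteLp.add hp.out m₁.enorm m₂.enorm i₁ i₂).mono hp.out fun x => enorm_add_le _ _,
      _, u₁.add u₂, FiniteLp.add hp.out u₁.1 u₂.1 j₁ j₂⟩
  smul_mem' := by
    rintro c f ⟨m, i, g, u, j⟩
    refine ⟨m.const_smul c, ?_, _, u.smul c, j.const_mul hp.out u.1 (by simp)⟩
    exact (i.const_mul hp.out m.enorm (c := ‖c‖ₑ) (by simp)).mono hp.out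
      fun x => by simp [enorm_smul]

/-- The functions of the Newtonian-Sobolev class, before passing to equivalence classes. It is a
new type, so as not to carry the topology of pointwise convergence. -/
def NewtonianFunction : Type _ := newtonianSubmodule μ p F

instance : AddCommGroup (NewtonianFunction μ p F) :=
  inferInstanceAs (AddCommGroup (newtonianSubmodule μ p F))

instance : Module ℝ (NewtonianFunction μ p F) :=
  inferInstanceAs (Module ℝ (newtonianSubmodule μ p F))

instance : CoeFun (NewtonianFunction μ p F) (fun _ => X → F) := ⟨fun f => f.1⟩

variable {F}

/-- The Newtonian-Sobolev size of a function: `‖f‖_p + inf ‖g‖_p`, the infimum being over all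
upper gradients `g` of `f`. -/
def newtonianSize (f : X → F) : ℝ≥0∞ :=
  lpSize μ p (fun x => ‖f x‖ₑ) + ⨅ (g : X → ℝ≥0∞) (_ : IsUpperGradient f g), lpSize μ p g

variable {μ p}

theorem newtonianSize_lt_top (f : NewtonianFunction μ p F) : newtonianSize μ p f < ∞ := by
  obtain ⟨_, i, g, u, j⟩ := f.2
  refine ENNReal.add_lt_top.2 ⟨lpSize_lt_top_iff.2 i, ?_⟩
  exact (iInf₂_le g u).trans_lt (lpSize_lt_top_iff.2 j)

theorem newtonianSize_zero : newtonianSize μ p (0 : X → F) = 0 := by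
  have h := iInf₂_le (f := fun (g : X → ℝ≥0∞) (_ : IsUpperGradient (0 : X → F) g) => lpSize μ p g)
    _ IsUpperGradient.zero
  rw [lpSize_zero hp.out, nonpos_iff_eq_zero] at h
  rw [newtonianSize, h]
  simpa using lpSize_zero hp.out

theorem newtonianSize_neg_le (f : X → F) : newtonianSize μ p (-f) ≤ newtonianSize μ p f := by
  unfold newtonianSize
  refine add_le_add (by simp) ?_
  exact le_iInf₂ fun g u => iInf₂_le g u.neg

theorem newtonianSize_add_le {f₁ f₂ : X → F} (h₁ : Measurable f₁) (h₂ : Measurable f₂) :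
    newtonianSize μ p (f₁ + f₂) ≤ newtonianSize μ p f₁ + newtonianSize μ p f₂ := by
  unfold newtonianSize
  rw [add_add_add_comm]
  refine add_le_add ?_ ?_
  · exact (lpSize_mono hp.out fun x => enorm_add_le _ _).trans
      (lpSize_add_le hp.out h₁.enorm h₂.enorm)
  · refine ENNReal.le_iInf₂_add_iInf₂ fun g₁ u₁ g₂ u₂ => ?_
    exact (iInf₂_le _ (u₁.add u₂)).trans (lpSize_add_le hp.out u₁.1 u₂.1)

variable (μ p F)

/-- The translation-invariant pseudo-metric of the Newtonian-Sobolev size. -/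
instance : SeminormedAddCommGroup (NewtonianFunction μ p F) :=
  AddGroupSeminorm.toSeminormedAddCommGroup
    { toFun := fun f => (newtonianSize μ p f).toReal
      map_zero' := by
        change (newtonianSize μ p (0 : X → F)).toReal = 0
        rw [newtonianSize_zero, ENNReal.toReal_zero]
      add_le' := fun f₁ f₂ => by
        rw [← ENNReal.toReal_add (newtonianSize_lt_top f₁).ne (newtonianSize_lt_top f₂).ne]
        exact ENNReal.toReal_mono
          (ENNReal.add_lt_top.2 ⟨newtonianSize_lt_top f₁, newtonianSize_lt_top f₂⟩).ne
          (newtonianSize_add_le f₁.2.1 f₂.2.1)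
      neg' := fun f => by
        refine congrArg ENNReal.toReal (le_antisymm (newtonianSize_neg_le _) ?_)
        have h := newtonianSize_neg_le (μ := μ) (p := p) (-(f : X → F))
        rwa [neg_neg] at h }

/-- The Newtonian-Sobolev space `N^{1,p}(X; F)`: functions of the Newtonian-Sobolev class, modulo
those of size zero, with the metric induced by the size (a norm if `1 ≤ p`). -/
abbrev NewtonianSpace : Type _ := SeparationQuotient (NewtonianFunction μ p F)

variable {μ p F}

/-- The Borel set `A` is `p`-exceptional (has `p`-capacity zero): its indicator function has
Newtonian-Sobolev size zero. These are the sets on which two representatives of one class in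
`N^{1,p}` may differ. -/
def IsExceptional (μ : Measure X) (p : ℝ) (A : Set X) : Prop :=
  MeasurableSet A ∧ newtonianSize μ p (A.indicator (fun _ => (1 : ℝ))) = 0

/-- The function `f` represents the class `u`. -/
def Represents (f : NewtonianFunction μ p F) (u : NewtonianSpace μ p F) : Prop :=
  SeparationQuotient.mk f = u

end Newtonian

/-! ### Prevalence -/

/-- A nonzero Borel measure `m` with compact support, normalized to have mass one, is transverse
to `T` if every translate of `T` is `m`-null. The set `S` is shy if it is contained in a Borel set
to which some such measure is transverse. -/
def IsShy {B : Type*} [AddCommGroup B] [TopologicalSpace B] (S : Set B) : Prop :=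
  ∃ T : Set B, S ⊆ T ∧ MeasurableSet[borel B] T ∧
    ∃ m : @Measure B (borel B), m univ = 1 ∧ (∃ K : Set B, IsCompact K ∧ m Kᶜ = 0) ∧
      ∀ x : B, m ((fun y => y + x) '' T) = 0

/-- A set is prevalent if its complement is shy. -/
def IsPrevalent {B : Type*} [AddCommGroup B] [TopologicalSpace B] (S : Set B) : Prop :=
  IsShy Sᶜ

end

/-! Frostman's lemma gives a nonzero finite measure ν on E with ν(B(x,r)) ≤ C r^s. If the energy ∬
|f(x) - f(y)|^(-t) dν dν of a Borel map f is finite, then f maps every Borel set of positive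
ν-measure onto a set of dimension at least t (`le_dimH_image_of_energy`). Hence finite energy for a
sequence of t increasing to α is enough.

Such maps are random series of tents. At scale r = R 2^(-j), each point z of an r-net near E carries
a tent of height a = (j+1)^(-2 max(1,p)/p) (ν(B(z,11r)) r^(p-Q))^(1/p), multiplied by an independent
random vector, uniform in the unit ball of the target. The slopes are about a/r on balls of measure
about r^Q, so the L^p cost of the level is a polynomial weight times ∑ ν(B(z,11r)), which bounded
overlap controls by ν(X) (`exists_bumpSystem_height`). If 4r < d(x,y) ≤ 8r, some tent sees x but not
y. Given all other coefficients, f(x) - f(y) is a translate of a uniform vector of size at least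
a/2, so the mean of |f(x) - f(y)|^(-t) is at most a constant times a^(-t) when t < N
(`BumpSystem.exists_lintegral_law_le`). Integration over y and summation over the scales leave ∑
(j+1)^k r^ε with ε = s(1 - t/p) - (p-Q)t/p, which is positive precisely for t < α
(`lintegral_energyKernel_ne_top`).

Adding a fixed function to the series does not change these bounds, so the law of the series is
transverse to the classes of infinite energy. The bad set must also be Borel: truncated energies are
continuous on classes, by Fuglede's lemma, as soon as the measure on pairs ignores exceptional sets
(`continuous_energyFunctional`), and the bad set is described by their lower limits
(`isShy_of_forall_exists_liminf_eq_top`).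

If ν ignores exceptional sets, ν × ν serves and every representative is good. Otherwise ν charges an
exceptional set A. Then (c) is void, since ν ≤ C H^s; (a) holds for every class, since a
representative may be redefined on A to equal one good map; and for (b), ν × ν is replaced by
averages over small balls, which ignore μ-null sets and recover the energy of a continuous map in
the limit. -/

section Auxiliary

open Filter Topology
open scoped NNReal

/-! ### Arc length, and upper gradients of Lipschitz functions. -/

section Curves

variable {X : Type*} [MetricSpace X]

theorem curveLength_boundedVariationOn {γ : C(unitInterval, X)} (hγ : curveLength γ ≠ ∞) :
    BoundedVariationOn γ univ := hγ

/-- The variation of a continuous curve of finite length over a shrinking interval at x tends to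
zero on both sides of x. -/
theorem continuous_variationOnFromTo {γ : C(unitInterval, X)} (hγ : curveLength γ ≠ ∞) :
    Continuous (variationOnFromTo γ univ 0) := by
  have hb := curveLength_boundedVariationOn hγ
  have hl := hb.locallyBoundedVariationOn
  refine continuous_iff_continuousAt.2 fun x => ?_
  have h1 := hb.tendsto_eVariationOn_Icc_zero_left (x := x) γ.continuous.continuousWithinAt
  have h2 := hb.tendsto_eVariationOn_Icc_zero_right x γ.continuous.continuousWithinAt
  rw [nhdsWithin_univ] at h1 h2
  have h3 : Tendsto (fun y => (eVariationOn γ (univ ∩ Icc y x)).toReal +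
      (eVariationOn γ (univ ∩ Icc x y)).toReal) (𝓝 x) (𝓝 0) := by
    have := ((ENNReal.tendsto_toReal ENNReal.zero_ne_top).comp h1).add
      ((ENNReal.tendsto_toReal ENNReal.zero_ne_top).comp h2)
    simpa using this
  refine tendsto_iff_dist_tendsto_zero.2 (squeeze_zero (fun _ => dist_nonneg) (fun y => ?_) h3)
  rw [Real.dist_eq, variationOnFromTo.sub_right hl (mem_univ _) (mem_univ _) (mem_univ _)]
  rcases le_total x y with h | h
  · rw [abs_of_nonneg (variationOnFromTo.nonneg_of_le _ _ h), variationOnFromTo.eq_of_le _ _ h]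
    exact le_add_of_nonneg_left ENNReal.toReal_nonneg
  · rw [abs_of_nonpos (variationOnFromTo.nonpos_of_ge _ _ h), variationOnFromTo.eq_of_ge _ _ h,
      neg_neg]
    exact le_add_of_nonneg_right ENNReal.toReal_nonneg

theorem variationOnFromTo_one (γ : C(unitInterval, X)) :
    variationOnFromTo γ univ 0 1 = (curveLength γ).toReal := by
  rw [variationOnFromTo.eq_of_le _ _ zero_le_one, curveLength]
  congr 2
  ext t
  simp [unitInterval.le_one']

theorem monotone_variationOnFromTo {γ : C(unitInterval, X)} (hγ : curveLength γ ≠ ∞) :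
    Monotone (variationOnFromTo γ univ 0) := monotoneOn_univ.1 <|
  variationOnFromTo.monotoneOn (curveLength_boundedVariationOn hγ).locallyBoundedVariationOn
    (mem_univ _)

/-- Every arc length parameter comes from a point of the curve, so claims about
`naturalParameterization` need only be checked at values of the variation function, where it returns
the curve. -/
theorem exists_variationOnFromTo_eq {γ : C(unitInterval, X)} (hγ : curveLength γ ≠ ∞)
    (t₀ : unitInterval) {a : ℝ} (ha : a ∈ Icc 0 (variationOnFromTo γ univ 0 t₀)) :
    ∃ t ≤ t₀, variationOnFromTo γ univ 0 t = a := by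
  have h := intermediate_value_Icc (unitInterval.nonneg' : (0 : unitInterval) ≤ t₀)
    (continuous_variationOnFromTo hγ).continuousOn
  rw [variationOnFromTo.self] at h
  obtain ⟨t, ht, rfl⟩ := h ha
  exact ⟨t, ht.2, rfl⟩

theorem naturalParameterization_variationOnFromTo {γ : C(unitInterval, X)}
    (hγ : curveLength γ ≠ ∞) (t : unitInterval) :
    naturalParameterization γ univ 0 (variationOnFromTo γ univ 0 t) = γ t :=
  edist_eq_zero.1 <| edist_naturalParameterization_eq_zero
    (curveLength_boundedVariationOn hγ).locallyBoundedVariationOn (mem_univ _) (mem_univ _)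

theorem naturalParameterization_zero {γ : C(unitInterval, X)} (hγ : curveLength γ ≠ ∞) :
    naturalParameterization γ univ 0 0 = γ 0 := by
  simpa [variationOnFromTo.self] using naturalParameterization_variationOnFromTo hγ 0

theorem naturalParameterization_length {γ : C(unitInterval, X)} (hγ : curveLength γ ≠ ∞) :
    naturalParameterization γ univ 0 (curveLength γ).toReal = γ 1 := by
  rw [← variationOnFromTo_one, naturalParameterization_variationOnFromTo hγ]

theorem lipschitzOnWith_naturalParameterization {γ : C(unitInterval, X)}
    (hγ : curveLength γ ≠ ∞) :
    LipschitzOnWith 1 (naturalParameterization γ univ 0) (Icc 0 (curveLength γ).toReal) := by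
  have hl := (curveLength_boundedVariationOn hγ).locallyBoundedVariationOn
  have key : ∀ s t : unitInterval, s ≤ t → dist (γ s) (γ t) ≤
      variationOnFromTo γ univ 0 t - variationOnFromTo γ univ 0 s := fun s t hst => by
    rw [variationOnFromTo.sub_right hl (mem_univ _) (mem_univ _) (mem_univ _),
      variationOnFromTo.eq_of_le _ _ hst, dist_edist]
    exact ENNReal.toReal_mono (hl s t (mem_univ _) (mem_univ _))
      (eVariationOn.edist_le _ (by simp [hst]) (by simp [hst]))
  refine LipschitzOnWith.of_dist_le_mul fun a ha b hb => ?_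
  rw [← variationOnFromTo_one] at ha hb
  obtain ⟨s, -, rfl⟩ := exists_variationOnFromTo_eq hγ 1 ha
  obtain ⟨t, -, rfl⟩ := exists_variationOnFromTo_eq hγ 1 hb
  rw [naturalParameterization_variationOnFromTo hγ, naturalParameterization_variationOnFromTo hγ,
    NNReal.coe_one, one_mul, Real.dist_eq]
  rcases le_total s t with h | h
  · exact (key s t h).trans (by rw [abs_sub_comm]; exact le_abs_self _)
  · rw [dist_comm]
    exact (key t s h).trans (le_abs_self _)

/-- The initial piece of a rectifiable curve, ending at a given parameter. -/
theorem exists_initial_subcurve {γ : C(unitInterval, X)} (hγ : curveLength γ ≠ ∞)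
    (t₀ : unitInterval) : ∃ γ' : C(unitInterval, X), curveLength γ' ≠ ∞ ∧ γ' 0 = γ 0 ∧
      γ' 1 = γ t₀ ∧ ∀ g : X → ℝ≥0∞, lineIntegral γ' g ≤ lineIntegral γ g := by
  set φ : unitInterval → unitInterval := fun s => t₀ * s with hφ
  have hφc : Continuous φ := continuous_const.mul continuous_id
  have hφm : Monotone φ := fun a b hab => mul_le_mul_right hab t₀
  set γ' : C(unitInterval, X) := γ.comp ⟨φ, hφc⟩ with hγ'
  have hco : (γ' : unitInterval → X) = γ ∘ φ := rfl
  have hlen : curveLength γ' ≠ ∞ :=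
    ne_top_of_le_ne_top hγ (eVariationOn.comp_le_of_monotoneOn γ φ (hφm.monotoneOn _)
      (mapsTo_univ _ _))
  have himg : φ '' univ = Iic t₀ := by
    apply Subset.antisymm
    · rintro _ ⟨s, -, rfl⟩
      exact unitInterval.mul_le_left
    · intro s hs
      have := intermediate_value_Icc (zero_le_one : (0 : unitInterval) ≤ 1) hφc.continuousOn
      simp only [hφ, mul_zero, mul_one] at this
      obtain ⟨u, -, hu⟩ := this ⟨unitInterval.nonneg', hs⟩
      exact ⟨u, mem_univ _, hu⟩
  -- Variation is invariant under monotone substitution, so both curves have the same arc length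
  -- parametrization and the integrals differ only in their upper limit.
  have hV : ∀ s, variationOnFromTo γ' univ 0 s = variationOnFromTo γ univ 0 (t₀ * s) := fun s => by
    rw [hco, variationOnFromTo.comp_eq_of_monotoneOn γ φ (hφm.monotoneOn _) (mem_univ _)
      (mem_univ _), himg]
    simp only [hφ, mul_zero]
    rw [variationOnFromTo.eq_of_le _ _ unitInterval.nonneg',
      variationOnFromTo.eq_of_le _ _ unitInterval.nonneg']
    congr 2
    ext u
    simp only [mem_inter_iff, mem_Iic, mem_univ, true_and, and_iff_right_iff_imp, mem_Icc]
    exact fun h => h.2.trans unitInterval.mul_le_left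
  refine ⟨γ', hlen, by simp [hco, hφ], by simp [hco, hφ], fun g => ?_⟩
  have hl' : (curveLength γ').toReal = variationOnFromTo γ univ 0 t₀ := by
    rw [← variationOnFromTo_one, hV, mul_one]
  unfold lineIntegral
  calc ∫⁻ t in Icc 0 (curveLength γ').toReal, g (naturalParameterization γ' univ 0 t)
      = ∫⁻ t in Icc 0 (curveLength γ').toReal, g (naturalParameterization γ univ 0 t) := by
        refine setLIntegral_congr_fun measurableSet_Icc fun a ha => ?_
        rw [← variationOnFromTo_one] at ha
        obtain ⟨s, -, rfl⟩ := exists_variationOnFromTo_eq hlen 1 ha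
        simp only [naturalParameterization_variationOnFromTo hlen]
        rw [hV, naturalParameterization_variationOnFromTo hγ]
        rfl
    _ ≤ _ := by
        refine lintegral_mono_set (Icc_subset_Icc_right ?_)
        rw [hl', ← variationOnFromTo_one]
        exact monotone_variationOnFromTo hγ unitInterval.le_one'

/-- The oscillation of a nonnegative Lipschitz function on an interval is bounded by the
Lipschitz constant times the length of a subinterval on which the function is positive. -/
theorem exists_Ioo_abs_sub_le {h : ℝ → ℝ} {K : ℝ≥0} {ℓ : ℝ} (hℓ : 0 ≤ ℓ)
    (hL : LipschitzOnWith K h (Icc 0 ℓ)) (h0 : ∀ t, 0 ≤ h t) :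
    ∃ a b, Ioo a b ⊆ Icc 0 ℓ ∧ (∀ t ∈ Ioo a b, h t ≠ 0) ∧ |h 0 - h ℓ| ≤ K * (b - a) := by
  have hd : ∀ a ∈ Icc 0 ℓ, ∀ b ∈ Icc 0 ℓ, a ≤ b → |h a - h b| ≤ K * (b - a) := by
    intro a ha b hb hab
    have := hL.dist_le_mul a ha b hb
    rwa [Real.dist_eq, Real.dist_eq, abs_sub_comm a b, abs_of_nonneg (sub_nonneg.2 hab)] at this
  have m0 : (0 : ℝ) ∈ Icc 0 ℓ := left_mem_Icc.2 hℓ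
  have mℓ : ℓ ∈ Icc 0 ℓ := right_mem_Icc.2 hℓ
  set Z := {t ∈ Icc 0 ℓ | h t = 0} with hZ
  have hZc : IsCompact Z := by
    have := hL.continuousOn.preimage_isClosed_of_isClosed isClosed_Icc
      (isClosed_singleton (x := (0 : ℝ)))
    exact isCompact_Icc.of_isClosed_subset this (fun t ht => ht.1)
  rcases Z.eq_empty_or_nonempty with hE | hN
  · refine ⟨0, ℓ, Ioo_subset_Icc_self, fun t ht h' => ?_, hd 0 m0 ℓ mℓ hℓ⟩
    exact (hE ▸ (⟨Ioo_subset_Icc_self ht, h'⟩ : t ∈ Z) : t ∈ (∅ : Set ℝ))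
  -- As h ≥ 0, the oscillation is at most the larger endpoint value. It is enough to travel from
  -- that endpoint to the nearest zero.
  rcases le_total (h ℓ) (h 0) with hle | hle
  · obtain ⟨τ, hτ, hmin⟩ := hZc.exists_isLeast hN
    refine ⟨0, τ, fun t ht => ⟨ht.1.le, ht.2.le.trans hτ.1.2⟩, fun t ht h' => ?_, ?_⟩
    · exact absurd (hmin ⟨⟨ht.1.le, ht.2.le.trans hτ.1.2⟩, h'⟩) (not_le.2 ht.2)
    · have := hd 0 m0 τ hτ.1 hτ.1.1
      rw [hτ.2, sub_zero, abs_of_nonneg (h0 0)] at this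
      rw [abs_of_nonneg (sub_nonneg.2 hle)]
      linarith [h0 ℓ]
  · obtain ⟨τ, hτ, hmax⟩ := hZc.exists_isGreatest hN
    refine ⟨τ, ℓ, fun t ht => ⟨hτ.1.1.trans ht.1.le, ht.2.le⟩, fun t ht h' => ?_, ?_⟩
    · exact absurd (hmax ⟨⟨hτ.1.1.trans ht.1.le, ht.2.le⟩, h'⟩) (not_le.2 ht.1)
    · have := hd τ hτ.1 ℓ mℓ hτ.1.2
      rw [hτ.2, zero_sub, abs_neg, abs_of_nonneg (h0 ℓ)] at this
      rw [abs_of_nonpos (sub_nonpos.2 hle)]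
      linarith [h0 0]

/-- A nonnegative Lipschitz function vanishing off the measurable set `B` has the upper gradient
that is equal to its Lipschitz constant on `B` and vanishes elsewhere. -/
theorem LipschitzWith.isUpperGradient_indicator [MeasurableSpace X] {ψ : X → ℝ} {K : ℝ≥0}
    (hψ : LipschitzWith K ψ) (h0 : ∀ x, 0 ≤ ψ x) {B : Set X} (hB : MeasurableSet B)
    (hs : ∀ x ∉ B, ψ x = 0) : IsUpperGradient ψ (B.indicator fun _ => (K : ℝ≥0∞)) := by
  refine ⟨measurable_const.indicator hB, fun γ hγ => ?_⟩
  set η := naturalParameterization γ univ 0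
  have hη := lipschitzOnWith_naturalParameterization hγ
  have hL : LipschitzOnWith K (ψ ∘ η) (Icc 0 (curveLength γ).toReal) := by
    simpa using hψ.comp_lipschitzOnWith hη
  obtain ⟨a, b, hab, hne, hle⟩ := exists_Ioo_abs_sub_le ENNReal.toReal_nonneg hL fun t => h0 _
  simp only [Function.comp_apply] at hle
  rw [show η 0 = γ 0 from naturalParameterization_zero hγ,
    show η (curveLength γ).toReal = γ 1 from naturalParameterization_length hγ] at hle
  calc edist (ψ (γ 0)) (ψ (γ 1)) = ENNReal.ofReal |ψ (γ 0) - ψ (γ 1)| := by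
        rw [edist_dist, Real.dist_eq]
    _ ≤ ENNReal.ofReal (K * (b - a)) := ENNReal.ofReal_le_ofReal hle
    _ = ∫⁻ _ in Ioo a b, (K : ℝ≥0∞) := by
        rw [setLIntegral_const, Real.volume_Ioo, ENNReal.ofReal_mul K.coe_nonneg,
          ENNReal.ofReal_coe_nnreal]
    _ = ∫⁻ t in Ioo a b, B.indicator (fun _ => (K : ℝ≥0∞)) (η t) := by
        refine setLIntegral_congr_fun measurableSet_Ioo fun t ht => ?_
        have : η t ∈ B := by
          by_contra h
          exact hne t ht (hs _ h)
        simp [this]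
    _ ≤ _ := lintegral_mono_set hab

end Curves

/-! ### Countable subadditivity of the L^p size. -/

section LpSize

variable {X : Type*} [MeasurableSpace X] {μ : Measure X} {p : ℝ}

theorem lpSize_le_iff {h : X → ℝ≥0∞} {S : ℝ≥0∞} :
    lpSize μ p h ≤ S ↔ ∫⁻ x, h x ^ p ∂μ ≤ S ^ max 1 p := by
  rw [lpSize, one_div, ENNReal.rpow_inv_le_iff (by positivity)]

theorem lpSize_eq_zero_of_ae (hp : 0 < p) {h : X → ℝ≥0∞} (hh : h =ᵐ[μ] 0) : lpSize μ p h = 0 := by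
  rw [← nonpos_iff_eq_zero, lpSize_le_iff]
  refine (lintegral_eq_zero_of_ae_eq_zero ?_).le.trans zero_le
  filter_upwards [hh] with x hx
  simp [hx, ENNReal.zero_rpow_of_pos hp]

theorem ae_eq_zero_of_lpSize_eq_zero (hp : 0 < p) {h : X → ℝ≥0∞} (mh : Measurable h)
    (hh : lpSize μ p h = 0) : h =ᵐ[μ] 0 := by
  have h1 := lpSize_le_iff.1 hh.le
  rw [ENNReal.zero_rpow_of_pos (by positivity), nonpos_iff_eq_zero,
    lintegral_eq_zero_iff (mh.pow_const p)] at h1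
  filter_upwards [h1] with x hx
  simpa [ENNReal.rpow_eq_zero_iff, hp, hp.not_gt] using hx

theorem lpSize_finset_sum_le (hp : 0 < p) {ι : Type*} {h : ι → X → ℝ≥0∞}
    (mh : ∀ i, Measurable (h i)) (s : Finset ι) :
    lpSize μ p (fun x => ∑ i ∈ s, h i x) ≤ ∑ i ∈ s, lpSize μ p (h i) := by
  classical
  induction s using Finset.induction_on with
  | empty => simp [lpSize_zero hp]
  | insert a s ha ih =>
    simp only [Finset.sum_insert ha]
    refine (lpSize_add_le hp (mh a) (Finset.measurable_fun_sum s fun i _ => mh i)).trans ?_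
    gcongr

/-- Fatou's lemma for the partial sums. -/
theorem lpSize_tsum_le (hp : 0 < p) {h : ℕ → X → ℝ≥0∞} (mh : ∀ i, Measurable (h i)) :
    lpSize μ p (fun x => ∑' i, h i x) ≤ ∑' i, lpSize μ p (h i) := by
  rw [lpSize_le_iff]
  have h1 : ∀ x, (∑' i, h i x) ^ p =
      liminf (fun n => (∑ i ∈ Finset.range n, h i x) ^ p) atTop := fun x =>
    (((ENNReal.continuous_rpow_const (y := p)).tendsto _).comp
      (ENNReal.tendsto_nat_tsum fun i => h i x)).liminf_eq.symm
  simp_rw [h1]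
  refine (lintegral_liminf_le fun n => (Finset.measurable_fun_sum _ fun i _ => mh i).pow_const
    p).trans (liminf_le_of_le (by isBoundedDefault) fun b hb => ?_)
  obtain ⟨n, hn⟩ := hb.exists
  exact hn.trans <| lpSize_le_iff.1 <|
    (lpSize_finset_sum_le hp mh _).trans (ENNReal.sum_le_tsum _)

theorem ae_lt_top_of_lpSize_lt_top (hp : 0 < p) {h : X → ℝ≥0∞} (mh : Measurable h)
    (hh : lpSize μ p h < ∞) : ∀ᵐ x ∂μ, h x < ∞ := by
  filter_upwards [ae_lt_top (mh.pow_const p) (lpSize_lt_top_iff.1 hh).ne] with x hx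
  exact (ENNReal.rpow_lt_top_iff_of_pos hp).1 hx

/-- Superadditivity of the lower integral needs no measurability. This lets it be used for line
integrals without checking that integrands are measurable along the curve. -/
theorem finset_sum_lintegral_le {ι : Type*} (f : ι → X → ℝ≥0∞) (s : Finset ι) :
    ∑ i ∈ s, ∫⁻ x, f i x ∂μ ≤ ∫⁻ x, ∑ i ∈ s, f i x ∂μ := by
  classical
  induction s using Finset.induction_on with
  | empty => simp
  | insert a s ha ih =>
    simp only [Finset.sum_insert ha]
    exact (add_le_add_right ih _).trans (le_lintegral_add _ _)

theorem tsum_lintegral_le {ι : Type*} (f : ι → X → ℝ≥0∞) :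
    ∑' i, ∫⁻ x, f i x ∂μ ≤ ∫⁻ x, ∑' i, f i x ∂μ := by
  rw [ENNReal.tsum_eq_iSup_sum]
  exact iSup_le fun s => (finset_sum_lintegral_le f s).trans
    (lintegral_mono fun x => ENNReal.sum_le_tsum s)

end LpSize

/-! ### Fuglede's lemma and exceptional sets. -/

section Exceptional

variable {X : Type*} [MetricSpace X] [MeasurableSpace X] {μ : Measure X} {p : ℝ}
  {F : Type*} [NormedAddCommGroup F] [NormedSpace ℝ F] [MeasurableSpace F] [BorelSpace F]
  [SecondCountableTopology F]

theorem exists_isUpperGradient_lpSize_le {w : X → F} {c : ℝ≥0∞} (h : newtonianSize μ p w < c) :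
    ∃ g, IsUpperGradient w g ∧ lpSize μ p g ≤ c := by
  have h1 : ⨅ (g : X → ℝ≥0∞) (_ : IsUpperGradient w g), lpSize μ p g < c :=
    le_add_self.trans_lt h
  obtain ⟨g, hg⟩ := iInf_lt_iff.1 h1
  obtain ⟨hu, hg⟩ := iInf_lt_iff.1 hg
  exact ⟨g, hu, hg.le⟩

theorem newtonianSize_eq_zero_of_forall (hp : 0 < p) {w : X → F} (h0 : ∀ᵐ x ∂μ, w x = 0)
    (h : ∀ ε : ℝ≥0∞, ε ≠ 0 → ∃ g, IsUpperGradient w g ∧ lpSize μ p g ≤ ε) :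
    newtonianSize μ p w = 0 := by
  rw [newtonianSize, lpSize_eq_zero_of_ae hp, zero_add, ← nonpos_iff_eq_zero]
  · refine le_of_forall_pos_le_add fun ε hε => ?_
    obtain ⟨g, hg, hle⟩ := h ε hε.ne'
    exact (iInf₂_le g hg).trans (by simpa using hle)
  · filter_upwards [h0] with x hx
    simp [hx]

theorem IsExceptional.measure_eq_zero (hp : 0 < p) {A : Set X} (hA : IsExceptional μ p A) :
    μ A = 0 := by
  have h1 : lpSize μ p (fun x => ‖A.indicator (fun _ => (1 : ℝ)) x‖ₑ) = 0 :=
    (add_eq_zero.1 hA.2).1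
  have h2 := ae_eq_zero_of_lpSize_eq_zero hp (measurable_const.indicator hA.1).enorm h1
  refine measure_mono_null (fun x hx => ?_) (ae_iff.1 h2)
  simpa using hx

theorem tsum_lineIntegral_le (γ : C(unitInterval, X)) (h : ℕ → X → ℝ≥0∞) :
    ∑' n, lineIntegral γ (h n) ≤ lineIntegral γ (fun x => ∑' n, h n x) :=
  tsum_lintegral_le _

/-- Fuglede's lemma: a sequence that converges to zero sufficiently fast in the Newtonian-Sobolev
space converges pointwise off an exceptional set. -/
theorem isExceptional_not_tendsto (hp : 0 < p) {w : ℕ → X → F} (mw : ∀ n, Measurable (w n))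
    (hw : ∑' n, newtonianSize μ p (w n) ≠ ∞) :
    IsExceptional μ p {x | ¬ Tendsto (fun n => w n x) atTop (𝓝 0)} := by
  set B := {x | ¬ Tendsto (fun n => w n x) atTop (𝓝 0)} with hB
  have mB : MeasurableSet B := by
    have h1 : B = {x | Tendsto (fun n => ‖w n x‖ₑ) atTop (𝓝 0)}ᶜ := by
      ext x
      simp only [hB, mem_ofPred_eq, mem_compl_iff]
      rw [← tendsto_zero_iff_enorm_tendsto_zero]
    rw [h1]
    exact (measurableSet_tendsto _ fun n => (mw n).enorm).compl
  have hμB : ∀ᵐ x ∂μ, x ∉ B := by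
    have h1 : lpSize μ p (fun x => ∑' n, ‖w n x‖ₑ) < ∞ :=
      ((lpSize_tsum_le hp fun n => (mw n).enorm).trans
        (ENNReal.tsum_le_tsum fun n => le_self_add)).trans_lt hw.lt_top
    filter_upwards [ae_lt_top_of_lpSize_lt_top hp
      (Measurable.tsum fun n => (mw n).enorm) h1] with x hx
    simp only [hB, mem_ofPred_eq, not_not]
    rw [tendsto_zero_iff_enorm_tendsto_zero]
    exact ENNReal.tendsto_atTop_zero_of_tsum_ne_top hx.ne
  refine ⟨mB, newtonianSize_eq_zero_of_forall hp ?_ fun ε hε => ?_⟩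
  · filter_upwards [hμB] with x hx
    simp [hx]
  obtain ⟨δ, δ0, hδ⟩ := ENNReal.exists_pos_sum_of_countable one_ne_zero ℕ
  have h1 : ∀ n, ∃ g, IsUpperGradient (w n) g ∧ lpSize μ p g ≤ newtonianSize μ p (w n) + δ n :=
    fun n => exists_isUpperGradient_lpSize_le <|
      ENNReal.lt_add_right (ENNReal.ne_top_of_tsum_ne_top hw n) (by simpa using (δ0 n).ne')
  choose h hu hle using h1
  have hs : ∑' n, lpSize μ p (h n) ≠ ∞ := by
    refine ne_top_of_le_ne_top ?_ (ENNReal.tsum_le_tsum hle)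
    rw [ENNReal.tsum_add]
    exact ENNReal.add_ne_top.2 ⟨hw, (hδ.trans ENNReal.one_lt_top).ne⟩
  -- Convergence does not depend on the first m terms, so a tail of the upper gradients, of size at
  -- most ε, can serve as upper gradient of the indicator.
  obtain ⟨m, hm⟩ := ((ENNReal.tendsto_sum_nat_add _ hs).eventually_le_const
    (pos_iff_ne_zero.2 hε)).exists
  refine ⟨fun x => ∑' n, h (n + m) x, ⟨Measurable.tsum fun n => (hu _).1, fun γ hγ => ?_⟩,
    (lpSize_tsum_le hp fun n => (hu _).1).trans hm⟩
  -- Only curves joining `B` to its complement matter. If the tail had finite integral along one, `w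
  -- n (γ 0) - w n (γ 1)` would tend to zero, and the two ends would converge to zero together or
  -- not at all.
  by_cases hend : γ 0 ∈ B ↔ γ 1 ∈ B
  · by_cases h0 : γ 0 ∈ B
    · simp [h0, hend.1 h0]
    · simp [h0, show γ 1 ∉ B from fun h => h0 (hend.2 h)]
  suffices lineIntegral γ (fun x => ∑' n, h (n + m) x) = ∞ by simp [this]
  by_contra htop
  refine hend (not_congr ?_)
  have h2 : Tendsto (fun n => lineIntegral γ (h (n + m))) atTop (𝓝 0) :=
    ENNReal.tendsto_atTop_zero_of_tsum_ne_top
      (ne_top_of_le_ne_top htop (tsum_lineIntegral_le γ fun n => h (n + m)))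
  have h3 : Tendsto (fun n => w (n + m) (γ 0) - w (n + m) (γ 1)) atTop (𝓝 0) := by
    rw [tendsto_zero_iff_enorm_tendsto_zero]
    refine tendsto_of_tendsto_of_tendsto_of_le_of_le tendsto_const_nhds h2 (fun _ => zero_le)
      fun n => ?_
    simpa [edist_eq_enorm_sub] using (hu (n + m)).2 γ hγ
  rw [← tendsto_add_atTop_iff_nat (f := fun n => w n (γ 0)) m,
    ← tendsto_add_atTop_iff_nat (f := fun n => w n (γ 1)) m]
  constructor
  · intro h4
    simpa using h4.sub h3
  · intro h4
    simpa using h3.add h4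

/-- A measurable function of Newtonian-Sobolev size zero vanishes off an exceptional set. -/
theorem isExceptional_ne_zero (hp : 0 < p) {w : X → F} (mw : Measurable w)
    (hw : newtonianSize μ p w = 0) : IsExceptional μ p {x | w x ≠ 0} := by
  have h := isExceptional_not_tendsto (μ := μ) hp (w := fun _ => w) (fun _ => mw) (by simp [hw])
  simpa [tendsto_const_nhds_iff] using h

theorem lineIntegral_eq_top_of_forall_mem {A : Set X} {γ : C(unitInterval, X)}
    (hγ : curveLength γ ≠ ∞) (hne : γ 0 ≠ γ 1) (hA : ∀ t, γ t ∈ A) {g : X → ℝ≥0∞}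
    (hg : ∀ x ∈ A, g x = ∞) : lineIntegral γ g = ∞ := by
  have h1 : 0 < (curveLength γ).toReal := by
    refine ENNReal.toReal_pos (fun h0 => hne ?_) hγ
    have := eVariationOn.edist_le γ (mem_univ (0 : unitInterval)) (mem_univ 1)
    rw [show eVariationOn γ univ = 0 from h0, nonpos_iff_eq_zero] at this
    exact edist_eq_zero.1 this
  rw [lineIntegral, setLIntegral_congr_fun (g := fun _ => ∞) measurableSet_Icc]
  · rw [setLIntegral_const, Real.volume_Icc, sub_zero]
    exact ENNReal.top_mul (by simpa using h1)
  · intro a ha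
    rw [← variationOnFromTo_one] at ha
    obtain ⟨s, -, rfl⟩ := exists_variationOnFromTo_eq hγ 1 ha
    simp only [naturalParameterization_variationOnFromTo hγ]
    exact hg _ (hA s)

/-- Functions that vanish off an exceptional set have Newtonian-Sobolev size zero. -/
theorem IsExceptional.newtonianSize_indicator (hp : 0 < p) {A : Set X}
    (hA : IsExceptional μ p A) (g : X → F) : newtonianSize μ p (A.indicator g) = 0 := by
  have hμA := hA.measure_eq_zero hp
  refine newtonianSize_eq_zero_of_forall hp ?_ fun ε hε => ?_
  · filter_upwards [measure_eq_zero_iff_ae_notMem.1 hμA] with x hx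
    simp [hx]
  obtain ⟨δ, δ0, hδ⟩ := ENNReal.exists_pos_sum_of_countable hε ℕ
  have h1 : ∀ n, ∃ k, IsUpperGradient (A.indicator fun _ => (1 : ℝ)) k ∧ lpSize μ p k ≤ δ n :=
    fun n => exists_isUpperGradient_lpSize_le (by simpa [hA.2] using δ0 n)
  choose h hu hle using h1
  -- The first term is infinite along curves inside `A`. Each `h n` integrates to at least one along
  -- a curve with exactly one end in `A`, so the series is infinite there.
  set H : X → ℝ≥0∞ := fun x => A.indicator (fun _ => ∞) x + ∑' n, h n x with hH
  have mS : Measurable fun x => ∑' n, h n x := Measurable.tsum fun n => (hu n).1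
  have mI : Measurable (A.indicator fun _ => (∞ : ℝ≥0∞)) := measurable_const.indicator hA.1
  have key : ∀ γ : C(unitInterval, X), curveLength γ ≠ ∞ → ¬ (γ 0 ∈ A ↔ γ 1 ∈ A) →
      lineIntegral γ H = ∞ := by
    intro γ hγ hend
    have h2 : ∀ n, 1 ≤ lineIntegral γ (h n) := fun n => by
      refine le_trans (le_of_eq ?_) ((hu n).2 γ hγ)
      by_cases h0 : γ 0 ∈ A
      · have h1 : γ 1 ∉ A := fun h' => hend ⟨fun _ => h', fun _ => h0⟩
        simp [h0, h1, edist_eq_enorm_sub]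
      · have h1 : γ 1 ∈ A := by
          by_contra h'
          exact hend ⟨fun h => absurd h h0, fun h => absurd h h'⟩
        simp [h0, h1, edist_eq_enorm_sub]
    rw [← top_le_iff, ← ENNReal.tsum_const_eq_top_of_ne_zero (α := ℕ) one_ne_zero]
    refine (ENNReal.tsum_le_tsum h2).trans ((tsum_lineIntegral_le γ h).trans ?_)
    exact lintegral_mono fun t => le_add_self
  refine ⟨H, ⟨mI.add mS, fun γ hγ => ?_⟩, ?_⟩
  · by_cases heq : γ 0 = γ 1
    · simp [heq]
    by_cases hend : γ 0 ∈ A ↔ γ 1 ∈ A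
    · by_cases h0 : γ 0 ∈ A
      · suffices lineIntegral γ H = ∞ by simp [this]
        by_cases hall : ∀ t, γ t ∈ A
        · exact lineIntegral_eq_top_of_forall_mem hγ heq hall fun x hx => by simp [hH, hx]
        -- A curve that starts in `A` and leaves it has an initial piece with exactly one end in
        -- `A`.
        · push Not at hall
          obtain ⟨t, ht⟩ := hall
          obtain ⟨γ', hγ', h0', h1', hle'⟩ := exists_initial_subcurve hγ t
          have := key γ' hγ' (by rw [h0', h1']; tauto)
          exact top_le_iff.1 (this ▸ hle' H)
      · simp [h0, show γ 1 ∉ A from fun h => h0 (hend.2 h)]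
    · simp [key γ hγ hend]
  · refine (lpSize_add_le hp mI mS).trans ?_
    rw [lpSize_eq_zero_of_ae hp, zero_add]
    · exact (lpSize_tsum_le hp fun n => (hu n).1).trans ((ENNReal.tsum_le_tsum hle).trans hδ.le)
    · filter_upwards [measure_eq_zero_iff_ae_notMem.1 hμA] with x hx
      simp [hx]

end Exceptional

/-! ### From ball growth to Hausdorff measure. -/

section MassDistribution

open Metric

variable {Y : Type*} [MetricSpace Y] [MeasurableSpace Y] [BorelSpace Y]

/-- The mass distribution principle: a measure concentrated on `G` whose balls centred on `G` have
mass at most `C r ^ s` is bounded by `C` times the Hausdorff measure. -/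
theorem measure_le_smul_hausdorffMeasure {σ : Measure Y} {G : Set Y} {s : ℝ}
    {C : ℝ≥0} (hC : C ≠ 0) (hG : ∀ t, IsClosed t → Disjoint t G → σ t = 0)
    (hb : ∀ z ∈ G, ∀ r : ℝ, 0 < r → σ (closedBall z r) ≤ C * ENNReal.ofReal r ^ s) :
    σ ≤ C • μH[s] := by
  have key : (C⁻¹ : ℝ≥0) • σ ≤ μH[s] := by
    refine Measure.le_hausdorffMeasure s _ 1 one_pos fun t ht => ?_
    have hd : ediam t ≠ ∞ := (ht.trans_lt ENNReal.one_lt_top).ne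
    rw [Measure.smul_apply, ENNReal.smul_def, smul_eq_mul, ENNReal.coe_inv hC,
      ENNReal.inv_mul_le_iff (by simpa using hC) (by simp)]
    by_cases hdis : Disjoint (closure t) G
    · rw [measure_mono_null subset_closure (hG _ isClosed_closure hdis)]
      exact zero_le
    obtain ⟨z, hzt, hzG⟩ := not_disjoint_iff.1 hdis
    have hbound : ∀ r : ℝ, (ediam t).toReal < r → σ t ≤ C * ENNReal.ofReal r ^ s := fun r hr => by
      refine (measure_mono fun y hy => ?_).trans
        (hb z hzG r (ENNReal.toReal_nonneg.trans_lt hr))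
      rw [mem_closedBall, dist_edist]
      refine (ENNReal.toReal_mono hd ?_).trans hr.le
      rw [← ediam_closure]
      exact edist_le_ediam_of_mem (subset_closure hy) hzt
    -- Balls have positive radius, so a set of diameter zero is reached only by letting the radius
    -- decrease to the diameter.
    have hlim : Tendsto (fun r : ℝ => (C : ℝ≥0∞) * ENNReal.ofReal r ^ s) (𝓝[>] (ediam t).toReal)
        (𝓝 (C * ENNReal.ofReal (ediam t).toReal ^ s)) := by
      refine ENNReal.Tendsto.const_mul ?_ (Or.inr ENNReal.coe_ne_top)
      exact ((ENNReal.continuous_rpow_const.comp ENNReal.continuous_ofReal).tendsto _).mono_left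
        nhdsWithin_le_nhds
    rw [ENNReal.ofReal_toReal hd] at hlim
    exact ge_of_tendsto hlim (eventually_nhdsWithin_of_forall hbound)
  intro t
  have := key t
  rw [Measure.smul_apply, ENNReal.smul_def, smul_eq_mul] at this ⊢
  rw [ENNReal.coe_inv hC, ENNReal.inv_mul_le_iff (by simpa using hC) (by simp)] at this
  exact this

end MassDistribution

/-! ### Frostman's lemma, by weighted coverings and the Hahn-Banach theorem. -/

section Frostman

open Metric

variable {Y : Type*} [MetricSpace Y] [CompactSpace Y] [MeasurableSpace Y] [BorelSpace Y] {s : ℝ}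

/-- Each r^s is at most the total cost, so covers of cost tending to zero also have radii tending to
zero, and the Hausdorff measure would vanish. The factor 4 leaves room for the enlargement in
Vitali's covering lemma, where any factor above 3 is allowed. -/
theorem exists_pos_le_sum_rpow_of_cover (hs : 0 < s) (hY : 0 < μH[s] (univ : Set Y)) :
    ∃ δ : ℝ, 0 < δ ∧ ∀ S : Finset (Y × Ioi (0 : ℝ)),
      (∀ y, ∃ i ∈ S, y ∈ closedBall i.1 (4 * (i.2 : ℝ))) → δ ≤ ∑ i ∈ S, (i.2 : ℝ) ^ s := by
  by_contra! hcon
  choose S hcov hsum using fun n : ℕ => hcon (1 / ((n : ℝ) + 1)) (by positivity)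
  have hr : ∀ n, ∀ i ∈ S n, (i.2 : ℝ) ≤ (1 / ((n : ℝ) + 1)) ^ s⁻¹ := fun n i hi => by
    have h1 : (i.2 : ℝ) ^ s ≤ 1 / ((n : ℝ) + 1) :=
      (Finset.single_le_sum (f := fun i : Y × Ioi (0 : ℝ) => (i.2 : ℝ) ^ s)
        (fun j _ => Real.rpow_nonneg (le_of_lt j.2.2) s) hi).trans (hsum n).le
    rwa [Real.le_rpow_inv_iff_of_pos (le_of_lt i.2.2) (by positivity) hs]
  have hd : ∀ n, ∀ i : S n, ediam (closedBall i.1.1 (4 * (i.1.2 : ℝ))) ≤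
      ENNReal.ofReal (8 * (i.1.2 : ℝ)) := fun n i => by
    rw [← closedEBall_ofReal (mul_nonneg (by norm_num) (le_of_lt i.1.2.2))]
    refine ediam_closedEBall_le.trans (le_of_eq ?_)
    rw [show (2 : ℝ≥0∞) = ENNReal.ofReal 2 by simp, ← ENNReal.ofReal_mul (by norm_num)]
    congr 1
    ring
  have ht0 : Tendsto (fun n : ℕ => 1 / ((n : ℝ) + 1)) atTop (𝓝 0) :=
    tendsto_one_div_add_atTop_nhds_zero_nat
  have hr0 : Tendsto (fun n : ℕ => ENNReal.ofReal (8 * (1 / ((n : ℝ) + 1)) ^ s⁻¹)) atTop (𝓝 0) := by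
    have := ENNReal.tendsto_ofReal ((ht0.rpow_const (p := s⁻¹)
      (Or.inr (inv_nonneg.2 hs.le))).const_mul 8)
    simpa [Real.zero_rpow (inv_ne_zero hs.ne')] using this
  have hle := Measure.hausdorffMeasure_le_liminf_sum (ι := fun n => S n) s (univ : Set Y)
    (l := atTop) _ hr0 (fun n i => closedBall i.1.1 (4 * (i.1.2 : ℝ)))
    (Eventually.of_forall fun n i => (hd n i).trans
      (ENNReal.ofReal_le_ofReal (by gcongr; exact hr n i i.2)))
    (Eventually.of_forall fun n y _ => by
      obtain ⟨i, hi, hy⟩ := hcov n y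
      exact mem_iUnion.2 ⟨⟨i, hi⟩, hy⟩)
  have hz : Tendsto (fun n : ℕ => ENNReal.ofReal (8 ^ s * (1 / ((n : ℝ) + 1)))) atTop (𝓝 0) := by
    have := ENNReal.tendsto_ofReal (ht0.const_mul ((8 : ℝ) ^ s))
    simpa using this
  have hle2 : liminf (fun n => ∑ i : S n, ediam (closedBall i.1.1 (4 * (i.1.2 : ℝ))) ^ s) atTop
      ≤ 0 := by
    rw [← hz.liminf_eq]
    refine liminf_le_liminf (Eventually.of_forall fun n => ?_)
    calc ∑ i : S n, ediam (closedBall i.1.1 (4 * (i.1.2 : ℝ))) ^ s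
        ≤ ∑ i : S n, ENNReal.ofReal (8 ^ s * (i.1.2 : ℝ) ^ s) := by
          refine Finset.sum_le_sum fun i _ => ?_
          rw [← Real.mul_rpow (by norm_num) (le_of_lt i.1.2.2),
            ← ENNReal.ofReal_rpow_of_pos (mul_pos (by norm_num) i.1.2.2)]
          exact ENNReal.rpow_le_rpow (hd n i) hs.le
      _ = ENNReal.ofReal (8 ^ s * ∑ i ∈ S n, (i.2 : ℝ) ^ s) := by
          rw [← ENNReal.ofReal_sum_of_nonneg fun i _ =>
            mul_nonneg (by positivity) (Real.rpow_nonneg (le_of_lt i.1.2.2) s),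
            ← Finset.mul_sum, Finset.sum_coe_sort (S n) fun i => (i.2 : ℝ) ^ s]
      _ ≤ _ := by gcongr; exact (hsum n).le
  exact (hY.trans_le (hle.trans hle2)).ne' rfl

/-- The covering number estimate behind Frostman's lemma, for integer weights: a family of balls
that covers each point at least `k` times contains `k` disjoint subfamilies, whose enlargements
cover the space. -/
theorem mul_le_sum_of_multicover {δ : ℝ} (hδ : ∀ S : Finset (Y × Ioi (0 : ℝ)),
      (∀ y, ∃ i ∈ S, y ∈ closedBall i.1 (4 * (i.2 : ℝ))) → δ ≤ ∑ i ∈ S, (i.2 : ℝ) ^ s)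
    (S : Finset (Y × Ioi (0 : ℝ))) (k : ℕ) (m : Y × Ioi (0 : ℝ) → ℕ)
    (hm : ∀ y, k ≤ ∑ i ∈ S, (closedBall i.1 (i.2 : ℝ)).indicator (fun _ => m i) y) :
    k * δ ≤ ∑ i ∈ S, m i * (i.2 : ℝ) ^ s := by
  classical
  induction k generalizing m with
  | zero =>
    simp only [Nat.cast_zero, zero_mul]
    exact Finset.sum_nonneg fun i _ => mul_nonneg (Nat.cast_nonneg _)
      (Real.rpow_nonneg (le_of_lt i.2.2) s)
  | succ k ih =>
    -- Vitali's lemma is applied to the balls that still have positive multiplicity. The enlarged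
    -- balls of the disjoint subfamily cover the space, which costs at least δ.
    set t : Set (Y × Ioi (0 : ℝ)) := {i | i ∈ S ∧ m i ≠ 0} with ht
    have hbd : ∀ a ∈ t, (a.2 : ℝ) ≤ ∑ i ∈ S, (i.2 : ℝ) := fun a ha =>
      Finset.single_le_sum (f := fun i : Y × Ioi (0 : ℝ) => (i.2 : ℝ))
        (fun j _ => le_of_lt j.2.2) ha.1
    obtain ⟨u, hut, hdis, hcov⟩ := Vitali.exists_disjoint_subfamily_covering_enlargement_closedBall
      t (fun i => i.1) (fun i => (i.2 : ℝ)) _ hbd 4 (by norm_num)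
    have hufin : u.Finite := S.finite_toSet.subset fun i hi => (hut hi).1
    set U := hufin.toFinset with hU
    have hUS : U ⊆ S := fun i hi => (hut (hufin.mem_toFinset.1 hi)).1
    have hUm : ∀ i ∈ U, 1 ≤ m i := fun i hi =>
      Nat.one_le_iff_ne_zero.2 (hut (hufin.mem_toFinset.1 hi)).2
    have hsub : ∀ {R : Type} [AddCommMonoid R] (f : Y × Ioi (0 : ℝ) → R),
        ∑ i ∈ U, f i = ∑ i ∈ S, if i ∈ U then f i else 0 := fun f => by
      rw [Finset.sum_ite_mem, Finset.inter_eq_right.2 hUS]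
    have h1 : δ ≤ ∑ i ∈ U, (i.2 : ℝ) ^ s := by
      refine hδ U fun y => ?_
      have hpos : 0 < ∑ i ∈ S, (closedBall i.1 (i.2 : ℝ)).indicator (fun _ => m i) y :=
        (Nat.succ_pos k).trans_le (hm y)
      obtain ⟨i, hiS, hi⟩ := Finset.exists_ne_zero_of_sum_ne_zero hpos.ne'
      have hyi : y ∈ closedBall i.1 (i.2 : ℝ) := mem_of_indicator_ne_zero hi
      rw [indicator_of_mem hyi] at hi
      obtain ⟨b, hb, hsub⟩ := hcov i ⟨hiS, hi⟩
      exact ⟨b, hufin.mem_toFinset.2 hb, hsub hyi⟩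
    -- Removing one copy of each selected ball lowers the multiplicity of a point by at most one,
    -- because the selected balls are disjoint.
    have h2 := ih (fun i => m i - if i ∈ U then 1 else 0) fun y => by
      have hone : ∑ i ∈ U, (closedBall i.1 (i.2 : ℝ)).indicator (fun _ => 1) y ≤ 1 := by
        rw [Finset.sum_indicator_eq_sum_filter, Finset.sum_const, smul_eq_mul, mul_one,
          Finset.card_le_one]
        intro a ha b hb
        rw [Finset.mem_filter, hufin.mem_toFinset] at ha hb
        by_contra hab
        exact disjoint_left.1 (hdis ha.1 hb.1 hab) ha.2 hb.2
      have hsplit : ∑ i ∈ S, (closedBall i.1 (i.2 : ℝ)).indicator (fun _ => m i) y =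
          ∑ i ∈ S, (closedBall i.1 (i.2 : ℝ)).indicator
            (fun _ => m i - if i ∈ U then 1 else 0) y +
          ∑ i ∈ U, (closedBall i.1 (i.2 : ℝ)).indicator (fun _ => 1) y := by
        rw [hsub fun i => (closedBall i.1 (i.2 : ℝ)).indicator (fun _ => 1) y,
          ← Finset.sum_add_distrib]
        refine Finset.sum_congr rfl fun i _ => ?_
        by_cases hy : y ∈ closedBall i.1 (i.2 : ℝ)
        · simp only [indicator_of_mem hy]
          by_cases hi : i ∈ U
          · have := hUm i hi
            simp only [hi, if_true]
            omega
          · simp [hi]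
        · simp [hy]
      have := hm y
      omega
    have h3 : ∑ i ∈ S, (m i : ℝ) * (i.2 : ℝ) ^ s =
        ∑ i ∈ S, ((m i - if i ∈ U then 1 else 0 : ℕ) : ℝ) * (i.2 : ℝ) ^ s +
          ∑ i ∈ U, (i.2 : ℝ) ^ s := by
      rw [hsub fun i => (i.2 : ℝ) ^ s, ← Finset.sum_add_distrib]
      refine Finset.sum_congr rfl fun i _ => ?_
      by_cases hi : i ∈ U
      · have := hUm i hi
        simp only [hi, if_true]
        push_cast [this]
        ring
      · simp [hi]
    rw [h3]
    push_cast
    linarith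

/-- The cost of a weighted family of balls. -/
noncomputable def ballCost (s : ℝ) : (Y × Ioi (0 : ℝ) →₀ ℝ≥0) →ₗ[ℝ≥0] ℝ :=
  Finsupp.linearCombination ℝ≥0 fun i => (i.2 : ℝ) ^ s

/-- The total weight of the balls of a weighted family that contain a given point. -/
noncomputable def ballWeight (y : Y) : (Y × Ioi (0 : ℝ) →₀ ℝ≥0) →ₗ[ℝ≥0] ℝ :=
  Finsupp.linearCombination ℝ≥0 fun i => (closedBall i.1 (i.2 : ℝ)).indicator (fun _ => 1) y

theorem ballCost_nonneg (w : Y × Ioi (0 : ℝ) →₀ ℝ≥0) : 0 ≤ ballCost s w := by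
  rw [ballCost, Finsupp.linearCombination_apply]
  exact Finset.sum_nonneg fun i _ => smul_nonneg zero_le (Real.rpow_nonneg (le_of_lt i.2.2) s)

/-- Real weights are multiplied by k and rounded up, so that the estimate for integer weights
applies. The rounding error is at most `R`, independently of k, and disappears on division by k. -/
theorem exists_pos_le_ballCost (hs : 0 < s) (hY : 0 < μH[s] (univ : Set Y)) :
    ∃ δ : ℝ, 0 < δ ∧ ∀ w : Y × Ioi (0 : ℝ) →₀ ℝ≥0, (∀ y, 1 ≤ ballWeight y w) →
      δ ≤ ballCost s w := by
  obtain ⟨δ, hδ0, hδ⟩ := exists_pos_le_sum_rpow_of_cover hs hY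
  refine ⟨δ, hδ0, fun w hw => ?_⟩
  set R := ∑ i ∈ w.support, (i.2 : ℝ) ^ s
  have key : ∀ k : ℕ, k * δ ≤ k * ballCost s w + R := fun k => by
    have h1 := mul_le_sum_of_multicover hδ w.support k (fun i => ⌈(k : ℝ) * w i⌉₊) fun y => by
      have h2 : (k : ℝ) ≤ ∑ i ∈ w.support, (closedBall i.1 (i.2 : ℝ)).indicator
          (fun _ => (⌈(k : ℝ) * w i⌉₊ : ℝ)) y := by
        calc (k : ℝ) ≤ k * ballWeight y w := le_mul_of_one_le_right (Nat.cast_nonneg _) (hw y)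
          _ ≤ _ := by
            rw [ballWeight, Finsupp.linearCombination_apply, Finsupp.sum, Finset.mul_sum]
            refine Finset.sum_le_sum fun i _ => ?_
            by_cases hy : y ∈ closedBall i.1 (i.2 : ℝ)
            · simp only [indicator_of_mem hy, NNReal.smul_def, smul_eq_mul, mul_one]
              exact Nat.le_ceil _
            · simp [hy]
      have h3 : ((∑ i ∈ w.support, (closedBall i.1 (i.2 : ℝ)).indicator
          (fun _ => ⌈(k : ℝ) * w i⌉₊) y : ℕ) : ℝ) = ∑ i ∈ w.support,
            (closedBall i.1 (i.2 : ℝ)).indicator (fun _ => (⌈(k : ℝ) * w i⌉₊ : ℝ)) y := by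
        push_cast
        refine Finset.sum_congr rfl fun i _ => ?_
        by_cases hy : y ∈ closedBall i.1 (i.2 : ℝ) <;> simp [hy]
      exact_mod_cast h3 ▸ h2
    refine h1.trans ?_
    rw [ballCost, Finsupp.linearCombination_apply, Finsupp.sum, Finset.mul_sum,
      ← Finset.sum_add_distrib]
    refine Finset.sum_le_sum fun i _ => ?_
    have h4 : (0 : ℝ) ≤ (i.2 : ℝ) ^ s := Real.rpow_nonneg (le_of_lt i.2.2) s
    have h5 : (⌈(k : ℝ) * w i⌉₊ : ℝ) ≤ k * w i + 1 := (Nat.ceil_lt_add_one (by positivity)).le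
    calc (⌈(k : ℝ) * w i⌉₊ : ℝ) * (i.2 : ℝ) ^ s ≤ (k * w i + 1) * (i.2 : ℝ) ^ s := by gcongr
      _ = _ := by rw [NNReal.smul_def, smul_eq_mul]; ring
  by_contra! hlt
  obtain ⟨k, hk⟩ := exists_nat_gt (R / (δ - ballCost s w))
  rw [div_lt_iff₀ (sub_pos.2 hlt)] at hk
  linarith [key k]

/-- The sublinear functional whose linear minorants are the Frostman measures. -/
noncomputable def frostmanGauge (s : ℝ) (f : CompactlySupportedContinuousMap Y ℝ) : ℝ :=
  sInf (ballCost s '' {w | ∀ y, f y ≤ ballWeight y w})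

theorem frostmanGauge_le {f : CompactlySupportedContinuousMap Y ℝ} {w : Y × Ioi (0 : ℝ) →₀ ℝ≥0}
    (h : ∀ y, f y ≤ ballWeight y w) : frostmanGauge s f ≤ ballCost s w :=
  csInf_le ⟨0, by rintro _ ⟨w, -, rfl⟩; exact ballCost_nonneg w⟩ ⟨w, h, rfl⟩

theorem exists_le_ballWeight (f : CompactlySupportedContinuousMap Y ℝ) :
    ∃ w : Y × Ioi (0 : ℝ) →₀ ℝ≥0, ∀ y, f y ≤ ballWeight y w := by
  rcases isEmpty_or_nonempty Y with h | ⟨⟨y₀⟩⟩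
  · exact ⟨0, fun y => h.elim y⟩
  obtain ⟨M, hM⟩ := (isCompact_range f.continuous).bddAbove
  -- One ball containing the whole space, with weight a bound for f. The summand 1 keeps the radius
  -- positive if the diameter is zero.
  refine ⟨Finsupp.single (y₀, ⟨diam (univ : Set Y) + 1, by
    have := diam_nonneg (s := (univ : Set Y)); simp only [mem_Ioi]; linarith⟩) M.toNNReal,
    fun y => ?_⟩
  have hy : y ∈ closedBall y₀ (diam (univ : Set Y) + 1) := by
    rw [mem_closedBall]
    have := dist_le_diam_of_mem isCompact_univ.isBounded (mem_univ y) (mem_univ y₀)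
    linarith
  rw [ballWeight, Finsupp.linearCombination_single]
  simp only [indicator_of_mem hy, NNReal.smul_def, smul_eq_mul, mul_one]
  exact (hM (mem_range_self y)).trans (Real.le_coe_toNNReal M)

theorem le_frostmanGauge {f : CompactlySupportedContinuousMap Y ℝ} {c : ℝ}
    (h : ∀ w : Y × Ioi (0 : ℝ) →₀ ℝ≥0, (∀ y, f y ≤ ballWeight y w) → c ≤ ballCost s w) :
    c ≤ frostmanGauge s f :=
  le_csInf (Set.Nonempty.image _ (exists_le_ballWeight f))
    (by rintro _ ⟨w, hw, rfl⟩; exact h w hw)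

theorem frostmanGauge_add_le (f g : CompactlySupportedContinuousMap Y ℝ) :
    frostmanGauge s (f + g) ≤ frostmanGauge s f + frostmanGauge s g := by
  rw [← sub_le_iff_le_add]
  refine le_frostmanGauge fun w hw => ?_
  rw [sub_le_comm]
  refine le_frostmanGauge fun v hv => ?_
  rw [sub_le_iff_le_add, ← map_add]
  refine frostmanGauge_le fun y => ?_
  rw [map_add, add_comm (ballWeight y v)]
  exact add_le_add (hw y) (hv y)

theorem frostmanGauge_smul_le {c : ℝ} (hc : 0 < c) (f : CompactlySupportedContinuousMap Y ℝ) :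
    frostmanGauge s (c • f) ≤ c * frostmanGauge s f := by
  rw [← div_le_iff₀' hc]
  refine le_frostmanGauge fun w hw => ?_
  rw [div_le_iff₀' hc]
  have h1 : ballCost s ((NNReal.mk c hc.le) • w) = c * ballCost s w := by
    rw [map_smul]; rfl
  rw [← h1]
  refine frostmanGauge_le fun y => ?_
  rw [map_smul]
  exact mul_le_mul_of_nonneg_left (hw y) hc.le

theorem frostmanGauge_smul {c : ℝ} (hc : 0 < c) (f : CompactlySupportedContinuousMap Y ℝ) :
    frostmanGauge s (c • f) = c * frostmanGauge s f := by
  refine le_antisymm (frostmanGauge_smul_le hc f) ?_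
  have := frostmanGauge_smul_le (s := s) (inv_pos.2 hc) (c • f)
  rw [smul_smul, inv_mul_cancel₀ hc.ne', one_smul] at this
  rwa [← le_inv_mul_iff₀ hc]

theorem frostmanGauge_nonpos {f : CompactlySupportedContinuousMap Y ℝ} (hf : ∀ y, f y ≤ 0) :
    frostmanGauge s f ≤ 0 := by
  simpa using frostmanGauge_le (s := s) (f := f) (w := 0) (by simpa using hf)

/-- Frostman's lemma for compact metric spaces. -/
theorem exists_frostman_measure_of_compactSpace (hs : 0 < s) (hY : 0 < μH[s] (univ : Set Y)) :
    ∃ ν : Measure Y, IsFiniteMeasure ν ∧ ν univ ≠ 0 ∧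
      ∀ x, ∀ r : ℝ, 0 < r → ν (closedBall x r) ≤ ENNReal.ofReal ((2 * r) ^ s) := by
  have hne : Nonempty Y := by
    by_contra h
    rw [not_nonempty_iff] at h
    simp [univ_eq_empty_iff.2 h] at hY
  obtain ⟨δ, hδ0, hδ⟩ := exists_pos_le_ballCost hs hY
  set e : CompactlySupportedContinuousMap Y ℝ :=
    ⟨ContinuousMap.const Y 1, HasCompactSupport.of_compactSpace _⟩ with he
  have he1 : ∀ y, e y = 1 := fun y => rfl
  have hNe : 0 < frostmanGauge s e := hδ0.trans_le (le_frostmanGauge fun w hw => hδ w hw)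
  have he0 : ∀ c : ℝ, c • e = 0 → RingHom.id ℝ c • frostmanGauge s e = 0 := fun c h => by
    have h1 := DFunLike.congr_fun h hne.some
    have h2 : c = 0 := by simpa [he1] using h1
    simp [h2]
  -- Hahn-Banach: the functional that sends c • e to c times the gauge of e is dominated by the
  -- gauge on the line through e, and extends with the same domination.
  obtain ⟨Λ, hΛe, hΛ⟩ := exists_extension_of_le_sublinear
    (LinearPMap.mkSpanSingleton' (σ := RingHom.id ℝ) e (frostmanGauge s e) he0) (frostmanGauge s)
    (fun c hc f => frostmanGauge_smul hc f) frostmanGauge_add_le (by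
      rintro ⟨x, hx⟩
      obtain ⟨c, rfl⟩ := Submodule.mem_span_singleton.1 hx
      rw [LinearPMap.mkSpanSingleton'_apply]
      simp only [RingHom.id_apply, smul_eq_mul]
      rcases lt_trichotomy c 0 with hc | rfl | hc
      · have h1 := frostmanGauge_add_le (s := s) (c • e) ((-c) • e)
        have h2 : frostmanGauge s (c • e + (-c) • e) = 0 := by
          rw [show c • e + (-c) • e = 0 by ext y; simp [he1]]
          refine le_antisymm (frostmanGauge_nonpos fun y => le_rfl)
            (le_frostmanGauge fun w _ => ballCost_nonneg w)
        rw [h2, frostmanGauge_smul (neg_pos.2 hc)] at h1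
        linarith
      · rw [zero_mul]
        exact le_frostmanGauge fun w _ => ballCost_nonneg w
      · rw [frostmanGauge_smul hc])
  have hΛ1 : Λ e = frostmanGauge s e :=
    (hΛe ⟨e, Submodule.mem_span_singleton_self e⟩).trans
      (LinearPMap.mkSpanSingleton'_apply_self _ _ _ _)
  -- Positivity comes from domination: the gauge of a nonpositive function is at most zero, as the
  -- empty family of balls shows.
  have hpos : ∀ f, 0 ≤ f → 0 ≤ Λ f := fun f hf => by
    have h1 := (hΛ (-f)).trans (frostmanGauge_nonpos fun y => neg_nonpos.2 (hf y))
    rw [map_neg] at h1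
    linarith
  set L := PositiveLinearMap.mk₀ Λ hpos with hL
  have hLΛ : ∀ f, L f = Λ f := fun f => rfl
  refine ⟨RealRMK.rieszMeasure L, ⟨?_⟩, fun h0 => ?_, fun x r hr => ?_⟩
  · exact (RealRMK.rieszMeasure_le_of_eq_one L (fun y => (zero_le_one : (0 : ℝ) ≤ 1))
      isCompact_univ fun y _ => he1 y).trans_lt ENNReal.ofReal_lt_top
  · have h1 := RealRMK.le_rieszMeasure_tsupport_subset L (f := e) (V := univ)
      (fun y => by simp [he1]) (subset_univ _)
    rw [h0, nonpos_iff_eq_zero, ENNReal.ofReal_eq_zero, hLΛ, hΛ1] at h1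
    exact absurd hNe (not_lt.2 h1)
  -- The cutoff equals one on the ball of radius r and vanishes off the ball of radius 2r, which by
  -- itself bounds its gauge by (2r)^s.
  · set f : CompactlySupportedContinuousMap Y ℝ :=
      ⟨⟨fun y => max 0 (min 1 (2 - dist y x / r)), by fun_prop⟩,
        HasCompactSupport.of_compactSpace _⟩ with hf
    have hfy : ∀ y, f y = max 0 (min 1 (2 - dist y x / r)) := fun y => rfl
    refine (RealRMK.rieszMeasure_le_of_eq_one L (f := f) (fun y => le_max_left _ _)
      isClosed_closedBall.isCompact fun y hy => ?_).trans (ENNReal.ofReal_le_ofReal ?_)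
    · rw [mem_closedBall, ← div_le_one₀ hr] at hy
      rw [hfy, min_eq_left (by linarith), max_eq_right zero_le_one]
    · rw [hLΛ]
      refine (hΛ f).trans ?_
      have h1 : frostmanGauge s f ≤ ballCost s
          (Finsupp.single (x, (⟨2 * r, mul_pos two_pos hr⟩ : Ioi (0 : ℝ))) 1) := by
        refine frostmanGauge_le fun y => ?_
        rw [ballWeight, Finsupp.linearCombination_single, one_smul, hfy]
        by_cases hy : y ∈ closedBall x (2 * r)
        · simp [indicator_of_mem hy]
        · have h2 : 2 < dist y x / r := by
            rw [lt_div_iff₀ hr]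
            simpa using hy
          rw [indicator_of_notMem hy]
          refine max_le le_rfl ((min_le_right _ _).trans (by linarith))
      refine h1.trans (le_of_eq ?_)
      rw [ballCost, Finsupp.linearCombination_single, one_smul]

end Frostman

section Frostman

open Metric

/-- Frostman's lemma for compact subsets of metric spaces. -/
theorem exists_frostman_measure {X : Type*} [MetricSpace X] [MeasurableSpace X] [BorelSpace X]
    {s : ℝ} (hs : 0 < s) {E : Set X} (hE : IsCompact E) (hHE : 0 < μH[s] E) :
    ∃ ν : Measure X, IsFiniteMeasure ν ∧ ν Eᶜ = 0 ∧ ν E ≠ 0 ∧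
      ∃ C : ℝ≥0, C ≠ 0 ∧ ∀ x, ∀ r : ℝ, 0 < r → ν (closedBall x r) ≤ C * ENNReal.ofReal r ^ s := by
  have : CompactSpace E := isCompact_iff_compactSpace.1 hE
  have h1 : 0 < μH[s] (univ : Set E) := by
    rw [← isometry_subtype_coe.hausdorffMeasure_image (Or.inl hs.le), image_univ,
      Subtype.range_coe]
    exact hHE
  obtain ⟨ν, hfin, h0, hν⟩ := exists_frostman_measure_of_compactSpace hs h1
  refine ⟨ν.map (↑), inferInstance, ?_, ?_, ⟨4 ^ s, by positivity⟩,
    fun h => (Real.rpow_pos_of_pos (by norm_num : (0 : ℝ) < 4) s).ne'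
      (congrArg NNReal.toReal h), fun x r hr => ?_⟩
  · rw [Measure.map_apply measurable_subtype_coe hE.measurableSet.compl]
    simp
  · rw [Measure.map_apply measurable_subtype_coe hE.measurableSet]
    simpa using h0
  · rw [Measure.map_apply measurable_subtype_coe measurableSet_closedBall]
    rcases ((↑) ⁻¹' closedBall x r : Set E).eq_empty_or_nonempty with h | ⟨y, hy⟩
    · simp [h]
    -- The estimate in `E` is for centres in `E`. A ball that meets `E` at y lies, within `E`, in
    -- the ball of twice the radius about y; hence the constant 4^s.
    have hsub : ((↑) ⁻¹' closedBall x r : Set E) ⊆ closedBall y (2 * r) := fun z hz => by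
      have h1 : dist (z : X) x ≤ r := hz
      have h2 : dist (y : X) x ≤ r := hy
      rw [mem_closedBall, Subtype.dist_eq]
      linarith [dist_triangle_right (z : X) y x]
    refine (measure_mono hsub).trans ((hν y (2 * r) (by positivity)).trans (le_of_eq ?_))
    rw [show (2 : ℝ) * (2 * r) = 4 * r by ring, Real.mul_rpow (by norm_num) hr.le,
      ENNReal.ofReal_mul (by positivity), ENNReal.ofReal_rpow_of_pos hr]
    congr 1
    exact ENNReal.ofReal_eq_coe_nnreal _

end Frostman

/-! ### Finite energy bounds the dimension of images from below. -/

section Energy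

open Metric

variable {X Y : Type*} [MeasurableSpace X] [MetricSpace Y] [MeasurableSpace Y] [BorelSpace Y]
  [SecondCountableTopology Y]

/-- If the image of the finite measure `ν` under `f` has finite `t`-energy, then the images of all
sets of positive measure have dimension at least `t`. -/
theorem le_dimH_image_of_energy {ν : Measure X} [IsFiniteMeasure ν] {f : X → Y}
    (hf : Measurable f) {t : ℝ} (ht : 0 ≤ t)
    (hE : ∫⁻ x, ∫⁻ y, edist (f x) (f y) ^ (-t) ∂ν ∂ν ≠ ∞) {A : Set X} (hA : MeasurableSet A)
    (hνA : ν A ≠ 0) : ENNReal.ofReal t ≤ dimH (f '' A) := by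
  set V : X → ℝ≥0∞ := fun x => ∫⁻ y, edist (f x) (f y) ^ (-t) ∂ν with hV
  have mV : Measurable V := Measurable.lintegral_prod_right
    (((hf.comp measurable_fst).edist (hf.comp measurable_snd)).pow_const _)
  -- The potential V is finite almost everywhere, so one of its sublevel sets meets A in positive
  -- measure.
  obtain ⟨M, hM⟩ : ∃ M : ℕ, ν (A ∩ {x | V x ≤ M}) ≠ 0 := by
    by_contra! h0
    refine hνA (measure_mono_null (fun x hx => ?_) (measure_union_null
      (measure_iUnion_null h0) (ae_iff.1 (ae_lt_top mV hE))))
    by_cases hVx : V x < ∞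
    · obtain ⟨n, hn⟩ := ENNReal.exists_nat_gt hVx.ne
      exact Or.inl (mem_iUnion.2 ⟨n, hx, hn.le⟩)
    · exact Or.inr hVx
  set G := A ∩ {x | V x ≤ M} with hG
  have mG : MeasurableSet G := hA.inter (measurableSet_le mV measurable_const)
  set σ := (ν.restrict G).map f with hσ
  have hle : σ ≤ ((M : ℝ≥0) + 1) • μH[t] := by
    refine measure_le_smul_hausdorffMeasure (G := f '' G) (by positivity) (fun s hs hd => ?_) ?_
    · rw [hσ, Measure.map_apply hf hs.measurableSet, Measure.restrict_apply
        (hf hs.measurableSet)]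
      refine measure_mono_null (fun x hx => ?_) measure_empty
      exact disjoint_left.1 hd hx.1 ⟨x, hx.2, rfl⟩
    · rintro _ ⟨x, hx, rfl⟩ r hr
      rw [hσ, Measure.map_apply hf measurableSet_closedBall]
      refine (Measure.restrict_apply_le _ _).trans ?_
      -- Chebyshev's inequality: on this preimage the integrand of V is at least r^(-t).
      have h1 : ENNReal.ofReal r ^ (-t) * ν (f ⁻¹' closedBall (f x) r) ≤ M + 1 := by
        calc ENNReal.ofReal r ^ (-t) * ν (f ⁻¹' closedBall (f x) r)
            = ∫⁻ _ in f ⁻¹' closedBall (f x) r, ENNReal.ofReal r ^ (-t) ∂ν := by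
              rw [setLIntegral_const]
          _ ≤ ∫⁻ y in f ⁻¹' closedBall (f x) r, edist (f x) (f y) ^ (-t) ∂ν := by
              refine setLIntegral_mono' (hf measurableSet_closedBall) fun y hy => ?_
              rw [ENNReal.rpow_neg, ENNReal.rpow_neg, ENNReal.inv_le_inv]
              refine ENNReal.rpow_le_rpow ?_ ht
              rw [edist_comm, edist_dist]
              exact ENNReal.ofReal_le_ofReal hy
          _ ≤ V x := setLIntegral_le_lintegral _ _
          _ ≤ M := hx.2
          _ ≤ M + 1 := le_self_add
      have hr0 : ENNReal.ofReal r ^ t ≠ 0 := by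
        simp [ENNReal.rpow_eq_zero_iff, hr, ENNReal.ofReal_ne_top]
      have hrt : ENNReal.ofReal r ^ t ≠ ∞ :=
        ENNReal.rpow_ne_top_of_nonneg ht ENNReal.ofReal_ne_top
      rw [ENNReal.rpow_neg, ENNReal.inv_mul_le_iff hr0 hrt, mul_comm] at h1
      simpa using h1
  have hne : μH[t] (f '' A) ≠ 0 := by
    intro h0
    -- The image of A need not be measurable, so σ is evaluated on a measurable hull.
    have h1 : μH[t] (toMeasurable μH[t] (f '' A)) = 0 := by rw [measure_toMeasurable, h0]
    have h2 := hle (toMeasurable μH[t] (f '' A))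
    rw [Measure.smul_apply, h1, smul_zero, nonpos_iff_eq_zero, hσ,
      Measure.map_apply hf (measurableSet_toMeasurable _ _),
      Measure.restrict_apply (hf (measurableSet_toMeasurable _ _))] at h2
    have hsub : G ⊆ f ⁻¹' toMeasurable μH[t] (f '' A) ∩ G := fun x hx =>
      ⟨subset_toMeasurable _ _ (mem_image_of_mem f hx.1), hx⟩
    exact hM (measure_mono_null hsub h2)
  lift t to ℝ≥0 using ht
  rw [ENNReal.ofReal_coe_nnreal]
  exact le_dimH_of_hausdorffMeasure_ne_zero hne

end Energy

/-! ### Separated nets and bounded overlap. -/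

section Nets

open Metric

variable {X : Type*} [MetricSpace X]

theorem IsCompact.exists_separated_net {K : Set X} (hK : IsCompact K) {r : ℝ} (hr : 0 < r) :
    ∃ I : Finset X, ↑I ⊆ K ∧ (∀ x ∈ I, ∀ y ∈ I, x ≠ y → r < dist x y) ∧
      ∀ x ∈ K, ∃ z ∈ I, dist x z ≤ r := by
  -- A set with separation 2ε has at most as many points as a cover by sets of radius ε. Total
  -- boundedness therefore makes a maximal r-separated set finite.
  set ε : ℝ≥0 := ⟨r / 2, by positivity⟩ with hε
  have hε0 : ε ≠ 0 := fun h => by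
    have : r / 2 = 0 := congrArg NNReal.toReal h
    linarith
  have h2ε : ((2 * ε : ℝ≥0) : ℝ) = r := by
    push_cast
    change 2 * (r / 2) = r
    ring
  obtain ⟨C, -, hCfin, hC⟩ := exists_finite_isCover_of_totallyBounded hε0 hK.totallyBounded
  have hpack : packingNumber (2 * ε) K ≠ ⊤ := ne_top_of_le_ne_top (encard_ne_top_iff.2 hCfin)
    ((packingNumber_two_mul_le_externalCoveringNumber ε K).trans
      hC.externalCoveringNumber_le_encard)
  have hfin : (maximalSeparatedSet (2 * ε) K).Finite := by
    rw [← encard_ne_top_iff, encard_maximalSeparatedSet hpack]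
    exact hpack
  refine ⟨hfin.toFinset, by simpa using maximalSeparatedSet_subset, fun x hx y hy hxy => ?_,
    fun x hx => ?_⟩
  · rw [hfin.mem_toFinset] at hx hy
    have : ((2 * ε : ℝ≥0) : ℝ≥0∞) < edist x y := isSeparated_maximalSeparatedSet hx hy hxy
    rw [edist_nndist, ENNReal.coe_lt_coe] at this
    rw [← h2ε]
    exact_mod_cast this
  · obtain ⟨z, hz, hxz⟩ := isCover_maximalSeparatedSet hpack hx
    refine ⟨z, hfin.mem_toFinset.2 hz, ?_⟩
    have : edist x z ≤ (2 * ε : ℝ≥0) := hxz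
    rw [edist_nndist, ENNReal.coe_le_coe] at this
    rw [← h2ε]
    exact_mod_cast this

variable [ProperSpace X] [MeasurableSpace X] [BorelSpace X] {μ : Measure X}
  [IsLocallyFiniteMeasure μ] {Q : ℝ}

/-- On compact sets, the Ahlfors regularity estimates extend to all bounded radii. -/
theorem LocallyAhlforsRegular.exists_bounds (hX : LocallyAhlforsRegular μ Q) (hQ : 0 < Q)
    {K : Set X} (hK : IsCompact K) {S : ℝ} (hS : 0 < S) :
    ∃ C : ℝ, 0 < C ∧ ∀ x ∈ K, ∀ r : ℝ, 0 < r → r ≤ S →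
      ENNReal.ofReal (r ^ Q / C) ≤ μ (ball x r) ∧ μ (ball x r) ≤ ENNReal.ofReal (C * r ^ Q) := by
  obtain ⟨R, hR, C₀, hC₀, h⟩ := hX K hK
  set m := (μ (cthickening S K)).toReal with hm
  have hmt : μ (cthickening S K) ≠ ∞ := hK.cthickening.measure_lt_top.ne
  -- For radii from R to S, C₁ serves the upper bound, through the measure of the thickening, and C₂
  -- the lower bound, through the ball of radius R/2.
  set C₁ := m / R ^ Q with hC₁
  set C₂ := C₀ * S ^ Q / (R / 2) ^ Q with hC₂
  have hRQ : 0 < R ^ Q := by positivity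
  have hC₁0 : 0 ≤ C₁ := div_nonneg ENNReal.toReal_nonneg hRQ.le
  have hC₂0 : 0 < C₂ := by positivity
  refine ⟨C₀ + C₁ + C₂, by positivity, fun x hx r hr hrS => ?_⟩
  have hrQ : 0 < r ^ Q := by positivity
  rcases lt_or_ge r R with hlt | hge
  · obtain ⟨h1, h2⟩ := h x hx r hr hlt
    refine ⟨le_trans (ENNReal.ofReal_le_ofReal ?_) h1,
      h2.trans (ENNReal.ofReal_le_ofReal ?_)⟩
    · gcongr
      linarith
    · gcongr
      linarith
  · constructor
    · refine le_trans (ENNReal.ofReal_le_ofReal ?_)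
        ((h x hx (R / 2) (by positivity) (by linarith)).1.trans
          (measure_mono (ball_subset_ball (by linarith))))
      have h1 : r ^ Q ≤ S ^ Q := Real.rpow_le_rpow hr.le hrS hQ.le
      calc r ^ Q / (C₀ + C₁ + C₂) ≤ S ^ Q / C₂ := by
            gcongr
            linarith
        _ = _ := by rw [hC₂]; field_simp
    · calc μ (ball x r) ≤ μ (cthickening S K) := measure_mono <|
            (ball_subset_closedBall.trans (closedBall_subset_closedBall hrS)).trans
              (closedBall_subset_cthickening hx S)
        _ = ENNReal.ofReal m := (ENNReal.ofReal_toReal hmt).symm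
        _ ≤ _ := by
            refine ENNReal.ofReal_le_ofReal ?_
            have h1 : R ^ Q ≤ r ^ Q := Real.rpow_le_rpow hR.le hge hQ.le
            calc m = C₁ * R ^ Q := by rw [hC₁]; field_simp
              _ ≤ (C₀ + C₁ + C₂) * r ^ Q := by
                  gcongr
                  linarith

/-- The balls of radius r/2 about the net points are disjoint, and those within 11r of x all lie in
the ball of radius 24r about one of them. Comparing measures bounds their number; 48 is the ratio of
the radii. -/
theorem card_filter_dist_le {C S : ℝ} (hC : 0 < C) {K : Set X}
    (h : ∀ x ∈ K, ∀ r : ℝ, 0 < r → r ≤ S →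
      ENNReal.ofReal (r ^ Q / C) ≤ μ (ball x r) ∧ μ (ball x r) ≤ ENNReal.ofReal (C * r ^ Q))
    {r : ℝ} (hr : 0 < r) (hrS : 24 * r ≤ S) {I : Finset X} (hI : ↑I ⊆ K)
    (hsep : ∀ x ∈ I, ∀ y ∈ I, x ≠ y → r < dist x y) (x : X) :
    ((I.filter fun z => dist x z ≤ 11 * r).card : ℝ) ≤ C ^ 2 * 48 ^ Q := by
  set J := I.filter fun z => dist x z ≤ 11 * r with hJ
  rcases J.eq_empty_or_nonempty with hJe | ⟨z₀, hz₀⟩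
  · rw [hJe, Finset.card_empty, Nat.cast_zero]
    positivity
  have hmem : ∀ z ∈ J, z ∈ I ∧ dist x z ≤ 11 * r := fun z hz => Finset.mem_filter.1 hz
  have hdis : (J : Set X).PairwiseDisjoint fun z => ball z (r / 2) := fun a ha b hb hab =>
    ball_disjoint_ball (by linarith [hsep a (hmem a ha).1 b (hmem b hb).1 hab])
  have h1 : ∑ z ∈ J, μ (ball z (r / 2)) ≤ μ (ball z₀ (24 * r)) := by
    rw [← measure_biUnion_finset hdis fun _ _ => measurableSet_ball]
    refine measure_mono (iUnion₂_subset fun z hz => ball_subset_ball' ?_)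
    have := dist_triangle_left z z₀ x
    linarith [(hmem z hz).2, (hmem z₀ hz₀).2]
  have h2 : (J.card : ℝ≥0∞) * ENNReal.ofReal ((r / 2) ^ Q / C) ≤
      ENNReal.ofReal (C * (24 * r) ^ Q) := by
    refine le_trans ?_ (h1.trans (h z₀ (hI (hmem z₀ hz₀).1) _ (by positivity) hrS).2)
    rw [← nsmul_eq_mul]
    exact Finset.card_nsmul_le_sum _ _ _ fun z hz =>
      (h z (hI (hmem z hz).1) _ (by positivity) (by linarith)).1
  rw [← ENNReal.ofReal_natCast, ← ENNReal.ofReal_mul (by positivity),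
    ENNReal.ofReal_le_ofReal_iff (by positivity)] at h2
  have h3 : (24 * r) ^ Q = 48 ^ Q * (r / 2) ^ Q := by
    rw [← Real.mul_rpow (by norm_num) (by positivity)]
    congr 1
    ring
  have h4 : 0 < (r / 2) ^ Q := by positivity
  rw [h3, mul_div_assoc', div_le_iff₀ hC] at h2
  refine le_of_mul_le_mul_right ?_ h4
  linarith

end Nets

/-! ### Upper gradients of sums and series. -/

section UpperGradientSums

variable {X : Type*} [MetricSpace X] [MeasurableSpace X] {F : Type*} [NormedAddCommGroup F]
  [NormedSpace ℝ F]

theorem IsUpperGradient.mono {f : X → F} {g h : X → ℝ≥0∞} (hg : IsUpperGradient f g)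
    (hh : Measurable h) (hle : ∀ x, g x ≤ h x) : IsUpperGradient f h :=
  ⟨hh, fun γ hγ => (hg.2 γ hγ).trans (lintegral_mono fun _ => hle _)⟩

theorem IsUpperGradient.finset_sum {ι : Type*} {f : ι → X → F} {g : ι → X → ℝ≥0∞}
    (s : Finset ι) (h : ∀ i ∈ s, IsUpperGradient (f i) (g i)) :
    IsUpperGradient (fun x => ∑ i ∈ s, f i x) (fun x => ∑ i ∈ s, g i x) := by
  classical
  induction s using Finset.induction_on with
  | empty =>
    simp only [Finset.sum_empty]
    exact IsUpperGradient.zero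
  | insert a s ha ih =>
    simp only [Finset.sum_insert ha]
    exact (h a (s.mem_insert_self a)).add (ih fun i hi => h i (Finset.mem_insert_of_mem hi))

theorem IsUpperGradient.tsum [CompleteSpace F] {f : ℕ → X → F} {g : ℕ → X → ℝ≥0∞}
    (h : ∀ j, IsUpperGradient (f j) (g j)) (hf : ∀ x, Summable fun j => f j x) :
    IsUpperGradient (fun x => ∑' j, f j x) (fun x => ∑' j, g j x) := by
  refine ⟨Measurable.tsum fun j => (h j).1, fun γ hγ => ?_⟩
  rw [edist_eq_enorm_sub, ← (hf _).tsum_sub (hf _)]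
  refine enorm_tsum_le_tsum_enorm.trans ((ENNReal.tsum_le_tsum fun j => ?_).trans
    (tsum_lineIntegral_le γ g))
  rw [← edist_eq_enorm_sub]
  exact (h j).2 γ hγ

theorem IsUpperGradient.smul_const {ψ : X → ℝ} {g : X → ℝ≥0∞} (h : IsUpperGradient ψ g) (v : F) :
    IsUpperGradient (fun x => ψ x • v) (fun x => ‖v‖ₑ * g x) := by
  refine ⟨h.1.const_mul _, fun γ hγ => ?_⟩
  rw [edist_eq_enorm_sub, ← sub_smul, enorm_smul, mul_comm, ← edist_eq_enorm_sub]
  exact (mul_le_mul_right (h.2 γ hγ) _).trans (lintegral_const_mul_le _ _)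

/-- The exponent of homogeneity is 1 for p ≥ 1 and p for p < 1. -/
theorem lpSize_const_mul {μ : Measure X} {p : ℝ} (hp : 0 < p) (c : ℝ≥0∞) {h : X → ℝ≥0∞}
    (mh : Measurable h) : lpSize μ p (fun x => c * h x) = c ^ (p / max 1 p) * lpSize μ p h := by
  unfold lpSize
  simp only [ENNReal.mul_rpow_of_nonneg _ _ hp.le]
  rw [lintegral_const_mul _ (mh.pow_const p), ENNReal.mul_rpow_of_nonneg _ _ (by positivity),
    ← ENNReal.rpow_mul, mul_one_div]

end UpperGradientSums

/-! ### Tent functions. -/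

section Bumps

open Metric

variable {X : Type*} [MetricSpace X]

/-- The tent function of height one, supported in the closed ball of radius `2 * r` about `z`. -/
noncomputable def bump (z : X) (r : ℝ) (x : X) : ℝ := max 0 (1 - dist x z / (2 * r))

theorem bump_nonneg (z : X) (r : ℝ) (x : X) : 0 ≤ bump z r x := le_max_left _ _

theorem bump_le_one (z : X) {r : ℝ} (hr : 0 < r) (x : X) : bump z r x ≤ 1 :=
  max_le zero_le_one (sub_le_self _ (by positivity))

theorem half_le_bump {z : X} {r : ℝ} (hr : 0 < r) {x : X} (h : dist x z ≤ r) :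
    1 / 2 ≤ bump z r x := by
  refine le_max_of_le_right ?_
  have : dist x z / (2 * r) ≤ 1 / 2 := by
    rw [div_le_iff₀ (by positivity)]
    linarith
  linarith

theorem bump_eq_zero {z : X} {r : ℝ} (hr : 0 < r) {x : X} (h : 2 * r ≤ dist x z) :
    bump z r x = 0 := by
  refine max_eq_left ?_
  rw [sub_nonpos, one_le_div (by positivity)]
  exact h

theorem continuous_bump (z : X) (r : ℝ) : Continuous (bump z r) := by
  unfold bump
  fun_prop

theorem lipschitzWith_bump (z : X) {r : ℝ} (hr : 0 < r) :
    LipschitzWith (Real.toNNReal (1 / (2 * r))) (bump z r) := by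
  refine LipschitzWith.of_dist_le_mul fun x y => ?_
  rw [Real.coe_toNNReal _ (by positivity), Real.dist_eq]
  have h1 := abs_max_sub_max_le_abs (1 - dist x z / (2 * r)) (1 - dist y z / (2 * r)) 0
  rw [max_comm, max_comm _ (0 : ℝ)] at h1
  refine h1.trans ?_
  rw [show 1 - dist x z / (2 * r) - (1 - dist y z / (2 * r)) =
    1 / (2 * r) * (dist y z - dist x z) by ring, abs_mul, abs_of_pos (by positivity)]
  gcongr
  rw [dist_comm x y]
  exact abs_dist_sub_le y x z

theorem isUpperGradient_bump [MeasurableSpace X] [BorelSpace X] (z : X) {r : ℝ} (hr : 0 < r) :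
    IsUpperGradient (bump z r)
      ((closedBall z (2 * r)).indicator fun _ => ENNReal.ofReal (1 / (2 * r))) :=
  (lipschitzWith_bump z hr).isUpperGradient_indicator (bump_nonneg z r) measurableSet_closedBall
    fun _ hx => bump_eq_zero hr (not_le.1 hx).le

end Bumps

/-- A system of tent functions: finitely many of radius `r j` for each `j`, centred on `I j` and
with heights `a j`, for which all sums with bounded coefficients converge in the
Newtonian-Sobolev space. -/
structure BumpSystem {X : Type*} [MetricSpace X] [MeasurableSpace X] (μ : Measure X) (p : ℝ) where
  r : ℕ → ℝ
  R : ℝ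
  I : ℕ → Finset X
  a : ℕ → X → ℝ
  A : ℕ → ℝ
  r_pos : ∀ j, 0 < r j
  r_le : ∀ j, r j ≤ R
  a_nonneg : ∀ j z, 0 ≤ a j z
  summable_A : Summable A
  sum_le : ∀ j x, ∑ z ∈ I j, a j z * bump z (r j) x ≤ A j
  lpSize_ne_top : ∑' j, lpSize μ p (fun x => ∑ z ∈ I j,
    (Metric.closedBall z (2 * r j)).indicator (fun _ => ENNReal.ofReal (a j z / (2 * r j))) x) ≠ ∞

/-! ### Series of tents as a continuous family in the Newtonian-Sobolev space. -/

namespace BumpSystem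

open Metric

variable {X : Type*} [MetricSpace X] [MeasurableSpace X] {μ : Measure X} {p : ℝ}
  (S : BumpSystem μ p)

/-- The index set of a bump system. -/
abbrev Index : Type _ := Σ j : ℕ, {z // z ∈ S.I j}

/-- The upper gradient of the sum of the tent functions of level `j`. -/
noncomputable def grad (j : ℕ) (x : X) : ℝ≥0∞ := ∑ z ∈ S.I j,
  (closedBall z (2 * S.r j)).indicator (fun _ => ENNReal.ofReal (S.a j z / (2 * S.r j))) x

variable {F : Type*} [NormedAddCommGroup F] [NormedSpace ℝ F]

/-- The linear combination of the tent functions of level `j`. -/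
noncomputable def layer (c : S.Index → F) (j : ℕ) (x : X) : F :=
  ∑ z : {z // z ∈ S.I j}, (S.a j z * bump (z : X) (S.r j) x) • c ⟨j, z⟩

/-- The linear combination of all tent functions. -/
noncomputable def sum (c : S.Index → F) (x : X) : F := ∑' j, S.layer c j x

theorem norm_layer_le {c : S.Index → F} {D : ℝ} (hc : ∀ i, ‖c i‖ ≤ D) (j : ℕ) (x : X) :
    ‖S.layer c j x‖ ≤ S.A j * |D| := by
  calc ‖S.layer c j x‖ ≤ ∑ z : {z // z ∈ S.I j}, S.a j z * bump (z : X) (S.r j) x * |D| := by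
        refine norm_sum_le_of_le _ fun z _ => ?_
        rw [norm_smul, Real.norm_of_nonneg (mul_nonneg (S.a_nonneg _ _) (bump_nonneg _ _ _))]
        gcongr
        · exact mul_nonneg (S.a_nonneg _ _) (bump_nonneg _ _ _)
        · exact (hc _).trans (le_abs_self D)
    _ = (∑ z ∈ S.I j, S.a j z * bump z (S.r j) x) * |D| := by
        rw [← Finset.sum_mul, Finset.sum_coe_sort (S.I j) fun z => S.a j z * bump z (S.r j) x]
    _ ≤ _ := by
        gcongr
        exact S.sum_le j x

theorem continuous_layer (j : ℕ) :
    Continuous fun q : (S.Index → F) × X => S.layer q.1 j q.2 := by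
  refine continuous_finsetSum _ fun z _ => ?_
  refine Continuous.smul (continuous_const.mul ((continuous_bump _ _).comp continuous_snd)) ?_
  exact (continuous_apply _).comp continuous_fst

variable [CompleteSpace F]

theorem summable_layer {c : S.Index → F} {D : ℝ} (hc : ∀ i, ‖c i‖ ≤ D) (x : X) :
    Summable fun j => S.layer c j x :=
  Summable.of_norm_bounded (S.summable_A.mul_right |D|) fun j => S.norm_layer_le hc j x

theorem sum_add {c c' : S.Index → F} {D D' : ℝ} (hc : ∀ i, ‖c i‖ ≤ D) (hc' : ∀ i, ‖c' i‖ ≤ D')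
    (x : X) : S.sum (c + c') x = S.sum c x + S.sum c' x := by
  rw [sum, sum, sum, ← (S.summable_layer hc x).tsum_add (S.summable_layer hc' x)]
  congr 1
  ext j
  simp [layer, Finset.sum_add_distrib]

theorem sum_sub {c c' : S.Index → F} {D D' : ℝ} (hc : ∀ i, ‖c i‖ ≤ D) (hc' : ∀ i, ‖c' i‖ ≤ D')
    (x : X) : S.sum (c - c') x = S.sum c x - S.sum c' x := by
  rw [sum, sum, sum, ← (S.summable_layer hc x).tsum_sub (S.summable_layer hc' x)]
  congr 1
  ext j
  simp [layer, smul_sub]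

theorem sum_single [DecidableEq S.Index] (i : S.Index) (e : F) (x : X) :
    S.sum (Pi.single i e) x = (S.a i.1 i.2 * bump (i.2 : X) (S.r i.1) x) • e := by
  obtain ⟨j, z⟩ := i
  rw [sum, tsum_eq_single j]
  · rw [layer, Finset.sum_eq_single z]
    · simp
    · intro b _ hb
      rw [Pi.single_eq_of_ne, smul_zero]
      simpa using hb
    · simp
  · intro k hk
    refine Finset.sum_eq_zero fun b _ => ?_
    rw [Pi.single_eq_of_ne, smul_zero]
    exact fun h => hk (congrArg Sigma.fst h)

variable (F) in
/-- The space of coefficients: all families of points of the closed unit ball. -/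
abbrev Coeff : Type _ := S.Index → closedBall (0 : F) 1

/-- The function with given coefficients. -/
noncomputable def toFun (ω : S.Coeff F) : X → F := S.sum fun i => (ω i : F)

theorem norm_coe_le (ω : S.Coeff F) (i : S.Index) : ‖(ω i : F)‖ ≤ 1 :=
  mem_closedBall_zero_iff.1 (ω i).2

/-- Weierstrass test: level j is bounded by `S.A j`, uniformly in the coefficients and the point. -/
theorem continuous_toFun : Continuous fun q : S.Coeff F × X => S.toFun q.1 q.2 := by
  refine continuous_tsum (u := fun j => S.A j * |1|) (fun j => ?_) (S.summable_A.mul_right _)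
    fun j q => S.norm_layer_le (S.norm_coe_le q.1) j q.2
  have h : Continuous fun q : S.Coeff F × X => ((fun i => (q.1 i : F)), q.2) := by fun_prop
  exact (S.continuous_layer j).comp h

variable [BorelSpace X]

theorem measurable_grad (j : ℕ) : Measurable (S.grad j) :=
  Finset.measurable_fun_sum _ fun _ _ => measurable_const.indicator measurableSet_closedBall

theorem isUpperGradient_layer {c : S.Index → F} {j : ℕ} {D : ℝ≥0} (hc : ∀ z, ‖c ⟨j, z⟩‖ ≤ D) :
    IsUpperGradient (S.layer c j) (fun x => D * S.grad j x) := by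
  have h1 : ∀ z ∈ (Finset.univ : Finset {z // z ∈ S.I j}),
      IsUpperGradient (fun x => (S.a j z * bump (z : X) (S.r j) x) • c ⟨j, z⟩)
        (fun x => ‖c ⟨j, z⟩‖ₑ * (‖S.a j z‖ₑ * (closedBall (z : X) (2 * S.r j)).indicator
          (fun _ => ENNReal.ofReal (1 / (2 * S.r j))) x)) := fun z _ =>
    ((isUpperGradient_bump (z : X) (S.r_pos j)).smul (S.a j z)).smul_const _
  refine (IsUpperGradient.finset_sum _ h1).mono ((S.measurable_grad j).const_mul _) fun x => ?_
  rw [grad, ← Finset.sum_coe_sort (S.I j), Finset.mul_sum]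
  refine Finset.sum_le_sum fun z _ => ?_
  have h2 : ‖c ⟨j, z⟩‖ₑ ≤ D := by
    rw [enorm_eq_nnnorm, ENNReal.coe_le_coe]
    exact hc z
  refine mul_le_mul h2 ?_ zero_le zero_le
  by_cases hx : x ∈ closedBall (z : X) (2 * S.r j)
  · simp only [indicator_of_mem hx]
    rw [Real.enorm_of_nonneg (S.a_nonneg _ _), ← ENNReal.ofReal_mul (S.a_nonneg _ _), mul_one_div]
  · simp [hx]

/-- A tent vanishes wherever its gradient term does, and its height is 2r times its slope. Thus the
gradients also control the L^p size of the function itself. -/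
theorem enorm_layer_le {c : S.Index → F} {j : ℕ} {D : ℝ≥0} (hc : ∀ z, ‖c ⟨j, z⟩‖ ≤ D) (x : X) :
    ‖S.layer c j x‖ₑ ≤ ENNReal.ofReal (2 * S.R) * (D * S.grad j x) := by
  refine (enorm_sum_le _ _).trans ?_
  rw [grad, ← Finset.sum_coe_sort (S.I j), Finset.mul_sum, Finset.mul_sum]
  refine Finset.sum_le_sum fun z _ => ?_
  have hr := S.r_pos j
  have h2 : ‖c ⟨j, z⟩‖ₑ ≤ D := by
    rw [enorm_eq_nnnorm, ENNReal.coe_le_coe]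
    exact hc z
  rw [enorm_smul, Real.enorm_of_nonneg (mul_nonneg (S.a_nonneg _ _) (bump_nonneg _ _ _))]
  by_cases hx : x ∈ closedBall (z : X) (2 * S.r j)
  · simp only [indicator_of_mem hx]
    rw [mul_left_comm, mul_comm]
    gcongr
    rw [← ENNReal.ofReal_mul (by linarith [S.r_le j])]
    refine ENNReal.ofReal_le_ofReal ?_
    calc S.a j z * bump (z : X) (S.r j) x ≤ S.a j z * 1 := by
          gcongr
          · exact S.a_nonneg _ _
          · exact bump_le_one _ hr _
      _ = 2 * S.r j * (S.a j z / (2 * S.r j)) := by field_simp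
      _ ≤ _ := by
          gcongr
          · exact div_nonneg (S.a_nonneg _ _) (by positivity)
          · exact S.r_le j
  · rw [bump_eq_zero hr (not_le.1 hx).le]
    simp

theorem isUpperGradient_sum {c : S.Index → F} {D : ℕ → ℝ≥0} {M : ℝ} (hM : ∀ i, ‖c i‖ ≤ M)
    (hc : ∀ j z, ‖c ⟨j, z⟩‖ ≤ D j) :
    IsUpperGradient (S.sum c) (fun x => ∑' j, D j * S.grad j x) :=
  IsUpperGradient.tsum (fun j => S.isUpperGradient_layer (hc j)) (S.summable_layer hM)

theorem newtonianSize_sum_le (hp : 0 < p) {c : S.Index → F} {D : ℕ → ℝ≥0} {M : ℝ}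
    (hM : ∀ i, ‖c i‖ ≤ M) (hc : ∀ j z, ‖c ⟨j, z⟩‖ ≤ D j) :
    newtonianSize μ p (S.sum c) ≤ (ENNReal.ofReal (2 * S.R) ^ (p / max 1 p) + 1) *
      ∑' j, (D j : ℝ≥0∞) ^ (p / max 1 p) * lpSize μ p (S.grad j) := by
  have h1 : lpSize μ p (fun x => ∑' j, D j * S.grad j x) ≤
      ∑' j, (D j : ℝ≥0∞) ^ (p / max 1 p) * lpSize μ p (S.grad j) := by
    refine (lpSize_tsum_le hp fun j => (S.measurable_grad j).const_mul _).trans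
      (ENNReal.tsum_le_tsum fun j => (lpSize_const_mul hp _ (S.measurable_grad j)).le)
  rw [newtonianSize, add_mul, one_mul]
  refine add_le_add ?_ ((iInf₂_le _ (S.isUpperGradient_sum hM hc)).trans h1)
  refine le_trans ?_ (mul_le_mul_right h1 _)
  rw [← lpSize_const_mul hp _ (Measurable.tsum fun j => (S.measurable_grad j).const_mul _)]
  refine lpSize_mono hp fun x => ?_
  rw [← ENNReal.tsum_mul_left]
  exact enorm_tsum_le_tsum_enorm.trans (ENNReal.tsum_le_tsum fun j => S.enorm_layer_le (hc j) x)

theorem tsum_lpSize_grad_ne_top : ∑' j, lpSize μ p (S.grad j) ≠ ∞ := S.lpSize_ne_top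

variable [MeasurableSpace F] [BorelSpace F] [SecondCountableTopology F]

theorem measurable_toFun (ω : S.Coeff F) : Measurable (S.toFun ω) :=
  (S.continuous_toFun.comp (Continuous.prodMk_right ω)).measurable

variable [hp : Fact (0 < p)]

theorem isUpperGradient_toFun (ω : S.Coeff F) :
    IsUpperGradient (S.toFun ω) (fun x => ∑' j, S.grad j x) := by
  simpa [toFun] using S.isUpperGradient_sum (D := 1) (S.norm_coe_le ω)
    fun j z => by simpa using S.norm_coe_le ω ⟨j, z⟩

theorem finiteLp_tsum_grad : FiniteLp μ p (fun x => ∑' j, S.grad j x) :=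
  lpSize_lt_top_iff.1 <| (lpSize_tsum_le hp.out S.measurable_grad).trans_lt
    S.tsum_lpSize_grad_ne_top.lt_top

theorem toFun_mem (ω : S.Coeff F) : S.toFun ω ∈ newtonianSubmodule μ p F := by
  refine ⟨S.measurable_toFun ω, ?_, _, S.isUpperGradient_toFun ω, S.finiteLp_tsum_grad⟩
  rw [← lpSize_lt_top_iff]
  refine le_self_add.trans_lt ((S.newtonianSize_sum_le hp.out (D := 1) (S.norm_coe_le ω)
    fun j z => by simpa using S.norm_coe_le ω ⟨j, z⟩).trans_lt (ENNReal.mul_lt_top ?_ ?_))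
  · simp only [ENNReal.add_lt_top, ENNReal.one_lt_top, and_true]
    exact ENNReal.rpow_lt_top_of_nonneg (div_nonneg hp.out.le (by positivity))
      ENNReal.ofReal_ne_top
  · simpa using S.tsum_lpSize_grad_ne_top.lt_top

/-- The function with given coefficients, as an element of the Newtonian-Sobolev class. -/
noncomputable def toNewtonian (ω : S.Coeff F) : NewtonianFunction μ p F :=
  ⟨S.toFun ω, S.toFun_mem ω⟩

/-- The distance to ω₀ is at most a constant times ∑ D_j^q L_j, with D_j the largest change of a
coefficient at level j. Each D_j is a finite supremum of continuous functions, and D_j ≤ 2 makes the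
series converge uniformly. As the coefficient space is compact, this provides the compact support
required of a transverse measure. -/
theorem continuous_toNewtonian : Continuous (S.toNewtonian (F := F)) := by
  set q := p / max 1 p with hq
  have hq0 : 0 < q := div_pos hp.out (by positivity)
  set κ := ENNReal.ofReal (2 * S.R) ^ q + 1 with hκ
  have hκt : κ ≠ ∞ := ENNReal.add_ne_top.2
    ⟨ENNReal.rpow_ne_top_of_nonneg hq0.le ENNReal.ofReal_ne_top, ENNReal.one_ne_top⟩
  set L : ℕ → ℝ := fun j => (lpSize μ p (S.grad j)).toReal with hL
  have hLs : Summable L := ENNReal.summable_toReal S.tsum_lpSize_grad_ne_top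
  refine continuous_iff_continuousAt.2 fun ω₀ => ?_
  set D : S.Coeff F → ℕ → ℝ≥0 := fun ω j =>
    Finset.univ.sup fun z : {z // z ∈ S.I j} => nndist (ω ⟨j, z⟩) (ω₀ ⟨j, z⟩) with hD
  have hDc : ∀ j, Continuous fun ω => D ω j := fun j => by
    refine Continuous.finset_sup_apply (s := Finset.univ) fun z _ => ?_
    exact (continuous_apply _).nndist continuous_const
  have hD2 : ∀ ω j, D ω j ≤ 2 := fun ω j => Finset.sup_le fun z _ => by
    have h1 : dist (ω ⟨j, z⟩ : F) (ω₀ ⟨j, z⟩) ≤ 2 := by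
      rw [dist_eq_norm]
      linarith [norm_sub_le (ω ⟨j, z⟩ : F) (ω₀ ⟨j, z⟩), S.norm_coe_le ω ⟨j, z⟩,
        S.norm_coe_le ω₀ ⟨j, z⟩]
    exact h1
  have hDle : ∀ ω j z, ‖((ω ⟨j, z⟩ : F) - ω₀ ⟨j, z⟩)‖ ≤ D ω j := fun ω j z => by
    rw [← dist_eq_norm]
    have h1 : nndist (ω ⟨j, z⟩) (ω₀ ⟨j, z⟩) ≤ D ω j :=
      Finset.le_sup (f := fun z : {z // z ∈ S.I j} => nndist (ω ⟨j, z⟩) (ω₀ ⟨j, z⟩))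
        (Finset.mem_univ z)
    exact h1
  set G : S.Coeff F → ℝ := fun ω => ∑' j, (D ω j : ℝ) ^ q * L j with hG
  have hGb : ∀ ω j, (D ω j : ℝ) ^ q * L j ≤ 2 ^ q * L j := fun ω j => by
    gcongr
    exact_mod_cast hD2 ω j
  have hG0 : ∀ ω j, 0 ≤ (D ω j : ℝ) ^ q * L j := fun ω j =>
    mul_nonneg (by positivity) ENNReal.toReal_nonneg
  have hGc : Continuous G := by
    refine continuous_tsum (u := fun j => 2 ^ q * L j) (fun j => ?_) (hLs.mul_left _)
      fun j ω => ?_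
    · exact ((NNReal.continuous_coe.comp (hDc j)).rpow_const fun _ => Or.inr hq0.le).mul
        continuous_const
    · rw [Real.norm_of_nonneg (hG0 ω j)]
      exact hGb ω j
  have hG00 : G ω₀ = 0 := by
    have h0 : ∀ j, D ω₀ j = 0 := fun j => by simp [hD]
    simp [hG, h0, Real.zero_rpow hq0.ne']
  rw [ContinuousAt, tendsto_iff_dist_tendsto_zero]
  have hlim : Tendsto (fun ω => κ.toReal * G ω) (𝓝 ω₀) (𝓝 0) := by
    have := (hGc.tendsto ω₀).const_mul κ.toReal
    rwa [hG00, mul_zero] at this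
  refine squeeze_zero (fun _ => dist_nonneg) (fun ω => ?_) hlim
  have h1 : dist (S.toNewtonian ω) (S.toNewtonian ω₀) =
      (newtonianSize μ p (S.sum fun i => (ω i : F) - ω₀ i)).toReal := by
    rw [dist_eq_norm]
    change (newtonianSize μ p (S.toFun ω - S.toFun ω₀)).toReal = _
    congr 2
    ext x
    exact (S.sum_sub (S.norm_coe_le ω) (S.norm_coe_le ω₀) x).symm
  have h2 : (∑' j, (D ω j : ℝ≥0∞) ^ q * lpSize μ p (S.grad j)) = ENNReal.ofReal (G ω) := by
    rw [hG, ENNReal.ofReal_tsum_of_nonneg (hG0 ω)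
      (Summable.of_nonneg_of_le (hG0 ω) (hGb ω) (hLs.mul_left _))]
    refine tsum_congr fun j => ?_
    rw [ENNReal.ofReal_mul (by positivity), hL,
      ENNReal.ofReal_toReal (ENNReal.ne_top_of_tsum_ne_top S.tsum_lpSize_grad_ne_top j),
      ← ENNReal.ofReal_rpow_of_nonneg (by positivity) hq0.le, ENNReal.ofReal_coe_nnreal]
  have h3 := S.newtonianSize_sum_le hp.out (c := fun i => (ω i : F) - ω₀ i) (D := D ω) (M := 2)
    (fun i => (hDle ω i.1 i.2).trans (by exact_mod_cast hD2 ω i.1)) (hDle ω)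
  rw [h1]
  rw [h2] at h3
  refine (ENNReal.toReal_mono (ENNReal.mul_ne_top hκt ENNReal.ofReal_ne_top) h3).trans ?_
  rw [ENNReal.toReal_mul, ENNReal.toReal_ofReal (tsum_nonneg (hG0 ω))]

end BumpSystem

/-! ### Resampling one coordinate of a product measure. -/

section ProductMeasure

/-- An independent resampling of one coordinate preserves the law. Finite boxes suffice as test
sets, with coordinate i either constrained or free. -/
theorem map_update_infinitePi {ι : Type*} [DecidableEq ι] {B : ι → Type*}
    [∀ i, MeasurableSpace (B i)] (m : ∀ i, Measure (B i)) [∀ i, IsProbabilityMeasure (m i)]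
    (i : ι) : ((Measure.infinitePi m).prod (m i)).map
      (fun q : (∀ i, B i) × B i => Function.update q.1 i q.2) = Measure.infinitePi m := by
  have hm : Measurable fun q : (∀ i, B i) × B i => Function.update q.1 i q.2 := by
    refine measurable_pi_iff.2 fun k => ?_
    by_cases hk : k = i
    · subst hk
      simpa using measurable_snd
    · simp only [Function.update_of_ne hk]
      exact (measurable_pi_apply k).comp measurable_fst
  refine Measure.eq_infinitePi m fun s t ht => ?_
  rw [Measure.map_apply hm (.pi s.countable_toSet fun i _ => ht i)]
  by_cases hi : i ∈ s
  · have h1 : (fun q : (∀ i, B i) × B i => Function.update q.1 i q.2) ⁻¹' Set.pi s t =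
        Set.pi (s.erase i : Finset ι) t ×ˢ t i := by
      ext ⟨ω, e⟩
      simp only [mem_preimage, Set.mem_pi, Finset.mem_coe, mem_prod, Finset.mem_erase]
      constructor
      · intro h
        refine ⟨fun k hk => ?_, by simpa using h i hi⟩
        simpa [Function.update_of_ne hk.1] using h k hk.2
      · rintro ⟨h, he⟩ k hk
        by_cases hki : k = i
        · subst hki
          simpa using he
        · simpa [Function.update_of_ne hki] using h k ⟨hki, hk⟩
    rw [h1, Measure.prod_prod, Measure.infinitePi_pi m fun i _ => ht i, mul_comm,
      Finset.mul_prod_erase s (fun i => m i (t i)) hi]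
  · have h1 : (fun q : (∀ i, B i) × B i => Function.update q.1 i q.2) ⁻¹' Set.pi s t =
        Set.pi s t ×ˢ univ := by
      ext ⟨ω, e⟩
      simp only [mem_preimage, Set.mem_pi, Finset.mem_coe, mem_prod, mem_univ, and_true]
      refine forall₂_congr fun k hk => ?_
      rw [Function.update_of_ne]
      exact fun h => hi (h ▸ hk)
    rw [h1, Measure.prod_prod, Measure.infinitePi_pi m fun i _ => ht i, measure_univ, mul_one]

theorem lintegral_infinitePi_update {ι : Type*} [DecidableEq ι] {B : ι → Type*}
    [∀ i, MeasurableSpace (B i)] (m : ∀ i, Measure (B i)) [∀ i, IsProbabilityMeasure (m i)]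
    (i : ι) {f : (∀ i, B i) → ℝ≥0∞} (hf : Measurable f) :
    ∫⁻ ω, f ω ∂Measure.infinitePi m =
      ∫⁻ ω, ∫⁻ e, f (Function.update ω i e) ∂m i ∂Measure.infinitePi m := by
  have hm : Measurable fun q : (∀ i, B i) × B i => Function.update q.1 i q.2 := by
    refine measurable_pi_iff.2 fun k => ?_
    by_cases hk : k = i
    · subst hk
      simpa using measurable_snd
    · simp only [Function.update_of_ne hk]
      exact (measurable_pi_apply k).comp measurable_fst
  conv_lhs => rw [← map_update_infinitePi m i]
  rw [lintegral_map hf hm]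
  exact lintegral_prod _ (hf.comp hm).aemeasurable

end ProductMeasure

/-! ### Negative moments of uniform vectors in a ball. -/

section BallMeasure

open Metric Module

variable (F : Type*) [NormedAddCommGroup F] [NormedSpace ℝ F] [FiniteDimensional ℝ F]
  [MeasureSpace F] [BorelSpace F] [(volume : Measure F).IsAddHaarMeasure]

/-- The uniform distribution on the closed unit ball. -/
noncomputable def unitBallMeasure : Measure (closedBall (0 : F) 1) :=
  (volume (closedBall (0 : F) 1))⁻¹ • Measure.comap (↑) (volume : Measure F)

theorem volume_unitBall_ne_zero : volume (closedBall (0 : F) 1) ≠ 0 :=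
  (measure_closedBall_pos volume 0 one_pos).ne'

theorem volume_unitBall_ne_top : volume (closedBall (0 : F) 1) ≠ ∞ :=
  measure_closedBall_lt_top.ne

instance : IsProbabilityMeasure (unitBallMeasure F) := by
  constructor
  rw [unitBallMeasure, Measure.smul_apply, comap_subtype_coe_apply measurableSet_closedBall,
    image_univ, Subtype.range_coe, smul_eq_mul]
  exact ENNReal.inv_mul_cancel (volume_unitBall_ne_zero F) (volume_unitBall_ne_top F)

theorem lintegral_ball_enorm_rpow_ne_top (hF : 1 ≤ finrank ℝ F) {t : ℝ}
    (ht : t < finrank ℝ F) :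
    ∫⁻ z in ball (0 : F) 1, ‖z‖ₑ ^ (-t) ≠ ∞ := by
  have : Nontrivial F := Module.nontrivial_of_finrank_pos (R := ℝ) hF
  have h1 : IntegrableOn (fun z : F => ‖z‖ ^ (-t)) (ball 0 1) volume := by
    refine integrableOn_ball_of_norm_le_rpow (C := 1) (α := t) hF ht (ae_of_all _ fun z => ?_)
      (measurable_norm.pow_const _).aestronglyMeasurable
    rw [one_mul, Real.norm_of_nonneg (by positivity)]
  have h2 := h1.2
  rw [hasFiniteIntegral_iff_enorm] at h2
  refine ne_of_lt (lt_of_le_of_lt (lintegral_mono_ae ?_) h2)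
  refine ae_restrict_of_ae ?_
  -- The real and the extended negative powers may disagree at the origin, which is a null set.
  have h0 : ∀ᵐ z : F, z ≠ 0 := by simp [ae_iff]
  filter_upwards [h0] with z hz
  have hz' : 0 < ‖z‖ := norm_pos_iff.2 hz
  rw [Real.enorm_of_nonneg (by positivity), ← ofReal_norm, ENNReal.ofReal_rpow_of_pos hz']

/-- The power is at most one plus its restriction to the unit ball, whose integral over the whole
space is translation invariant; so the bound is uniform in v. That C is not zero matters when it
multiplies ∞, at tents of height zero. -/
theorem exists_lintegral_unitBall_le (hF : 1 ≤ finrank ℝ F) {t : ℝ} (ht0 : 0 < t)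
    (ht : t < finrank ℝ F) : ∃ C : ℝ≥0∞, C ≠ 0 ∧ C ≠ ∞ ∧
      ∀ v : F, ∫⁻ e, ‖v + (e : F)‖ₑ ^ (-t) ∂unitBallMeasure F ≤ C := by
  set V := volume (closedBall (0 : F) 1) with hV
  have hV0 : V ≠ 0 := volume_unitBall_ne_zero F
  have hVt : V ≠ ∞ := volume_unitBall_ne_top F
  set c := ∫⁻ z in ball (0 : F) 1, ‖z‖ₑ ^ (-t) with hc
  have hct : c ≠ ∞ := lintegral_ball_enorm_rpow_ne_top F hF ht
  refine ⟨V⁻¹ * (V + c), ?_, ?_, fun v => ?_⟩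
  · simp [hV0, hVt]
  · exact ENNReal.mul_ne_top (ENNReal.inv_ne_top.2 hV0) (ENNReal.add_ne_top.2 ⟨hVt, hct⟩)
  rw [unitBallMeasure, lintegral_smul_measure, smul_eq_mul,
    lintegral_subtype_comap measurableSet_closedBall (fun e : F => ‖v + e‖ₑ ^ (-t))]
  gcongr
  have hpt : ∀ z : F, ‖z‖ₑ ^ (-t) ≤ 1 + (ball (0 : F) 1).indicator (fun z => ‖z‖ₑ ^ (-t)) z := by
    intro z
    by_cases hz : z ∈ ball (0 : F) 1
    · rw [indicator_of_mem hz]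
      exact le_add_self
    · rw [indicator_of_notMem hz, add_zero, ENNReal.rpow_neg, ENNReal.inv_le_one]
      refine ENNReal.one_le_rpow ?_ ?_
      · rw [← ofReal_norm, ENNReal.one_le_ofReal]
        simpa using hz
      · exact ht0
  have mI : Measurable ((ball (0 : F) 1).indicator fun z => ‖z‖ₑ ^ (-t)) :=
    (measurable_enorm.pow_const _).indicator measurableSet_ball
  calc ∫⁻ e in closedBall (0 : F) 1, ‖v + e‖ₑ ^ (-t)
      ≤ ∫⁻ e in closedBall (0 : F) 1,
        (1 + (ball (0 : F) 1).indicator (fun z => ‖z‖ₑ ^ (-t)) (v + e)) :=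
        lintegral_mono fun e => hpt _
    _ = V + ∫⁻ e in closedBall (0 : F) 1,
        (ball (0 : F) 1).indicator (fun z => ‖z‖ₑ ^ (-t)) (v + e) := by
        rw [lintegral_add_left measurable_const, setLIntegral_const, one_mul]
    _ ≤ V + ∫⁻ e, (ball (0 : F) 1).indicator (fun z => ‖z‖ₑ ^ (-t)) (v + e) := by
        gcongr
        exact Measure.restrict_le_self
    _ = V + c := by
        rw [lintegral_add_left_eq_self (μ := volume), lintegral_indicator measurableSet_ball]

end BallMeasure

/-! ### Conditioning on all coefficients but one. -/

namespace BumpSystem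

open Metric Module

variable {X : Type*} [MetricSpace X] [MeasurableSpace X] [BorelSpace X] {μ : Measure X} {p : ℝ}
  (S : BumpSystem μ p)
  (F : Type*) [NormedAddCommGroup F] [NormedSpace ℝ F] [FiniteDimensional ℝ F]
  [MeasureSpace F] [BorelSpace F] [(volume : Measure F).IsAddHaarMeasure]

/-- The law of independent coefficients that are uniformly distributed in the unit ball. -/
noncomputable def law : Measure (S.Coeff F) := Measure.infinitePi fun _ => unitBallMeasure F

instance : IsProbabilityMeasure (S.law F) := by
  unfold law
  infer_instance

variable {F}

theorem toFun_update [DecidableEq S.Index] [CompleteSpace F] (ω : S.Coeff F) (i : S.Index)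
    (e : closedBall (0 : F) 1) (x : X) :
    S.toFun (Function.update ω i e) x =
      S.toFun (Function.update ω i ⟨0, by simp⟩) x +
        (S.a i.1 i.2 * bump (i.2 : X) (S.r i.1) x) • (e : F) := by
  rw [← S.sum_single i (e : F) x, toFun, toFun, ← S.sum_add (D := 1) (D' := 1)]
  · congr 1
    ext k
    by_cases hk : k = i
    · subst hk
      simp
    · simp [hk]
  · exact S.norm_coe_le _
  · intro k
    by_cases hk : k = i
    · subst hk
      simpa using mem_closedBall_zero_iff.1 e.2
    · simp [hk]

/-- With all other coefficients frozen, the tent i sees x but not y. The difference is then a fixed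
vector plus b e, where b is at least half the height and e is uniform in the ball. Since the moment
bound is uniform in translations, neither v nor the frozen coefficients matter. -/
theorem exists_lintegral_law_le [CompleteSpace F] [SecondCountableTopology F]
    (hF : 1 ≤ finrank ℝ F) {t : ℝ} (ht0 : 0 < t)
    (ht : t < finrank ℝ F) : ∃ C : ℝ≥0∞, C ≠ ∞ ∧
      ∀ (i : S.Index) (x y : X), dist x i.2 ≤ S.r i.1 → 2 * S.r i.1 ≤ dist y i.2 → ∀ v : F,
        ∫⁻ ω, ‖v + (S.toFun ω x - S.toFun ω y)‖ₑ ^ (-t) ∂S.law F ≤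
          C * ENNReal.ofReal (S.a i.1 i.2 / 2) ^ (-t) := by
  classical
  obtain ⟨C, hC0, hCt, hC⟩ := exists_lintegral_unitBall_le F hF ht0 ht
  refine ⟨C, hCt, fun i x y hx hy v => ?_⟩
  rcases (S.a_nonneg i.1 i.2).eq_or_lt with ha | ha
  · rw [← ha, zero_div, ENNReal.ofReal_zero, ENNReal.zero_rpow_of_neg (neg_lt_zero.2 ht0),
      ENNReal.mul_top hC0]
    exact le_top
  set b := S.a i.1 i.2 * bump (i.2 : X) (S.r i.1) x with hb
  have hab : S.a i.1 i.2 / 2 ≤ b := by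
    rw [hb, div_eq_mul_one_div]
    gcongr
    exact half_le_bump (S.r_pos _) hx
  have hb0 : 0 < b := lt_of_lt_of_le (by positivity) hab
  have hmeas : Measurable fun ω : S.Coeff F => ‖v + (S.toFun ω x - S.toFun ω y)‖ₑ ^ (-t) := by
    have h1 : ∀ z, Continuous fun ω : S.Coeff F => S.toFun ω z := fun z =>
      S.continuous_toFun.comp (Continuous.prodMk_left z)
    exact ((continuous_const.add ((h1 x).sub (h1 y))).enorm.measurable).pow_const _
  have hC' : C * ENNReal.ofReal b ^ (-t) ≤ C * ENNReal.ofReal (S.a i.1 i.2 / 2) ^ (-t) := by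
    gcongr 1
    rw [ENNReal.rpow_neg, ENNReal.rpow_neg, ENNReal.inv_le_inv]
    exact ENNReal.rpow_le_rpow (ENNReal.ofReal_le_ofReal hab) ht0.le
  refine le_trans ?_ hC'
  rw [law, lintegral_infinitePi_update (fun _ : S.Index => unitBallMeasure F) i hmeas]
  refine (lintegral_mono (g := fun _ => C * ENNReal.ofReal b ^ (-t)) fun ω => ?_).trans
    (by rw [lintegral_const, measure_univ, mul_one])
  set w := S.toFun (Function.update ω i ⟨0, by simp⟩) with hw
  have h1 : ∀ e : closedBall (0 : F) 1, ‖v + (S.toFun (Function.update ω i e) x -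
      S.toFun (Function.update ω i e) y)‖ₑ ^ (-t) =
      ENNReal.ofReal b ^ (-t) * ‖b⁻¹ • (v + (w x - w y)) + (e : F)‖ₑ ^ (-t) := fun e => by
    rw [S.toFun_update ω i e x, S.toFun_update ω i e y, bump_eq_zero (S.r_pos _) hy, mul_zero,
      zero_smul, add_zero, ← hb, ← hw]
    have h2 : v + (w x + b • (e : F) - w y) = b • (b⁻¹ • (v + (w x - w y)) + (e : F)) := by
      rw [smul_add, smul_inv_smul₀ hb0.ne']
      abel
    rw [h2, enorm_smul, Real.enorm_of_nonneg hb0.le, ENNReal.rpow_neg, ENNReal.rpow_neg,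
      ENNReal.rpow_neg, ENNReal.mul_rpow_of_nonneg _ _ ht0.le, ENNReal.mul_inv]
    · left
      simp [ENNReal.rpow_eq_zero_iff, hb0]
    · left
      exact ENNReal.rpow_ne_top_of_nonneg ht0.le ENNReal.ofReal_ne_top
  simp only [h1]
  rw [lintegral_const_mul' _ _ (by
    rw [ENNReal.rpow_neg]
    simp [ENNReal.rpow_eq_zero_iff, hb0]), mul_comm]
  gcongr
  exact hC _

end BumpSystem

/-! ### Geometric scales and polynomial weights. -/

section Weights

theorem mul_half_pow_rpow {R : ℝ} (hR : 0 ≤ R) (ε : ℝ) (j : ℕ) :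
    (R * (1 / 2) ^ j) ^ ε = R ^ ε * ((1 / 2 : ℝ) ^ ε) ^ j := by
  rw [Real.mul_rpow hR (by positivity), ← Real.rpow_natCast, ← Real.rpow_natCast,
    ← Real.rpow_mul (by norm_num), ← Real.rpow_mul (by norm_num), mul_comm ε]

theorem half_rpow_lt_one {ε : ℝ} (hε : 0 < ε) : (1 / 2 : ℝ) ^ ε < 1 :=
  Real.rpow_lt_one (by norm_num) (by norm_num) hε

theorem summable_add_one_rpow_mul_geometric {ρ : ℝ} (h0 : 0 < ρ) (h1 : ρ < 1) (k : ℝ) :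
    Summable fun j : ℕ => ((j : ℝ) + 1) ^ k * ρ ^ j := by
  have h2 := (summable_nat_add_iff 1).2 (summable_pow_mul_geometric_of_norm_lt_one ⌈k⌉₊
    (r := ρ) (by rwa [Real.norm_of_nonneg h0.le]))
  refine Summable.of_nonneg_of_le (fun j => by positivity) (fun j => ?_) (h2.mul_right ρ⁻¹)
  rw [pow_succ, ← mul_assoc, mul_inv_cancel_right₀ h0.ne']
  gcongr
  rw [← Real.rpow_natCast]
  push_cast
  exact Real.rpow_le_rpow_of_exponent_le (by linarith [Nat.cast_nonneg (α := ℝ) j])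
    (Nat.le_ceil k)

theorem summable_mul_half_pow_rpow {R : ℝ} (hR : 0 ≤ R) {ε : ℝ} (hε : 0 < ε) (k : ℝ) :
    Summable fun j : ℕ => ((j : ℝ) + 1) ^ k * (R * (1 / 2) ^ j) ^ ε := by
  refine ((summable_add_one_rpow_mul_geometric (by positivity) (half_rpow_lt_one hε) k).mul_left
    (R ^ ε)).congr fun j => ?_
  rw [mul_half_pow_rpow hR]
  ring

/-- The least j satisfying the first inequality works; if it is 0, the second one follows from d ≤
R. -/
theorem exists_scale {R d : ℝ} (hd : 0 < d) (hdR : d ≤ R) :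
    ∃ j : ℕ, 4 * (R * (1 / 2) ^ j) < d ∧ d ≤ 8 * (R * (1 / 2) ^ j) := by
  have hR : 0 < R := hd.trans_le hdR
  have hex : ∃ j : ℕ, 4 * (R * (1 / 2) ^ j) < d := by
    obtain ⟨j, hj⟩ := exists_pow_lt_of_lt_one (show 0 < d / (4 * R) by positivity)
      (show (1 / 2 : ℝ) < 1 by norm_num)
    refine ⟨j, ?_⟩
    rw [lt_div_iff₀ (by positivity)] at hj
    linarith
  classical
  refine ⟨Nat.find hex, Nat.find_spec hex, ?_⟩
  rcases hk : Nat.find hex with _ | k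
  · simp
    linarith
  · have := Nat.find_min hex (m := k) (by omega)
    rw [not_lt] at this
    rw [pow_succ]
    linarith

end Weights

/-! ### Tents whose heights are adapted to a measure. -/

section Systems

open Metric

variable {X : Type*} [MetricSpace X] [MeasurableSpace X]

/-- At most M terms are nonzero at x, so the sum is at most M times its largest term. This argument
works for every p > 0. -/
theorem sum_indicator_rpow_le {p : ℝ} (hp : 0 < p) (I : Finset X) (B : X → Set X) (c : X → ℝ≥0∞)
    {M : ℝ≥0∞} (x : X) (hM : ∀ J ⊆ I, (∀ z ∈ J, x ∈ B z) → (J.card : ℝ≥0∞) ≤ M) :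
    (∑ z ∈ I, (B z).indicator (fun _ => c z) x) ^ p ≤
      M ^ p * ∑ z ∈ I, (B z).indicator (fun _ => c z ^ p) x := by
  classical
  set J := I.filter fun z => x ∈ B z with hJ
  have h1 : ∀ c : X → ℝ≥0∞, ∑ z ∈ I, (B z).indicator (fun _ => c z) x = ∑ z ∈ J, c z := by
    intro c
    rw [hJ, Finset.sum_filter]
    rfl
  rw [h1, h1]
  rcases J.eq_empty_or_nonempty with h0 | h0
  · simp [h0, ENNReal.zero_rpow_of_pos hp]
  obtain ⟨z₀, hz₀, hmax⟩ := J.exists_max_image c h0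
  calc (∑ z ∈ J, c z) ^ p ≤ (M * c z₀) ^ p := by
        gcongr
        refine (Finset.sum_le_card_nsmul _ _ _ hmax).trans ?_
        rw [nsmul_eq_mul]
        gcongr
        exact hM J (Finset.filter_subset _ _) fun z hz => (Finset.mem_filter.1 hz).2
    _ = M ^ p * c z₀ ^ p := ENNReal.mul_rpow_of_nonneg _ _ hp.le
    _ ≤ _ := by
        gcongr
        exact Finset.single_le_sum (f := fun z => c z ^ p) (fun _ _ => zero_le) hz₀

theorem sum_measure_le [BorelSpace X] (ν : Measure X) (I : Finset X) (B : X → Set X) {M : ℝ≥0∞}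
    (hB : ∀ z, MeasurableSet (B z))
    (hM : ∀ x, ∀ J ⊆ I, (∀ z ∈ J, x ∈ B z) → (J.card : ℝ≥0∞) ≤ M) :
    ∑ z ∈ I, ν (B z) ≤ M * ν univ := by
  classical
  calc ∑ z ∈ I, ν (B z) = ∑ z ∈ I, ∫⁻ x, (B z).indicator (fun _ => 1) x ∂ν := by
        refine Finset.sum_congr rfl fun z _ => ?_
        rw [lintegral_indicator (hB z), setLIntegral_const, one_mul]
    _ = ∫⁻ x, ∑ z ∈ I, (B z).indicator (fun _ => 1) x ∂ν :=
        (lintegral_finsetSum _ fun z _ => measurable_const.indicator (hB z)).symm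
    _ ≤ ∫⁻ _, M ∂ν := by
        refine lintegral_mono fun x => ?_
        have h2 : ∑ z ∈ I, (B z).indicator (fun _ => (1 : ℝ≥0∞)) x =
            ∑ z ∈ I.filter fun z => x ∈ B z, 1 := by
          rw [Finset.sum_filter]
          rfl
        rw [h2, Finset.sum_const, nsmul_one]
        exact hM x _ (Finset.filter_subset _ _) fun z hz => (Finset.mem_filter.1 hz).2
    _ = _ := by rw [lintegral_const]

/-- The height of the tent of radius `r` about `z` at level `j`, adapted to the measure `ν`. -/
noncomputable def height (ν : Measure X) (p Q : ℝ) (R : ℝ) (j : ℕ) (z : X) : ℝ :=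
  ((j : ℝ) + 1) ^ (-(2 * max 1 p / p)) *
    ((ν (closedBall z (11 * (R * (1 / 2) ^ j)))).toReal * (R * (1 / 2) ^ j) ^ (p - Q)) ^ (1 / p)

theorem height_nonneg (ν : Measure X) (p Q : ℝ) {R : ℝ} (hR : 0 ≤ R) (j : ℕ) (z : X) :
    0 ≤ height ν p Q R j z := by
  unfold height
  positivity

theorem height_le {ν : Measure X} [IsFiniteMeasure ν] {p : ℝ} (hp : 0 < p) (Q : ℝ) {R : ℝ}
    (hR : 0 ≤ R) (j : ℕ) (z : X) :
    height ν p Q R j z ≤ ((ν univ).toReal * (R * (1 / 2) ^ j) ^ (p - Q)) ^ (1 / p) := by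
  unfold height
  have h1 : ((j : ℝ) + 1) ^ (-(2 * max 1 p / p)) ≤ 1 :=
    Real.rpow_le_one_of_one_le_of_nonpos (by linarith [Nat.cast_nonneg (α := ℝ) j])
      (neg_nonpos.2 (by positivity))
  refine (mul_le_of_le_one_left (by positivity) h1).trans ?_
  gcongr
  · exact measure_ne_top _ _
  · exact subset_univ _

/-- In ∑ (a/r)^p r^Q the powers of r cancel, leaving (j+1)^(-2 max(1,p)) ∑ ν(B(z,11r)), and the last
sum is bounded by overlap. The power 1 / max(1,p) turns the weight into (j+1)^(-2). The sup norms of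
the levels decay like r^((p-Q)/p) because p > Q. The nets fill a neighbourhood of E, so that points
near E can be used later. -/
theorem exists_bumpSystem_height [ProperSpace X] [BorelSpace X] {μ : Measure X}
    [IsLocallyFiniteMeasure μ] [μ.IsOpenPosMeasure] {Q p : ℝ} (hX : LocallyAhlforsRegular μ Q)
    (hQ : 0 < Q) (hQp : Q < p) {E : Set X} (hE : IsCompact E) (ν : Measure X)
    [IsFiniteMeasure ν] {R : ℝ} (hR : 0 < R) :
    ∃ S : BumpSystem μ p, (∀ j, S.r j = R * (1 / 2) ^ j) ∧ (∀ j z, S.a j z = height ν p Q R j z) ∧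
      ∀ j, ∀ x ∈ cthickening R E, ∃ z ∈ S.I j, dist x z ≤ R * (1 / 2) ^ j := by
  have hp : 0 < p := hQ.trans hQp
  set K := cthickening R E with hK
  have hKc : IsCompact K := hE.cthickening
  set r : ℕ → ℝ := fun j => R * (1 / 2) ^ j with hr
  have hr0 : ∀ j, 0 < r j := fun j => by positivity
  have hrR : ∀ j, r j ≤ R := fun j =>
    mul_le_of_le_one_right hR.le (pow_le_one₀ (by norm_num) (by norm_num))
  choose I hIK hIsep hInet using fun j => hKc.exists_separated_net (hr0 j)
  classical
  -- The overlap count uses radii up to 24 r, and r is at most R.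
  obtain ⟨C, hC, hb⟩ := hX.exists_bounds hQ hKc (S := 24 * R) (by positivity)
  set M : ℝ := C ^ 2 * 48 ^ Q with hM
  have hM0 : 0 ≤ M := by positivity
  have hcard : ∀ j x, (((I j).filter fun z => dist x z ≤ 11 * r j).card : ℝ) ≤ M := fun j x =>
    card_filter_dist_le hC hb (hr0 j) (by linarith [hrR j]) (hIK j) (hIsep j) x
  have hcard' : ∀ j x (B : X → Set X), (∀ z, B z ⊆ closedBall z (11 * r j)) → ∀ J ⊆ I j,
      (∀ z ∈ J, x ∈ B z) → (J.card : ℝ≥0∞) ≤ ENNReal.ofReal M := by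
    intro j x B hB J hJ hx
    rw [← ENNReal.ofReal_natCast]
    refine ENNReal.ofReal_le_ofReal (le_trans ?_ (hcard j x))
    exact_mod_cast Finset.card_le_card fun z hz => Finset.mem_filter.2 ⟨hJ hz, hB z (hx z hz)⟩
  set a : ℕ → X → ℝ := height ν p Q R with ha
  have ha0 : ∀ j z, 0 ≤ a j z := height_nonneg ν p Q hR.le
  set A : ℕ → ℝ := fun j => M * ((ν univ).toReal * r j ^ (p - Q)) ^ (1 / p) with hA
  have hAs : Summable A := by
    have h1 := (summable_mul_half_pow_rpow hR.le (ε := (p - Q) * (1 / p))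
      (mul_pos (sub_pos.2 hQp) (by positivity)) 0).mul_left (M * (ν univ).toReal ^ (1 / p))
    refine h1.congr fun j => ?_
    simp only [hA]
    rw [Real.rpow_zero, one_mul, Real.mul_rpow ENNReal.toReal_nonneg (by positivity),
      ← Real.rpow_mul (hr0 j).le, mul_assoc]
  refine ⟨⟨r, R, I, a, A, hr0, hrR, ha0, hAs, fun j x => ?_, ?_⟩, fun j => rfl, fun j z => rfl,
    hInet⟩
  · have h1 : ∑ z ∈ I j, a j z * bump z (r j) x =
        ∑ z ∈ (I j).filter fun z => dist x z ≤ 11 * r j, a j z * bump z (r j) x := by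
      rw [Finset.sum_filter]
      refine Finset.sum_congr rfl fun z _ => ?_
      split_ifs with h
      · rfl
      · rw [bump_eq_zero (hr0 j) (by linarith [hr0 j]), mul_zero]
    rw [h1]
    refine (Finset.sum_le_card_nsmul _ _ (((ν univ).toReal * r j ^ (p - Q)) ^ (1 / p))
      fun z _ => ?_).trans ?_
    · exact (mul_le_of_le_one_right (ha0 j z) (bump_le_one _ (hr0 j) _)).trans
        (height_le hp Q hR.le j z)
    · rw [nsmul_eq_mul]
      refine mul_le_mul_of_nonneg_right ?_ (by positivity)
      convert hcard j x
  · set q := max 1 p with hq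
    have hq0 : 0 < q := by positivity
    set D : ℝ≥0∞ := ENNReal.ofReal M ^ p * ENNReal.ofReal (C * 3 ^ Q / 2 ^ p) *
      (ENNReal.ofReal M * ν univ) with hD
    have hDt : D ≠ ∞ := ENNReal.mul_ne_top (ENNReal.mul_ne_top
      (ENNReal.rpow_ne_top_of_nonneg hp.le ENNReal.ofReal_ne_top) ENNReal.ofReal_ne_top)
      (ENNReal.mul_ne_top ENNReal.ofReal_ne_top (measure_ne_top _ _))
    have key : ∀ j, lpSize μ p (fun x => ∑ z ∈ I j, (closedBall z (2 * r j)).indicator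
        (fun _ => ENNReal.ofReal (a j z / (2 * r j))) x) ≤
        D ^ (1 / q) * ENNReal.ofReal (((j : ℝ) + 1) ^ (-2 : ℝ)) := by
      intro j
      have hrj := hr0 j
      set W : ℝ := ((j : ℝ) + 1) ^ (-(2 * q)) with hW
      have hj : (0 : ℝ) < (j : ℝ) + 1 := by positivity
      have hI : ∫⁻ x, (∑ z ∈ I j, (closedBall z (2 * r j)).indicator
          (fun _ => ENNReal.ofReal (a j z / (2 * r j))) x) ^ p ∂μ ≤ D * ENNReal.ofReal W := by
        calc _ ≤ ∫⁻ x, ENNReal.ofReal M ^ p * ∑ z ∈ I j, (closedBall z (2 * r j)).indicator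
              (fun _ => ENNReal.ofReal (a j z / (2 * r j)) ^ p) x ∂μ := by
              refine lintegral_mono fun x => sum_indicator_rpow_le hp _ _ _ x
                (hcard' j x _ fun z => closedBall_subset_closedBall (by linarith))
          _ = ENNReal.ofReal M ^ p * ∑ z ∈ I j, ENNReal.ofReal (a j z / (2 * r j)) ^ p *
              μ (closedBall z (2 * r j)) := by
              rw [lintegral_const_mul _ (Finset.measurable_fun_sum _ fun z _ =>
                measurable_const.indicator measurableSet_closedBall),
                lintegral_finsetSum _ fun z _ =>
                  measurable_const.indicator measurableSet_closedBall]
              congr 1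
              refine Finset.sum_congr rfl fun z _ => ?_
              rw [lintegral_indicator measurableSet_closedBall, setLIntegral_const]
          _ ≤ ENNReal.ofReal M ^ p * ∑ z ∈ I j, ENNReal.ofReal W *
              ENNReal.ofReal (C * 3 ^ Q / 2 ^ p) * ν (closedBall z (11 * r j)) := by
              refine mul_le_mul_right (Finset.sum_le_sum fun z hz => ?_) _
              have h3 : μ (closedBall z (2 * r j)) ≤ ENNReal.ofReal (C * (3 * r j) ^ Q) :=
                (measure_mono (closedBall_subset_ball (by linarith))).trans
                  (hb z (hIK j hz) (3 * r j) (by positivity) (by linarith [hrR j])).2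
              refine (mul_le_mul_right h3 _).trans ?_
              rw [← ENNReal.ofReal_toReal (measure_ne_top ν (closedBall z (11 * r j))),
                ENNReal.ofReal_rpow_of_nonneg (div_nonneg (ha0 j z) (by positivity)) hp.le,
                ← ENNReal.ofReal_mul (by
                  have := ha0 j z
                  positivity), ← ENNReal.ofReal_mul (by positivity),
                ← ENNReal.ofReal_mul (by positivity)]
              refine ENNReal.ofReal_le_ofReal (le_of_eq ?_)
              simp only [ha, height]
              set m := (ν (closedBall z (11 * r j))).toReal with hm
              have hm0 : 0 ≤ m := ENNReal.toReal_nonneg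
              change ((((j : ℝ) + 1) ^ (-(2 * max 1 p / p)) * (m * r j ^ (p - Q)) ^ (1 / p)) /
                (2 * r j)) ^ p * (C * (3 * r j) ^ Q) = _
              rw [Real.div_rpow (by positivity) (by positivity),
                Real.mul_rpow (by positivity) (by positivity), ← Real.rpow_mul hj.le,
                ← Real.rpow_mul (by positivity), Real.mul_rpow (by norm_num) hrj.le,
                Real.mul_rpow (by norm_num) hrj.le, one_div_mul_cancel hp.ne', Real.rpow_one,
                ← neg_div, div_mul_cancel₀ _ hp.ne', Real.rpow_sub hrj]
              field_simp
              exact mul_comm _ _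
          _ = ENNReal.ofReal M ^ p * (ENNReal.ofReal W *
              ENNReal.ofReal (C * 3 ^ Q / 2 ^ p) * ∑ z ∈ I j, ν (closedBall z (11 * r j))) := by
              rw [Finset.mul_sum (I j) _ (ENNReal.ofReal W * _)]
          _ ≤ ENNReal.ofReal M ^ p * (ENNReal.ofReal W *
              ENNReal.ofReal (C * 3 ^ Q / 2 ^ p) * (ENNReal.ofReal M * ν univ)) := by
              gcongr
              exact sum_measure_le ν (I j) _ (fun z => measurableSet_closedBall) fun x =>
                hcard' j x _ fun z => subset_rfl
          _ = _ := by
              rw [hD]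
              ring
      unfold lpSize
      refine (ENNReal.rpow_le_rpow hI (by positivity)).trans ?_
      rw [ENNReal.mul_rpow_of_nonneg _ _ (by positivity),
        ENNReal.ofReal_rpow_of_nonneg (by positivity) (by positivity), hW, ← Real.rpow_mul hj.le]
      refine mul_le_mul_right (ENNReal.ofReal_le_ofReal (le_of_eq ?_)) _
      rw [← neg_mul, mul_one_div, mul_div_cancel_right₀ _ hq0.ne']
    refine ne_top_of_le_ne_top ?_ (ENNReal.tsum_le_tsum key)
    rw [ENNReal.tsum_mul_left]
    refine ENNReal.mul_ne_top (ENNReal.rpow_ne_top_of_nonneg (by positivity) hDt) ?_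
    refine Summable.tsum_ofReal_ne_top ?_
    have h2 := (summable_nat_add_iff 1).2 (Real.summable_nat_rpow (p := (-2 : ℝ)).2 (by norm_num))
    exact_mod_cast h2

end Systems

/-! ### The kernel that dominates the expected energy. -/

section EnergyKernel

open Metric

theorem ENNReal.mul_rpow_neg {x y : ℝ≥0∞} (hx : x ≠ 0) (hx' : x ≠ ∞) {t : ℝ} (ht : 0 < t) :
    (x * y) ^ (-t) = x ^ (-t) * y ^ (-t) := by
  rw [ENNReal.rpow_neg, ENNReal.rpow_neg, ENNReal.rpow_neg, ENNReal.mul_rpow_of_nonneg _ _ ht.le,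
    ENNReal.mul_inv]
  · left
    simp [ENNReal.rpow_eq_zero_iff, hx, hx']
  · left
    exact ENNReal.rpow_ne_top_of_nonneg ht.le hx'

theorem ENNReal.rpow_neg_le_rpow_neg {x y : ℝ≥0∞} (h : x ≤ y) {t : ℝ} (ht : 0 ≤ t) :
    y ^ (-t) ≤ x ^ (-t) := by
  rw [ENNReal.rpow_neg, ENNReal.rpow_neg, ENNReal.inv_le_inv]
  exact ENNReal.rpow_le_rpow h ht

variable {X : Type*} [MetricSpace X] [MeasurableSpace X]

/-- The part of the energy kernel at level `j` that depends only on the scale. -/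
noncomputable def scaleFactor (p Q t R : ℝ) (j : ℕ) : ℝ≥0∞ :=
  ENNReal.ofReal (((j : ℝ) + 1) ^ (-(2 * max 1 p / p)) / 2) ^ (-t) *
    ENNReal.ofReal ((R * (1 / 2) ^ j) ^ (p - Q)) ^ (-(t / p))

/-- B(x,9r) lies in B(z,11r), so the mass that defines the height is at least that of a ball about
x. This removes the net point z from the estimate. -/
theorem ofReal_height_rpow_le {ν : Measure X} [IsFiniteMeasure ν] {p Q R t : ℝ} (hp : 0 < p)
    (ht : 0 < t) (hR : 0 < R) {j : ℕ} {x z : X} (hxz : dist x z ≤ 2 * (R * (1 / 2) ^ j)) :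
    ENNReal.ofReal (height ν p Q R j z / 2) ^ (-t) ≤
      scaleFactor p Q t R j * ν (closedBall x (9 * (R * (1 / 2) ^ j))) ^ (-(t / p)) := by
  set r := R * (1 / 2) ^ j with hr
  have hr0 : 0 < r := by positivity
  set w : ℝ := ((j : ℝ) + 1) ^ (-(2 * max 1 p / p)) with hw
  have hw0 : 0 < w := by positivity
  have h1 : ENNReal.ofReal (height ν p Q R j z / 2) = ENNReal.ofReal (w / 2) *
      (ENNReal.ofReal (r ^ (p - Q)) * ν (closedBall z (11 * r))) ^ (1 / p) := by
    rw [← ENNReal.ofReal_toReal (measure_ne_top ν (closedBall z (11 * r))),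
      ← ENNReal.ofReal_mul (by positivity), ENNReal.ofReal_rpow_of_nonneg (by positivity)
      (by positivity), ← ENNReal.ofReal_mul (by positivity)]
    congr 1
    rw [height, ← hr, ← hw, mul_comm (r ^ (p - Q))]
    ring
  have h2 : ENNReal.ofReal (r ^ (p - Q)) ≠ 0 := by
    rw [Ne, ENNReal.ofReal_eq_zero, not_le]
    positivity
  rw [h1, ENNReal.mul_rpow_neg (by
    rw [Ne, ENNReal.ofReal_eq_zero, not_le]
    positivity) ENNReal.ofReal_ne_top ht, ← ENNReal.rpow_mul,
    show 1 / p * -t = -(t / p) by ring, ENNReal.mul_rpow_neg h2 ENNReal.ofReal_ne_top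
    (by positivity), scaleFactor, mul_assoc]
  refine mul_le_mul_right (mul_le_mul_right (ENNReal.rpow_neg_le_rpow_neg (measure_mono ?_)
    (by positivity)) _) _
  exact closedBall_subset_closedBall' (by linarith)

theorem ENNReal.mul_rpow_neg_le {x : ℝ≥0∞} (hx : x ≠ ∞) (a : ℝ) :
    x * x ^ (-a) ≤ x ^ (1 - a) := by
  rcases eq_or_ne x 0 with rfl | h0
  · simp
  · rw [sub_eq_add_neg, ENNReal.rpow_add _ _ h0 hx, ENNReal.rpow_one]

/-- A kernel that controls the expected energy of a random sum of tent functions. -/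
noncomputable def energyKernel (ν : Measure X) (p Q t R : ℝ) (x y : X) : ℝ≥0∞ :=
  ∑' j : ℕ, (closedBall x (8 * (R * (1 / 2) ^ j))).indicator
    (fun _ => scaleFactor p Q t R j * ν (closedBall x (9 * (R * (1 / 2) ^ j))) ^ (-(t / p))) y

theorem le_energyKernel {ν : Measure X} {p Q t R : ℝ} {x y : X} {j : ℕ}
    (h : dist x y ≤ 8 * (R * (1 / 2) ^ j)) :
    scaleFactor p Q t R j * ν (closedBall x (9 * (R * (1 / 2) ^ j))) ^ (-(t / p)) ≤
      energyKernel ν p Q t R x y := by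
  refine le_trans (le_of_eq ?_) (ENNReal.le_tsum j)
  rw [indicator_of_mem]
  rwa [mem_closedBall, dist_comm]

/-- With b = t/p, integrating level j in y gives at most ν(B(x,9r))^(1-b) ≤ (C (9r)^s)^(1-b) times
the scale factor, that is, a constant times (j+1)^k r^ε. The assumption on t says exactly that ε >
0, and geometric decay then absorbs the polynomial. -/
theorem lintegral_energyKernel_ne_top [BorelSpace X] {ν : Measure X} [IsFiniteMeasure ν]
    {p Q t R s : ℝ} {C : ℝ≥0} (hQ : Q < p) (hp : 0 < p) (hs : 0 < s) (ht : 0 < t) (hR : 0 < R)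
    (htp : t * (p - Q + s) < p * s)
    (hν : ∀ x r, 0 < r → ν (closedBall x r) ≤ C * ENNReal.ofReal r ^ s) :
    ∫⁻ x, ∫⁻ y, energyKernel ν p Q t R x y ∂ν ∂ν ≠ ∞ := by
  -- If t ≥ p, then t(p-Q+s) ≥ p(p-Q+s) > ps.
  have htp' : t < p := by
    by_contra! h
    nlinarith
  set b := t / p with hb
  have hb0 : 0 < b := by positivity
  have hb1 : 0 < 1 - b := by
    rw [sub_pos, hb, div_lt_one hp]
    exact htp'
  set ε := s * (1 - b) - (p - Q) * b with hε
  have hε0 : 0 < ε := by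
    have : ε = (p * s - t * (p - Q + s)) / p := by
      rw [hε, hb]
      field_simp
      ring
    rw [this]
    exact div_pos (by linarith) hp
  set k : ℝ := 2 * max 1 p / p * t with hk
  set B : ℕ → ℝ≥0∞ := fun j =>
    scaleFactor p Q t R j * (C * ENNReal.ofReal (9 * (R * (1 / 2) ^ j)) ^ s) ^ (1 - b) with hB
  have h1 : ∀ x, ∫⁻ y, energyKernel ν p Q t R x y ∂ν ≤ ∑' j, B j := by
    intro x
    unfold energyKernel
    rw [lintegral_tsum fun j =>
      (measurable_const.indicator measurableSet_closedBall).aemeasurable]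
    refine ENNReal.tsum_le_tsum fun j => ?_
    have hr0 : 0 < R * (1 / 2) ^ j := by positivity
    rw [lintegral_indicator measurableSet_closedBall, setLIntegral_const, hB, mul_assoc]
    refine mul_le_mul_right ?_ _
    have h2 := measure_mono (μ := ν) (closedBall_subset_closedBall (x := x)
      (show 8 * (R * (1 / 2) ^ j) ≤ 9 * (R * (1 / 2) ^ j) by linarith))
    refine (mul_le_mul_right h2 _).trans ?_
    rw [mul_comm]
    refine (ENNReal.mul_rpow_neg_le (measure_ne_top _ _) b).trans ?_
    exact ENNReal.rpow_le_rpow (hν x _ (by positivity)) hb1.le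
  have hBt : ∑' j, B j ≠ ∞ := by
    have h3 : ∀ j, B j = ENNReal.ofReal (2 ^ t * ((C : ℝ) * 9 ^ s) ^ (1 - b)) *
        ENNReal.ofReal (((j : ℝ) + 1) ^ k * (R * (1 / 2) ^ j) ^ ε) := by
      intro j
      have hj : (0 : ℝ) < (j : ℝ) + 1 := by positivity
      set r := R * (1 / 2) ^ j with hr
      have hr0 : 0 < r := by positivity
      simp only [hB, scaleFactor]
      rw [← hr, ENNReal.ofReal_rpow_of_pos (by positivity),
        ENNReal.ofReal_rpow_of_pos (by positivity), ← ENNReal.ofReal_coe_nnreal,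
        ENNReal.ofReal_rpow_of_pos (by positivity),
        ← ENNReal.ofReal_mul (p := (C : ℝ)) C.coe_nonneg,
        ENNReal.ofReal_rpow_of_nonneg (by positivity) hb1.le, ← ENNReal.ofReal_mul (by positivity),
        ← ENNReal.ofReal_mul (by positivity), ← ENNReal.ofReal_mul (by positivity)]
      congr 1
      rw [Real.div_rpow (by positivity) (by norm_num), ← Real.rpow_mul hj.le,
        ← Real.rpow_mul hr0.le, Real.mul_rpow (by norm_num) hr0.le, ← mul_assoc,
        Real.mul_rpow (x := (C : ℝ) * 9 ^ s) (by positivity) (by positivity),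
        ← Real.rpow_mul hr0.le, Real.rpow_neg (by norm_num : (0 : ℝ) ≤ 2), hε,
        sub_eq_add_neg (s * (1 - b)),
        Real.rpow_add hr0, hk, neg_mul_neg, mul_neg]
      field_simp
      rw [mul_comm, hb, mul_comm t, mul_div_assoc]
    simp_rw [h3]
    rw [ENNReal.tsum_mul_left]
    exact ENNReal.mul_ne_top ENNReal.ofReal_ne_top
      (summable_mul_half_pow_rpow hR.le hε0 k).tsum_ofReal_ne_top
  refine ne_top_of_le_ne_top ?_ (lintegral_mono h1)
  rw [lintegral_const]
  exact ENNReal.mul_ne_top hBt (measure_ne_top _ _)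

/-- A bump system whose random sums have finite expected energy with respect to `ν`. -/
theorem exists_bumpSystem_energyKernel [ProperSpace X] [BorelSpace X] {μ : Measure X}
    [IsLocallyFiniteMeasure μ] [μ.IsOpenPosMeasure] {Q p s : ℝ} (hX : LocallyAhlforsRegular μ Q)
    (hQ : 0 < Q) (hQp : Q < p) (hs : 0 < s) {E : Set X} (hE : IsCompact E) (ν : Measure X)
    [IsFiniteMeasure ν] {C : ℝ≥0}
    (hν : ∀ x r, 0 < r → ν (closedBall x r) ≤ C * ENNReal.ofReal r ^ s) :
    ∃ S : BumpSystem μ p, ∀ t, 0 < t → t * (p - Q + s) < p * s →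
      ∃ κ : X → X → ℝ≥0∞, ∫⁻ x, ∫⁻ y, κ x y ∂ν ∂ν ≠ ∞ ∧
        ∀ x ∈ E, ∀ y ∈ E, x ≠ y → ∀ x' y', dist x x' ≤ dist x y / 8 → dist y y' ≤ dist x y / 8 →
          ∃ i : S.Index, dist x' i.2 ≤ S.r i.1 ∧ 2 * S.r i.1 ≤ dist y' i.2 ∧
            ENNReal.ofReal (S.a i.1 i.2 / 2) ^ (-t) ≤ κ x y := by
  have hp : 0 < p := hQ.trans hQp
  set R := diam E + 1 with hR
  have hR0 : 0 < R := by
    have := diam_nonneg (s := E)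
    positivity
  obtain ⟨S, hSr, hSa, hSI⟩ := exists_bumpSystem_height hX hQ hQp hE ν hR0
  refine ⟨S, fun t ht htp => ⟨energyKernel ν p Q t R,
    lintegral_energyKernel_ne_top hQp hp hs ht hR0 htp hν, ?_⟩⟩
  intro x hx y hy hxy x' y' hx' hy'
  have hd : 0 < dist x y := dist_pos.2 hxy
  have hdR : dist x y ≤ R := by
    have := dist_le_diam_of_mem hE.isBounded hx hy
    linarith
  -- As d/8 ≤ r_j for d = d(x,y), the perturbed points are within r_j of x and y, and a net point z
  -- within r_j of x' is within 2 r_j of x.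
  obtain ⟨j, hj1, hj2⟩ := exists_scale hd hdR
  obtain ⟨z, hz, hxz⟩ := hSI j x' (mem_cthickening_of_dist_le x' x R E hx
    (by rw [dist_comm]; linarith))
  refine ⟨⟨j, z, hz⟩, by rwa [hSr], ?_, ?_⟩
  -- The triangle inequality gives d(y',z) ≥ d - d/8 - r - d/8 = 3d/4 - r, which exceeds 2r because
  -- d > 4r.
  · rw [hSr]
    change _ ≤ dist y' z
    have h1 := dist_triangle4 x x' z y
    have h2 := dist_triangle z y' y
    rw [dist_comm z y', dist_comm y' y] at h2
    linarith
  · rw [hSa]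
    refine (ofReal_height_rpow_le hp ht hR0 (x := x) ?_).trans (le_energyKernel hj2)
    have h1 := dist_triangle x x' z
    change dist x z ≤ _
    linarith

end EnergyKernel

/-- The set where some lower limit is infinite is Borel, and its transverse measure is the law of Φ,
supported on a compact image. By Fatou's lemma each lower limit has finite expectation after any
translation, so it is almost surely finite. -/
theorem isShy_of_forall_exists_liminf_eq_top {B : Type*} [AddCommGroup B] [TopologicalSpace B]
    [ContinuousAdd B] [T2Space B] {Ω : Type*} [TopologicalSpace Ω] [CompactSpace Ω]
    [MeasurableSpace Ω] [OpensMeasurableSpace Ω] (P : Measure Ω) [IsProbabilityMeasure P]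
    {Φ : Ω → B} (hΦ : Continuous Φ) {J : ℕ → ℕ → B → ℝ≥0∞} (hJ : ∀ k n, Continuous (J k n))
    {C : ℕ → ℝ≥0∞} (hC : ∀ k, C k ≠ ∞) (h : ∀ k n x, ∫⁻ ω, J k n (Φ ω + x) ∂P ≤ C k)
    {S : Set B} (hS : ∀ u ∈ S, ∃ k, liminf (fun n => J k n u) atTop = ∞) : IsShy S := by
  let _ : MeasurableSpace B := borel B
  have : BorelSpace B := ⟨rfl⟩
  have hJm : ∀ k, Measurable fun u => liminf (fun n => J k n u) atTop := fun k =>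
    Measurable.liminf fun n => (hJ k n).measurable
  set T : Set B := ⋃ k, {u | liminf (fun n => J k n u) atTop = ∞} with hT
  have hTm : MeasurableSet T := MeasurableSet.iUnion fun k => hJm k (measurableSet_singleton ∞)
  refine ⟨T, fun u hu => mem_iUnion.2 (hS u hu), hTm, P.map Φ, ?_,
    ⟨range Φ, isCompact_range hΦ, ?_⟩, fun x => ?_⟩
  · rw [Measure.map_apply hΦ.measurable MeasurableSet.univ, preimage_univ, measure_univ]
  · rw [Measure.map_apply hΦ.measurable (isCompact_range hΦ).isClosed.measurableSet.compl]
    simp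
  · have h1 : (fun y => y + x) '' T = (fun y => y + -x) ⁻¹' T := by
      ext y
      constructor
      · rintro ⟨z, hz, rfl⟩
        simpa using hz
      · exact fun hy => ⟨y + -x, hy, by simp⟩
    have hc : Continuous fun y : B => y + -x := continuous_id.add continuous_const
    rw [h1, Measure.map_apply hΦ.measurable (hc.measurable hTm)]
    have h2 : Φ ⁻¹' ((fun y => y + -x) ⁻¹' T) =
        ⋃ k, {ω | liminf (fun n => J k n (Φ ω + -x)) atTop = ∞} := by
      simp [hT, preimage_iUnion]
    rw [h2, measure_iUnion_null_iff]
    intro k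
    have hm : ∀ n, Measurable fun ω => J k n (Φ ω + -x) := fun n =>
      ((hJ k n).comp (hc.comp hΦ)).measurable
    have h3 : ∫⁻ ω, liminf (fun n => J k n (Φ ω + -x)) atTop ∂P ≠ ∞ := by
      refine ne_top_of_le_ne_top (hC k) ((lintegral_liminf_le hm).trans ?_)
      exact liminf_le_of_le (by isBoundedDefault) fun b hb => by
        obtain ⟨n, hn⟩ := hb.exists
        exact hn.trans (h k n _)
    have h4 := ae_lt_top (Measurable.liminf hm) h3
    rw [ae_iff] at h4
    simpa using h4

/-! ### Truncated energies as continuous functions of classes. -/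

section Functionals

variable {X : Type*} [MetricSpace X] [MeasurableSpace X] [BorelSpace X] {μ : Measure X} {p : ℝ}
  [hp : Fact (0 < p)] {F : Type*} [NormedAddCommGroup F] [NormedSpace ℝ F] [MeasurableSpace F]
  [BorelSpace F] [SecondCountableTopology F]

theorem newtonianSize_sub_eq_edist (f g : NewtonianFunction μ p F) :
    newtonianSize μ p (f.1 - g.1) = edist f g := by
  rw [edist_dist, dist_eq_norm]
  exact (ENNReal.ofReal_toReal (newtonianSize_lt_top (f - g)).ne).symm

theorem NewtonianFunction.measurable (f : NewtonianFunction μ p F) : Measurable (f : X → F) := f.2.1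

theorem isExceptional_ne_of_represents {f g : NewtonianFunction μ p F} {u : NewtonianSpace μ p F}
    (hf : Represents f u) (hg : Represents g u) : IsExceptional μ p {x | f.1 x ≠ g.1 x} := by
  have h1 : newtonianSize μ p (f.1 - g.1) = 0 := by
    rw [newtonianSize_sub_eq_edist, ← SeparationQuotient.edist_mk, hf.trans hg.symm, edist_self]
  have h2 := isExceptional_ne_zero hp.out (f.measurable.sub g.measurable) h1
  simpa only [Pi.sub_apply, ne_eq, sub_eq_zero] using h2

/-- A representative of a class. -/
noncomputable def NewtonianSpace.rep (u : NewtonianSpace μ p F) : NewtonianFunction μ p F :=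
  Function.surjInv SeparationQuotient.surjective_mk u

theorem NewtonianSpace.represents_rep (u : NewtonianSpace μ p F) : Represents u.rep u :=
  Function.surjInv_eq SeparationQuotient.surjective_mk u

/-- The truncated energy integrand. -/
noncomputable def truncatedEnergy (t : ℝ) (n : ℕ) (a b : F) : ℝ≥0∞ := min n (edist a b ^ (-t))

theorem continuous_truncatedEnergy (t : ℝ) (n : ℕ) :
    Continuous fun q : F × F => truncatedEnergy t n q.1 q.2 :=
  continuous_const.min (ENNReal.continuous_rpow_const.comp (continuous_fst.edist continuous_snd))

theorem measurable_truncatedEnergy (t : ℝ) (n : ℕ) {f : X → F} (hf : Measurable f) :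
    Measurable fun q : X × X => truncatedEnergy t n (f q.1) (f q.2) :=
  (continuous_truncatedEnergy t n).measurable.comp
    ((hf.comp measurable_fst).prodMk (hf.comp measurable_snd))

variable (μ p) in
/-- The measure on pairs of points has marginals that do not charge exceptional sets. -/
def NotChargingExceptional (σ : Measure (X × X)) : Prop :=
  ∀ A, IsExceptional μ p A → σ (Prod.fst ⁻¹' A) = 0 ∧ σ (Prod.snd ⁻¹' A) = 0

theorem NotChargingExceptional.ae {σ : Measure (X × X)} (hσ : NotChargingExceptional μ p σ)
    {P : X → Prop} (hA : IsExceptional μ p {x | ¬ P x}) : ∀ᵐ q ∂σ, P q.1 ∧ P q.2 := by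
  have h1 : ∀ᵐ q ∂σ, P q.1 := (hσ _ hA).1
  have h2 : ∀ᵐ q ∂σ, P q.2 := (hσ _ hA).2
  exact h1.and h2

theorem lintegral_congr_of_represents {σ : Measure (X × X)} (hσ : NotChargingExceptional μ p σ)
    {f g : NewtonianFunction μ p F} {u : NewtonianSpace μ p F} (hf : Represents f u)
    (hg : Represents g u) (G : F → F → ℝ≥0∞) :
    ∫⁻ q, G (f.1 q.1) (f.1 q.2) ∂σ = ∫⁻ q, G (g.1 q.1) (g.1 q.2) ∂σ := by
  refine lintegral_congr_ae ?_
  filter_upwards [hσ.ae (isExceptional_ne_of_represents hf hg)] with q hq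
  rw [hq.1, hq.2]

/-- The truncated energy of a class in the Newtonian-Sobolev space. -/
noncomputable def energyFunctional (σ : Measure (X × X)) (t : ℝ) (n : ℕ)
    (u : NewtonianSpace μ p F) : ℝ≥0∞ :=
  ∫⁻ q, truncatedEnergy t n (u.rep.1 q.1) (u.rep.1 q.2) ∂σ

theorem energyFunctional_eq {σ : Measure (X × X)} (hσ : NotChargingExceptional μ p σ) (t : ℝ)
    (n : ℕ) {f : NewtonianFunction μ p F} {u : NewtonianSpace μ p F} (hf : Represents f u) :
    energyFunctional σ t n u = ∫⁻ q, truncatedEnergy t n (f.1 q.1) (f.1 q.2) ∂σ :=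
  lintegral_congr_of_represents hσ u.represents_rep hf _

/-- Every subsequence of a convergent sequence has a further one that converges so fast that
Fuglede's lemma gives pointwise convergence of representatives off an exceptional set, which σ
ignores. The truncation supplies the constant n for dominated convergence. -/
theorem continuous_energyFunctional {σ : Measure (X × X)} [IsFiniteMeasure σ]
    (hσ : NotChargingExceptional μ p σ) (t : ℝ) (n : ℕ) :
    Continuous (energyFunctional (μ := μ) (p := p) (F := F) σ t n) := by
  rw [continuous_iff_seqContinuous]
  intro v u hv
  refine tendsto_of_subseq_tendsto fun ns hns => ?_
  have hvn := hv.comp hns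
  have hex : ∀ k : ℕ, ∃ N, ∀ m ≥ N, edist (v (ns m)) u ≤ ENNReal.ofReal ((1 / 2) ^ k) := by
    intro k
    have h1 := (tendsto_iff_edist_tendsto_0.1 hvn).eventually
      (gt_mem_nhds (show (0 : ℝ≥0∞) < ENNReal.ofReal ((1 / 2) ^ k) by
        rw [ENNReal.ofReal_pos]
        positivity))
    obtain ⟨N, hN⟩ := eventually_atTop.1 h1
    exact ⟨N, fun m hm => (hN m hm).le⟩
  choose ms hms using hex
  refine ⟨ms, ?_⟩
  have hsum : ∑' k, newtonianSize μ p (((v (ns (ms k))).rep.1 : X → F) - u.rep.1) ≠ ∞ := by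
    refine ne_top_of_le_ne_top summable_geometric_two.tsum_ofReal_ne_top
      (ENNReal.tsum_le_tsum fun k => ?_)
    refine le_trans (le_of_eq ?_) (hms k _ le_rfl)
    rw [newtonianSize_sub_eq_edist, ← SeparationQuotient.edist_mk,
      (v (ns (ms k))).represents_rep, u.represents_rep]
  have hexc := isExceptional_not_tendsto hp.out
    (fun k => ((v (ns (ms k))).rep.measurable.sub u.rep.measurable)) hsum
  refine tendsto_lintegral_of_dominated_convergence (fun _ => (n : ℝ≥0∞))
    (fun k => measurable_truncatedEnergy t n (v (ns (ms k))).rep.measurable)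
    (fun k => ae_of_all _ fun q => min_le_left _ _) ?_ ?_
  · rw [lintegral_const]
    exact ENNReal.mul_ne_top (ENNReal.natCast_ne_top n) (measure_ne_top _ _)
  · filter_upwards [hσ.ae hexc] with q hq
    have h2 : ∀ x, Tendsto (fun k => (((v (ns (ms k))).rep.1 : X → F) - u.rep.1) x) atTop (𝓝 0) →
        Tendsto (fun k => (v (ns (ms k))).rep.1 x) atTop (𝓝 (u.rep.1 x)) := fun x hx => by
      simpa using hx.add_const (u.rep.1 x)
    exact ((continuous_truncatedEnergy t n).tendsto _).comp ((h2 _ hq.1).prodMk_nhds (h2 _ hq.2))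

end Functionals

theorem measurable_enorm_add_sub_rpow {A X F : Type*} [MeasurableSpace A] [MeasurableSpace X]
    [NormedAddCommGroup F] [MeasurableSpace F] [BorelSpace F] [SecondCountableTopology F]
    {g : A → X → F} (hg : Measurable fun q : A × X => g q.1 q.2) {v : X × X → F}
    (hv : Measurable v) (t : ℝ) :
    Measurable fun z : A × (X × X) => ‖v z.2 + (g z.1 z.2.1 - g z.1 z.2.2)‖ₑ ^ (-t) := by
  have h1 : Measurable fun z : A × (X × X) => g z.1 z.2.1 :=
    hg.comp (measurable_fst.prodMk (measurable_fst.comp measurable_snd))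
  have h2 : Measurable fun z : A × (X × X) => g z.1 z.2.2 :=
    hg.comp (measurable_fst.prodMk (measurable_snd.comp measurable_snd))
  exact (((hv.comp measurable_snd).add (h1.sub h2)).enorm).pow_const _

/-! ### Prevalence from bounds on the mean energy. -/

namespace BumpSystem

open Metric Module

variable {X : Type*} [MetricSpace X] [MeasurableSpace X] [BorelSpace X]
  [SecondCountableTopology X] {μ : Measure X} {p : ℝ}
  (S : BumpSystem μ p)
  {F : Type*} [NormedAddCommGroup F] [NormedSpace ℝ F] [FiniteDimensional ℝ F]
  [MeasureSpace F] [BorelSpace F] [(volume : Measure F).IsAddHaarMeasure]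
  [SecondCountableTopology F] [CompleteSpace F]

theorem measurable_uncurry_toFun : Measurable fun q : S.Coeff F × X => S.toFun q.1 q.2 :=
  S.continuous_toFun.measurable

theorem measurable_energy (t : ℝ) {v : X × X → F} (hv : Measurable v) :
    Measurable fun z : S.Coeff F × (X × X) =>
      ‖v z.2 + (S.toFun z.1 z.2.1 - S.toFun z.1 z.2.2)‖ₑ ^ (-t) :=
  measurable_enorm_add_sub_rpow (g := S.toFun) S.measurable_uncurry_toFun hv t

/-- The energy of a random sum, with a perturbation, averaged over the coefficients. -/
noncomputable def meanEnergy (t : ℝ) (v : X × X → F) (q : X × X) : ℝ≥0∞ :=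
  ∫⁻ ω, ‖v q + (S.toFun ω q.1 - S.toFun ω q.2)‖ₑ ^ (-t) ∂S.law F

theorem measurable_meanEnergy (t : ℝ) {v : X × X → F} (hv : Measurable v) :
    Measurable (S.meanEnergy t v) :=
  Measurable.lintegral_prod_left' (μ := S.law F) (S.measurable_energy t hv)

theorem lintegral_law_lintegral (t : ℝ) {v : X × X → F} (hv : Measurable v) (σ : Measure (X × X))
    [SFinite σ] :
    ∫⁻ ω, ∫⁻ q, ‖v q + (S.toFun ω q.1 - S.toFun ω q.2)‖ₑ ^ (-t) ∂σ ∂S.law F =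
      ∫⁻ q, S.meanEnergy t v q ∂σ :=
  lintegral_lintegral_swap (f := fun ω q => ‖v q + (S.toFun ω q.1 - S.toFun ω q.2)‖ₑ ^ (-t))
    (S.measurable_energy t hv).aemeasurable

variable [hp : Fact (0 < p)]

/-- The transverse measure is the law of the random series. Translating by a class only changes the
perturbation v, over which the bounds are uniform. -/
theorem isPrevalent_of_energy {σ : ℕ → Measure (X × X)} [∀ n, IsFiniteMeasure (σ n)]
    (hσ : ∀ n, NotChargingExceptional μ p (σ n)) {t : ℕ → ℝ}
    (h : ∀ k, ∃ C : ℝ≥0∞, C ≠ ∞ ∧ ∀ n, ∀ v : X × X → F, Measurable v →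
      ∫⁻ q, S.meanEnergy (t k) v q ∂σ n ≤ C) {G : Set (NewtonianSpace μ p F)}
    (hG : ∀ u, (∀ k, liminf (fun n => energyFunctional (σ n) (t k) n u) atTop ≠ ∞) → u ∈ G) :
    IsPrevalent G := by
  choose C hC hb using h
  have hΦ : Continuous fun ω : S.Coeff F =>
      (SeparationQuotient.mk (S.toNewtonian ω) : NewtonianSpace μ p F) :=
    SeparationQuotient.continuous_mk.comp S.continuous_toNewtonian
  refine isShy_of_forall_exists_liminf_eq_top (S.law F) hΦ
    (J := fun k n u => energyFunctional (σ n) (t k) n u)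
    (fun k n => continuous_energyFunctional (hσ n) (t k) n) hC (fun k n x => ?_) fun u hu => ?_
  · set f := NewtonianSpace.rep x with hf
    have hv : Measurable fun q : X × X => f.1 q.1 - f.1 q.2 :=
      (f.measurable.comp measurable_fst).sub (f.measurable.comp measurable_snd)
    refine le_trans ?_ (hb k n _ hv)
    rw [← S.lintegral_law_lintegral (t k) hv (σ n)]
    refine lintegral_mono fun ω => ?_
    have hr : Represents (S.toNewtonian ω + f) (SeparationQuotient.mk (S.toNewtonian ω) + x) := by
      rw [Represents, SeparationQuotient.mk_add]
      congr 1
      exact NewtonianSpace.represents_rep x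
    rw [energyFunctional_eq (hσ n) (t k) n hr]
    refine lintegral_mono fun q => (min_le_right _ _).trans (le_of_eq ?_)
    congr 1
    rw [edist_eq_enorm_sub]
    congr 1
    change S.toFun ω q.1 + f.1 q.1 - (S.toFun ω q.2 + f.1 q.2) = _
    abel
  · by_contra! hcon
    exact hu (hG u hcon)

end BumpSystem

/-! ### Integrating the kernel bound over pairs. -/

section MeanEnergy

open Metric Module

variable {X : Type*} [MetricSpace X] [MeasurableSpace X] [BorelSpace X]
  [SecondCountableTopology X] {μ : Measure X} {p : ℝ}
  (F : Type*) [NormedAddCommGroup F] [NormedSpace ℝ F] [FiniteDimensional ℝ F]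
  [MeasureSpace F] [BorelSpace F] [(volume : Measure F).IsAddHaarMeasure]
  [SecondCountableTopology F] [CompleteSpace F]

/-- The kernel `κ` controls the mean energy of the random sums of `S`, uniformly for perturbations
of the function and for pairs of points near a pair of points of `E`. -/
def BumpSystem.ControlledBy (S : BumpSystem μ p) (E : Set X) (t : ℝ) (κ : X → X → ℝ≥0∞) : Prop :=
  ∀ x ∈ E, ∀ y ∈ E, x ≠ y → ∀ x' y', dist x x' ≤ dist x y / 8 → dist y y' ≤ dist x y / 8 →
    ∀ v : X × X → F, S.meanEnergy t v (x', y') ≤ κ x y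

theorem exists_bumpSystem_controlledBy [ProperSpace X]
    [IsLocallyFiniteMeasure μ] [μ.IsOpenPosMeasure] {Q s : ℝ} (hX : LocallyAhlforsRegular μ Q)
    (hQ : 0 < Q) (hQp : Q < p) (hs : 0 < s) {E : Set X} (hE : IsCompact E) (ν : Measure X)
    [IsFiniteMeasure ν] {C : ℝ≥0}
    (hν : ∀ x r, 0 < r → ν (closedBall x r) ≤ C * ENNReal.ofReal r ^ s)
    (hF : 1 ≤ finrank ℝ F) :
    ∃ S : BumpSystem μ p, ∀ t, 0 < t → t * (p - Q + s) < p * s → t < finrank ℝ F →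
      ∃ κ : X → X → ℝ≥0∞, ∫⁻ x, ∫⁻ y, κ x y ∂ν ∂ν ≠ ∞ ∧ S.ControlledBy F E t κ := by
  obtain ⟨S, hS⟩ := exists_bumpSystem_energyKernel hX hQ hQp hs hE ν hν
  refine ⟨S, fun t ht htp htF => ?_⟩
  obtain ⟨κ, hκ, hκE⟩ := hS t ht htp
  obtain ⟨D, hD, hDS⟩ := S.exists_lintegral_law_le (F := F) hF ht htF
  refine ⟨fun x y => D * κ x y, ?_, fun x hx y hy hxy x' y' hx' hy' v => ?_⟩
  · simp_rw [lintegral_const_mul' D _ hD]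
    exact ENNReal.mul_ne_top hD hκ
  · obtain ⟨i, hi1, hi2, hi3⟩ := hκE x hx y hy hxy x' y' hx' hy'
    exact (hDS i x' y' hi1 hi2 (v (x', y'))).trans (mul_le_mul_right hi3 _)

variable {F}

theorem ae_mem_of_compl_eq_zero {ν : Measure X} {E : Set X} (h : ν Eᶜ = 0) : ∀ᵐ x ∂ν, x ∈ E := h

/-- The kernel controls only distinct points; as ν has no atoms, the diagonal is negligible. -/
theorem BumpSystem.ControlledBy.lintegral_prod_le {S : BumpSystem μ p} {E : Set X} {t : ℝ}
    {κ : X → X → ℝ≥0∞} (h : S.ControlledBy F E t κ) {ν : Measure X} [IsFiniteMeasure ν]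
    [NullSingletonClass ν] (hνE : ν Eᶜ = 0) {v : X × X → F} (hv : Measurable v) :
    ∫⁻ q, S.meanEnergy t v q ∂ν.prod ν ≤ ∫⁻ x, ∫⁻ y, κ x y ∂ν ∂ν := by
  rw [lintegral_prod _ (S.measurable_meanEnergy t hv).aemeasurable]
  have hE := ae_mem_of_compl_eq_zero hνE
  refine lintegral_mono_ae ?_
  filter_upwards [hE] with x hx
  refine lintegral_mono_ae ?_
  have hxy : ∀ᵐ y ∂ν, y ≠ x := by simp [ae_iff]
  filter_upwards [hE, hxy] with y hy hyx
  exact h x hx y hy hyx.symm x y (by rw [dist_self]; positivity) (by rw [dist_self]; positivity) v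

end MeanEnergy

section Truncation

variable {F : Type*} [NormedAddCommGroup F]

theorem tendsto_truncatedEnergy (t : ℝ) (a b : F) :
    Tendsto (fun n => truncatedEnergy t n a b) atTop (𝓝 (edist a b ^ (-t))) := by
  have := (ENNReal.tendsto_nat_nhds_top).min (tendsto_const_nhds (x := edist a b ^ (-t)))
  rwa [min_eq_right le_top] at this

end Truncation

/-! ### Averages of `ν.prod ν` over small balls, normalized by r^(2Q). -/

section Coupling

open Metric

variable {X : Type*} [MetricSpace X] [MeasurableSpace X] [BorelSpace X]
  [SecondCountableTopology X]

/-- The radius of the balls over which the coupling averages. -/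
noncomputable def couplingRadius (n : ℕ) : ℝ := 1 / (8 * ((n : ℝ) + 1))

theorem couplingRadius_pos (n : ℕ) : 0 < couplingRadius n := by
  unfold couplingRadius
  positivity

theorem couplingRadius_le_one (n : ℕ) : couplingRadius n ≤ 1 := by
  unfold couplingRadius
  rw [div_le_one (by positivity)]
  linarith [Nat.cast_nonneg (α := ℝ) n]

theorem tendsto_couplingRadius : Tendsto couplingRadius atTop (𝓝 0) := by
  have h := (tendsto_one_div_add_atTop_nhds_zero_nat (𝕜 := ℝ)).const_mul (1 / 8)
  rw [mul_zero] at h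
  refine h.congr fun n => ?_
  rw [couplingRadius]
  field_simp

/-- Pairs of points near a given pair of points that are not too close to each other. -/
def nearPairs (n : ℕ) (z : X × X) : Set (X × X) :=
  {q | 8 * couplingRadius n < dist z.1 z.2 ∧ q ∈ ball z.1 (couplingRadius n) ×ˢ
    ball z.2 (couplingRadius n)}

theorem measurableSet_nearPairs (n : ℕ) :
    MeasurableSet {w : (X × X) × (X × X) | w.2 ∈ nearPairs n w.1} := by
  have h1 : MeasurableSet {w : (X × X) × (X × X) | 8 * couplingRadius n < dist w.1.1 w.1.2} :=
    (isOpen_lt (by fun_prop) (by fun_prop)).measurableSet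
  have h2 : MeasurableSet {w : (X × X) × (X × X) | dist w.2.1 w.1.1 < couplingRadius n} :=
    (isOpen_lt (by fun_prop) (by fun_prop)).measurableSet
  have h3 : MeasurableSet {w : (X × X) × (X × X) | dist w.2.2 w.1.2 < couplingRadius n} :=
    (isOpen_lt (by fun_prop) (by fun_prop)).measurableSet
  exact h1.inter (h2.inter h3)

theorem measurableSet_nearPairs_fiber (n : ℕ) (z : X × X) : MeasurableSet (nearPairs n z) :=
  measurable_prodMk_left (measurableSet_nearPairs n)

/-- The measure `ν.prod ν`, averaged with respect to `m` over balls about the two points. -/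
noncomputable def averagedProd (ν m : Measure X) (Q : ℝ) (n : ℕ) : Measure (X × X) :=
  ENNReal.ofReal (((couplingRadius n ^ Q) ^ 2)⁻¹) • (((ν.prod ν).prod (m.prod m)).restrict
    {w | w.2 ∈ nearPairs n w.1}).map Prod.snd

variable (ν m : Measure X) [IsFiniteMeasure ν] [IsFiniteMeasure m] (Q : ℝ) (n : ℕ)

instance : IsFiniteMeasure (averagedProd ν m Q n) := by
  unfold averagedProd
  exact Measure.smul_finite _ ENNReal.ofReal_ne_top

theorem measurable_setLIntegral_nearPairs {G : X × X → ℝ≥0∞} (hG : Measurable G) :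
    Measurable fun z => ∫⁻ q in nearPairs n z, G q ∂m.prod m := by
  have h1 : Measurable fun w : (X × X) × (X × X) =>
      {w : (X × X) × (X × X) | w.2 ∈ nearPairs n w.1}.indicator (fun w => G w.2) w :=
    (hG.comp measurable_snd).indicator (measurableSet_nearPairs n)
  have h2 := h1.lintegral_prod_right' (ν := m.prod m)
  convert h2 using 2 with z
  rw [← lintegral_indicator (measurableSet_nearPairs_fiber n z)]
  rfl

theorem lintegral_averagedProd {G : X × X → ℝ≥0∞} (hG : Measurable G) :
    ∫⁻ q, G q ∂averagedProd ν m Q n = ∫⁻ z, ENNReal.ofReal (((couplingRadius n ^ Q) ^ 2)⁻¹) *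
      ∫⁻ q in nearPairs n z, G q ∂m.prod m ∂ν.prod ν := by
  rw [averagedProd, lintegral_smul_measure, lintegral_map hG measurable_snd,
    ← lintegral_indicator (measurableSet_nearPairs n), lintegral_prod
    (f := {w : (X × X) × (X × X) | w.2 ∈ nearPairs n w.1}.indicator fun w => G w.2)
    ((hG.comp measurable_snd).indicator (measurableSet_nearPairs n)).aemeasurable, smul_eq_mul,
    lintegral_const_mul _ (measurable_setLIntegral_nearPairs m n hG)]
  congr 1
  refine lintegral_congr fun z => ?_
  rw [← lintegral_indicator (measurableSet_nearPairs_fiber n z)]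
  rfl

theorem averagedProd_eq_zero {P : Set (X × X)} (hP : MeasurableSet P) (h : m.prod m P = 0) :
    averagedProd ν m Q n P = 0 := by
  rw [averagedProd, Measure.smul_apply, Measure.map_apply measurable_snd hP]
  have h1 : ((ν.prod ν).prod (m.prod m)) (Prod.snd ⁻¹' P) = 0 := by
    rw [← univ_prod, Measure.prod_prod, h, mul_zero]
  rw [nonpos_iff_eq_zero.1 ((Measure.restrict_apply_le _ _).trans h1.le), smul_zero]

/-- The averaged measure vanishes on null sets of `m.prod m`, and exceptional sets are μ-null. This
is the purpose of averaging when ν itself charges an exceptional set. -/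
theorem notChargingExceptional_averagedProd {μ : Measure X} {p : ℝ} [Fact (0 < p)] (hm : m ≤ μ) :
    NotChargingExceptional μ p (averagedProd ν m Q n) := by
  intro A hA
  have hmA : m A = 0 :=
    nonpos_iff_eq_zero.1 ((hm A).trans (hA.measure_eq_zero Fact.out).le)
  constructor
  · refine averagedProd_eq_zero ν m Q n (measurable_fst hA.1) ?_
    rw [← prod_univ, Measure.prod_prod, hmA, zero_mul]
  · refine averagedProd_eq_zero ν m Q n (measurable_snd hA.1) ?_
    rw [← univ_prod, Measure.prod_prod, hmA, mul_zero]

variable {ν m Q}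

theorem nearPairs_eq {n : ℕ} {z : X × X} (h : 8 * couplingRadius n < dist z.1 z.2) :
    nearPairs n z = ball z.1 (couplingRadius n) ×ˢ ball z.2 (couplingRadius n) := by
  ext q
  simp [nearPairs, h]

theorem ofReal_inv_sq_mul {r c : ℝ} (hr : 0 < r) (hc : 0 ≤ c) :
    ENNReal.ofReal ((r ^ 2)⁻¹) * (ENNReal.ofReal (c * r) * ENNReal.ofReal (c * r)) =
      ENNReal.ofReal (c ^ 2) := by
  rw [← ENNReal.ofReal_mul (by positivity), ← ENNReal.ofReal_mul (by positivity)]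
  congr 1
  field_simp

/-- All pairs averaged over for (x,y) are within d(x,y)/8 of it, where the kernel still applies, and
upper regularity bounds the normalized mass of the product of balls by C². -/
theorem BumpSystem.ControlledBy.lintegral_averagedProd_le {μ : Measure X} {p : ℝ}
    {F : Type*} [NormedAddCommGroup F] [NormedSpace ℝ F] [FiniteDimensional ℝ F]
    [MeasureSpace F] [BorelSpace F] [(volume : Measure F).IsAddHaarMeasure]
    [SecondCountableTopology F] [CompleteSpace F] {S : BumpSystem μ p} {E : Set X} {t : ℝ}
    {κ : X → X → ℝ≥0∞} (h : S.ControlledBy F E t κ) (hνE : ν Eᶜ = 0) {C : ℝ} (hC : 0 ≤ C)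
    (hm : ∀ x ∈ E, ∀ r, 0 < r → r ≤ 1 → m (ball x r) ≤ ENNReal.ofReal (C * r ^ Q))
    {v : X × X → F} (hv : Measurable v) :
    ∫⁻ q, S.meanEnergy t v q ∂averagedProd ν m Q n ≤
      ENNReal.ofReal (C ^ 2) * ∫⁻ x, ∫⁻ y, κ x y ∂ν ∂ν := by
  have hG := S.measurable_meanEnergy t hv
  rw [lintegral_averagedProd ν m Q n hG, lintegral_prod _
    ((measurable_setLIntegral_nearPairs m n hG).const_mul _).aemeasurable]
  have hE := ae_mem_of_compl_eq_zero hνE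
  have hr0 := couplingRadius_pos n
  have hr1 := couplingRadius_le_one n
  simp_rw [← lintegral_const_mul' _ _ ENNReal.ofReal_ne_top]
  refine lintegral_mono_ae ?_
  filter_upwards [hE] with x hx
  refine lintegral_mono_ae ?_
  filter_upwards [hE] with y hy
  by_cases hd : 8 * couplingRadius n < dist x y
  · rw [nearPairs_eq (z := (x, y)) hd, lintegral_const_mul' _ _ ENNReal.ofReal_ne_top]
    have hxy : x ≠ y := dist_pos.1 (lt_trans (by positivity) hd)
    have h1 : ∫⁻ q in ball x (couplingRadius n) ×ˢ ball y (couplingRadius n),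
        S.meanEnergy t v q ∂m.prod m ≤ κ x y *
        (m (ball x (couplingRadius n)) * m (ball y (couplingRadius n))) := by
      rw [← Measure.prod_prod, ← setLIntegral_const]
      refine setLIntegral_mono' (measurableSet_ball.prod measurableSet_ball) fun q hq => ?_
      refine h x hx y hy hxy q.1 q.2 ?_ ?_ v
      · rw [dist_comm]
        linarith [mem_ball.1 hq.1]
      · rw [dist_comm]
        linarith [mem_ball.1 hq.2]
    refine (mul_le_mul_right h1 _).trans ?_
    rw [mul_left_comm, mul_comm _ (κ x y), ← ofReal_inv_sq_mul (r := couplingRadius n ^ Q)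
      (by positivity) hC]
    gcongr
    · exact hm x hx _ hr0 hr1
    · exact hm y hy _ hr0 hr1
  · have : nearPairs n (x, y) = ∅ := by
      ext q
      simp [nearPairs, hd]
    rw [this]
    simp

/-- By continuity of f, the integrand on shrinking balls about an off-diagonal pair is eventually
above any number below its value at the pair, while lower regularity keeps their normalized mass at
least C². Fatou's lemma then integrates this. -/
theorem mul_lintegral_energy_le_liminf {F : Type*} [NormedAddCommGroup F] [NormedSpace ℝ F]
    [MeasurableSpace F] [BorelSpace F] [SecondCountableTopology F] {E : Set X}
    (mE : MeasurableSet E) (hνE : ν Eᶜ = 0) [NullSingletonClass ν] {C : ℝ} (hC : 0 < C)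
    (hm : ∀ x ∈ E, ∀ r, 0 < r → r ≤ 1 → ENNReal.ofReal (C * r ^ Q) ≤ m (ball x r)) {f : X → F}
    (hf : Continuous f) (t : ℝ) :
    ENNReal.ofReal (C ^ 2) * ∫⁻ x, ∫⁻ y, edist (f x) (f y) ^ (-t) ∂ν ∂ν ≤
      liminf (fun n => ∫⁻ q, truncatedEnergy t n (f q.1) (f q.2) ∂averagedProd ν m Q n) atTop := by
  have hE := ae_mem_of_compl_eq_zero hνE
  have hcont : Continuous fun q : X × X => edist (f q.1) (f q.2) ^ (-t) :=
    ENNReal.continuous_rpow_const.comp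
      ((hf.comp continuous_fst).edist (hf.comp continuous_snd))
  have hG := fun n => measurable_truncatedEnergy t n hf.measurable
  simp_rw [fun n => lintegral_averagedProd ν m Q n (hG n)]
  rw [lintegral_lintegral (f := fun x y => edist (f x) (f y) ^ (-t)) hcont.measurable.aemeasurable,
    ← lintegral_const_mul' _ _ ENNReal.ofReal_ne_top]
  refine le_trans (lintegral_mono_ae ?_) (lintegral_liminf_le fun n =>
    (measurable_setLIntegral_nearPairs m n (hG n)).const_mul _)
  have hxy : ∀ᵐ z ∂ν.prod ν, z.1 ∈ E ∧ z.2 ∈ E ∧ z.1 ≠ z.2 := by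
    refine (Measure.ae_prod_iff_ae_ae ?_).2 ?_
    · exact (measurable_fst mE).inter ((measurable_snd mE).inter
        (measurableSet_eq_fun measurable_fst measurable_snd).compl)
    · filter_upwards [hE] with x hx
      have h0 : ∀ᵐ y ∂ν, y ≠ x := by simp [ae_iff]
      filter_upwards [hE, h0] with y hy hyx
      exact ⟨hx, hy, hyx.symm⟩
  filter_upwards [hxy] with z hz
  obtain ⟨hz1, hz2, hz3⟩ := hz
  -- Working with b strictly below the energy also covers pairs where f takes equal values and the
  -- energy is infinite.
  refine ENNReal.mul_le_of_forall_lt fun a ha b hb => ?_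
  obtain ⟨δ, hδ, hball⟩ := Metric.mem_nhds_iff.1
    ((hcont.tendsto z).eventually (lt_mem_nhds hb))
  obtain ⟨k, hk⟩ := ENNReal.exists_nat_gt (ne_top_of_lt hb)
  have hd : 0 < dist z.1 z.2 := dist_pos.2 hz3
  have hev1 := tendsto_couplingRadius.eventually (gt_mem_nhds hδ)
  have hev2 := tendsto_couplingRadius.eventually
    (gt_mem_nhds (show 0 < dist z.1 z.2 / 8 by positivity))
  refine le_liminf_of_le (by isBoundedDefault) ?_
  filter_upwards [hev1, hev2, eventually_ge_atTop k] with n h1 h2 h3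
  have hr0 := couplingRadius_pos n
  have hr1 := couplingRadius_le_one n
  rw [nearPairs_eq (by linarith)]
  have h4 : b * (ENNReal.ofReal (C * couplingRadius n ^ Q) *
      ENNReal.ofReal (C * couplingRadius n ^ Q)) ≤
      ∫⁻ q in ball z.1 (couplingRadius n) ×ˢ ball z.2 (couplingRadius n),
        truncatedEnergy t n (f q.1) (f q.2) ∂m.prod m := by
    calc _ ≤ b * (m (ball z.1 (couplingRadius n)) * m (ball z.2 (couplingRadius n))) := by
          gcongr
          · exact hm _ hz1 _ hr0 hr1
          · exact hm _ hz2 _ hr0 hr1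
      _ = ∫⁻ q in ball z.1 (couplingRadius n) ×ˢ ball z.2 (couplingRadius n), b ∂m.prod m := by
          rw [setLIntegral_const, Measure.prod_prod]
      _ ≤ _ := by
          refine setLIntegral_mono' (measurableSet_ball.prod measurableSet_ball) fun q hq => ?_
          refine le_min ?_ ?_
          · exact hk.le.trans (by exact_mod_cast h3)
          · refine (hball ?_).le
            rw [mem_ball, Prod.dist_eq, max_lt_iff]
            exact ⟨(mem_ball.1 hq.1).trans h1, (mem_ball.1 hq.2).trans h1⟩
  refine le_trans ?_ (mul_le_mul_right h4 _)
  rw [mul_left_comm, ofReal_inv_sq_mul (by positivity) hC.le, mul_comm]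
  gcongr

end Coupling

/-! ### Passage to the limiting exponent, and change of representatives. -/

section Main

open Metric Module

variable {X : Type*} [MetricSpace X] [MeasurableSpace X] [BorelSpace X]

theorem nullSingletonClass_of_closedBall_le {ν : Measure X} {s : ℝ} (hs : 0 < s) {C : ℝ≥0}
    (hν : ∀ x r, 0 < r → ν (closedBall x r) ≤ C * ENNReal.ofReal r ^ s) :
    NullSingletonClass ν := by
  refine ⟨fun x => nonpos_iff_eq_zero.1 (ge_of_tendsto (f := fun r => C * ENNReal.ofReal r ^ s)
    (x := 𝓝[>] (0 : ℝ)) ?_ ?_)⟩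
  · have h1 : Tendsto (fun r => C * ENNReal.ofReal r ^ s) (𝓝 0)
        (𝓝 (C * ENNReal.ofReal 0 ^ s)) := by
      refine ENNReal.Tendsto.const_mul ?_ (Or.inr ENNReal.coe_ne_top)
      exact ((ENNReal.continuous_rpow_const.comp ENNReal.continuous_ofReal).tendsto 0)
    rw [ENNReal.ofReal_zero, ENNReal.zero_rpow_of_pos hs, mul_zero] at h1
    exact h1.mono_left nhdsWithin_le_nhds
  · filter_upwards [self_mem_nhdsWithin] with r hr
    exact (measure_mono (singleton_subset_iff.2 (mem_closedBall_self (le_of_lt hr)))).trans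
      (hν x r hr)

/-- A sequence of exponents that increases to `α`. -/
noncomputable def exponent (α : ℝ) (k : ℕ) : ℝ := α * (1 - 1 / ((k : ℝ) + 2))

/-- The shift by 2 in `exponent` keeps the value at k = 0 positive. -/
theorem exponent_pos {α : ℝ} (hα : 0 < α) (k : ℕ) : 0 < exponent α k := by
  have h1 : 1 / ((k : ℝ) + 2) < 1 := by
    rw [div_lt_one (by positivity)]
    linarith [Nat.cast_nonneg (α := ℝ) k]
  exact mul_pos hα (by linarith)

theorem exponent_lt {α : ℝ} (hα : 0 < α) (k : ℕ) : exponent α k < α := by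
  have h1 : 0 < 1 / ((k : ℝ) + 2) := by positivity
  exact mul_lt_of_lt_one_right hα (by linarith)

theorem tendsto_exponent (α : ℝ) : Tendsto (exponent α) atTop (𝓝 α) := by
  have h2 : Tendsto (fun k : ℕ => 1 / ((k : ℝ) + 2)) atTop (𝓝 0) := by
    have h3 := (tendsto_add_atTop_iff_nat 1).2 (tendsto_one_div_add_atTop_nhds_zero_nat (𝕜 := ℝ))
    refine h3.congr fun k => ?_
    push_cast
    ring
  have h4 := (h2.const_sub 1).const_mul α
  rwa [sub_zero, mul_one] at h4

variable {F : Type*} [NormedAddCommGroup F] [NormedSpace ℝ F] [MeasurableSpace F] [BorelSpace F]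
  [SecondCountableTopology F]

theorem ofReal_le_dimH_image {ν : Measure X} [IsFiniteMeasure ν] {f : X → F} (hf : Measurable f)
    {α : ℝ} (hα : 0 < α)
    (h : ∀ k, ∫⁻ x, ∫⁻ y, edist (f x) (f y) ^ (-exponent α k) ∂ν ∂ν ≠ ∞)
    {A : Set X} (hA : MeasurableSet A) (hνA : ν A ≠ 0) : ENNReal.ofReal α ≤ dimH (f '' A) :=
  le_of_tendsto' (ENNReal.tendsto_ofReal (tendsto_exponent α)) fun k =>
    le_dimH_image_of_energy hf (exponent_pos hα k).le (h k) hA hνA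

theorem lintegral_energy_le_liminf [SecondCountableTopology X] (ν : Measure X) [IsFiniteMeasure ν]
    {f : X → F} (hf : Measurable f) (t : ℝ) :
    ∫⁻ x, ∫⁻ y, edist (f x) (f y) ^ (-t) ∂ν ∂ν ≤
      liminf (fun n => ∫⁻ q, truncatedEnergy t n (f q.1) (f q.2) ∂ν.prod ν) atTop := by
  rw [lintegral_lintegral (f := fun x y => edist (f x) (f y) ^ (-t))
    (((hf.comp measurable_fst).edist (hf.comp measurable_snd)).pow_const _).aemeasurable]
  refine le_trans (lintegral_mono fun q => ?_)
    (lintegral_liminf_le fun n => measurable_truncatedEnergy t n hf)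
  exact (tendsto_truncatedEnergy t (f q.1) (f q.2)).liminf_eq.ge

/-- A function vanishing off an exceptional set has size zero, so adding the difference there does
not change the class. -/
theorem exists_represents_eqOn_of_isExceptional {μ : Measure X} {p : ℝ} [hp : Fact (0 < p)]
    {A : Set X} (hA : IsExceptional μ p A) {g : X → F} (hg : Measurable g)
    (u : NewtonianSpace μ p F) :
    ∃ f : NewtonianFunction μ p F, Represents f u ∧ ∀ x ∈ A, f.1 x = g x := by
  set h : X → F := A.indicator (g - u.rep.1) with hh
  have hm : Measurable h := (hg.sub u.rep.measurable).indicator hA.1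
  have h0 : newtonianSize μ p h = 0 := hA.newtonianSize_indicator hp.out _
  have hmem : h ∈ newtonianSubmodule μ p F := by
    have h1 : newtonianSize μ p h < ∞ := h0 ▸ ENNReal.zero_lt_top
    rw [newtonianSize, ENNReal.add_lt_top] at h1
    refine ⟨hm, lpSize_lt_top_iff.1 h1.1, ?_⟩
    obtain ⟨G, hG⟩ := iInf_lt_iff.1 h1.2
    obtain ⟨hG1, hG2⟩ := iInf_lt_iff.1 hG
    exact ⟨G, hG1, lpSize_lt_top_iff.1 hG2⟩
  set h' : NewtonianFunction μ p F := ⟨h, hmem⟩ with hh'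
  refine ⟨u.rep + h', ?_, fun x hx => ?_⟩
  · have h1 : SeparationQuotient.mk (u.rep + h') = SeparationQuotient.mk u.rep := by
      rw [← edist_eq_zero, SeparationQuotient.edist_mk, ← newtonianSize_sub_eq_edist, ← h0]
      congr 1
      change u.rep.1 + h - u.rep.1 = h
      simp
    exact h1.trans u.represents_rep
  · change u.rep.1 x + h x = g x
    rw [hh, indicator_of_mem hx]
    simp

end Main

/-! ### The two cases: ν ignores exceptional sets, or charges one. -/

section Conclusion

open Metric Module

variable {X : Type*} [MetricSpace X] [ProperSpace X] [MeasurableSpace X] [BorelSpace X]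
  {μ : Measure X} [IsLocallyFiniteMeasure μ] [μ.IsOpenPosMeasure] {p : ℝ}
  {F : Type*} [NormedAddCommGroup F] [NormedSpace ℝ F] [FiniteDimensional ℝ F]
  [MeasureSpace F] [BorelSpace F] [(volume : Measure F).IsAddHaarMeasure]
  [SecondCountableTopology F] [CompleteSpace F]

/-- Each expected energy is finite, so almost every choice of coefficients has finite energy for all
of the countably many exponents. -/
theorem BumpSystem.exists_energy_ne_top (S : BumpSystem μ p) {E : Set X} {ν : Measure X}
    [IsFiniteMeasure ν] [NullSingletonClass ν] (hνE : ν Eᶜ = 0) {t : ℕ → ℝ}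
    (h : ∀ k, ∃ κ : X → X → ℝ≥0∞, ∫⁻ x, ∫⁻ y, κ x y ∂ν ∂ν ≠ ∞ ∧ S.ControlledBy F E (t k) κ) :
    ∃ ω : S.Coeff F, ∀ k,
      ∫⁻ x, ∫⁻ y, edist (S.toFun ω x) (S.toFun ω y) ^ (-t k) ∂ν ∂ν ≠ ∞ := by
  have hv : Measurable fun _ : X × X => (0 : F) := measurable_const
  have h1 : ∀ k, ∀ᵐ ω ∂S.law F,
      ∫⁻ q : X × X, ‖(0 : F) + (S.toFun ω q.1 - S.toFun ω q.2)‖ₑ ^ (-t k) ∂ν.prod ν < ∞ := by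
    intro k
    obtain ⟨κ, hκ, hS⟩ := h k
    have hm := Measurable.lintegral_prod_right' (ν := ν.prod ν) (S.measurable_energy (t k) hv)
    refine ae_lt_top hm ?_
    rw [S.lintegral_law_lintegral (t k) hv]
    exact ne_top_of_le_ne_top hκ (hS.lintegral_prod_le hνE hv)
  obtain ⟨ω, hω⟩ := (ae_all_iff.2 h1).exists
  refine ⟨ω, fun k => ?_⟩
  have hm := S.measurable_toFun ω
  rw [lintegral_lintegral (f := fun x y => edist (S.toFun ω x) (S.toFun ω y) ^ (-t k))
    (((hm.comp measurable_fst).edist (hm.comp measurable_snd)).pow_const _).aemeasurable]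
  simpa only [zero_add, edist_eq_enorm_sub] using (hω k).ne

variable [hp : Fact (0 < p)]

variable (μ p F) in
/-- The classes for which some representative, each continuous representative and, if sets of
capacity zero are negligible in `E`, each representative maps `E` to a set of dimension at least
`α`. -/
def largeImageClasses (E : Set X) (s α : ℝ) : Set (NewtonianSpace μ p F) :=
  {u | (∃ f : NewtonianFunction μ p F, Represents f u ∧ ENNReal.ofReal α ≤ dimH (f '' E)) ∧
    (∀ f : NewtonianFunction μ p F, Represents f u → Continuous f →
      ENNReal.ofReal α ≤ dimH (f '' E)) ∧
    ((∀ A : Set X, IsExceptional μ p A → μH[s] (E ∩ A) = 0) →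
      ∀ f : NewtonianFunction μ p F, Represents f u → ENNReal.ofReal α ≤ dimH (f '' E))}

variable {S : BumpSystem μ p} {E : Set X} {ν : Measure X} [IsFiniteMeasure ν]
  [NullSingletonClass ν] {s α : ℝ}

theorem isPrevalent_of_forall_isExceptional (mE : MeasurableSet E) (hνE : ν Eᶜ = 0)
    (hν0 : ν E ≠ 0) (hα : 0 < α)
    (hκ : ∀ k, ∃ κ : X → X → ℝ≥0∞, ∫⁻ x, ∫⁻ y, κ x y ∂ν ∂ν ≠ ∞ ∧
      S.ControlledBy F E (exponent α k) κ)
    (hcap : ∀ A, IsExceptional μ p A → ν A = 0) :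
    IsPrevalent (largeImageClasses μ p F E s α) := by
  have hσ : NotChargingExceptional μ p (ν.prod ν) := fun A hA => by
    constructor
    · rw [← prod_univ, Measure.prod_prod, hcap A hA, zero_mul]
    · rw [← univ_prod, Measure.prod_prod, hcap A hA, mul_zero]
  refine S.isPrevalent_of_energy (σ := fun _ => ν.prod ν) (fun _ => hσ) (t := exponent α)
    (fun k => ?_) fun u hu => ?_
  · obtain ⟨κ, hκt, hκS⟩ := hκ k
    exact ⟨_, hκt, fun _ v hv => hκS.lintegral_prod_le hνE hv⟩
  · have hall : ∀ f : NewtonianFunction μ p F, Represents f u →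
        ENNReal.ofReal α ≤ dimH (f.1 '' E) := by
      intro f hf
      refine ofReal_le_dimH_image f.measurable hα (fun k => ?_) mE hν0
      refine ne_top_of_le_ne_top (hu k) ?_
      simp_rw [energyFunctional_eq hσ (exponent α k) _ hf]
      exact lintegral_energy_le_liminf ν f.measurable _
    exact ⟨⟨u.rep, u.represents_rep, hall _ u.represents_rep⟩, fun f hf _ => hall f hf,
      fun _ => hall⟩

/-- The first and third properties hold for every class: the good map f₀ can be imposed on `A`, and
`A` violates the premise of the third. Only continuous representatives need the energies, averaged
over balls. -/
theorem isPrevalent_of_isExceptional {Q : ℝ} (hX : LocallyAhlforsRegular μ Q) (hQ : 0 < Q)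
    (hE : IsCompact E) (hνE : ν Eᶜ = 0) (hν0 : ν E ≠ 0) {C : ℝ≥0} (hν : ν ≤ C • μH[s])
    (hα : 0 < α)
    (hκ : ∀ k, ∃ κ : X → X → ℝ≥0∞, ∫⁻ x, ∫⁻ y, κ x y ∂ν ∂ν ≠ ∞ ∧
      S.ControlledBy F E (exponent α k) κ)
    {f₀ : X → F} (hf₀ : Measurable f₀)
    (hE₀ : ∀ k, ∫⁻ x, ∫⁻ y, edist (f₀ x) (f₀ y) ^ (-exponent α k) ∂ν ∂ν ≠ ∞)
    {A : Set X} (hA : IsExceptional μ p A) (hνA : ν A ≠ 0) :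
    IsPrevalent (largeImageClasses μ p F E s α) := by
  have mE : MeasurableSet E := hE.isClosed.measurableSet
  have hνEA : ν (E ∩ A) ≠ 0 := fun h0 => hνA <| by
    have h1 : A ⊆ E ∩ A ∪ Eᶜ := fun x hx => by
      by_cases hxE : x ∈ E
      · exact Or.inl ⟨hxE, hx⟩
      · exact Or.inr hxE
    exact measure_mono_null h1 (measure_union_null h0 hνE)
  -- The restriction makes the measure finite without affecting balls of radius at most 1 about
  -- points of E.
  set m := μ.restrict (cthickening 1 E) with hm
  have hmf : IsFiniteMeasure m := ⟨by
    rw [hm, Measure.restrict_apply_univ]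
    exact hE.cthickening.measure_lt_top⟩
  have hmb : ∀ x ∈ E, ∀ r, r ≤ 1 → m (ball x r) = μ (ball x r) := fun x hx r hr => by
    rw [hm, Measure.restrict_apply measurableSet_ball, inter_eq_left.2]
    exact fun y hy => mem_cthickening_of_dist_le y x 1 E hx ((mem_ball.1 hy).le.trans hr)
  obtain ⟨D, hD, hb⟩ := hX.exists_bounds hQ hE one_pos
  have hσ : ∀ n, NotChargingExceptional μ p (averagedProd ν m Q n) := fun n =>
    notChargingExceptional_averagedProd ν m Q n Measure.restrict_le_self
  refine S.isPrevalent_of_energy (σ := averagedProd ν m Q) hσ (t := exponent α)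
    (fun k => ?_) fun u hu => ⟨?_, fun f hf hfc => ?_, fun hH => ?_⟩
  · obtain ⟨κ, hκt, hκS⟩ := hκ k
    refine ⟨_, ENNReal.mul_ne_top ENNReal.ofReal_ne_top hκt, fun n v hv =>
      hκS.lintegral_averagedProd_le n hνE hD.le (fun x hx r hr hr1 => ?_) hv⟩
    rw [hmb x hx r hr1]
    exact (hb x hx r hr hr1).2
  · obtain ⟨f, hf, hfA⟩ := exists_represents_eqOn_of_isExceptional hA hf₀ u
    refine ⟨f, hf, (ofReal_le_dimH_image hf₀ hα hE₀ (mE.inter hA.1) hνEA).trans (dimH_mono ?_)⟩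
    rw [← image_congr fun x (hx : x ∈ E ∩ A) => hfA x hx.2]
    exact image_mono inter_subset_left
  · refine ofReal_le_dimH_image f.measurable hα (fun k hk => hu k ?_) mE hν0
    have h1 := mul_lintegral_energy_le_liminf (Q := Q) (m := m) mE hνE (C := 1 / D)
      (by positivity) (fun x hx r hr hr1 => by
        rw [hmb x hx r hr1, one_div_mul_eq_div]
        exact (hb x hx r hr hr1).1) hfc (exponent α k)
    simp_rw [energyFunctional_eq (hσ _) (exponent α k) _ hf]
    rw [← top_le_iff]
    refine le_trans (le_of_eq ?_) h1
    rw [hk, ENNReal.mul_top]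
    rw [Ne, ENNReal.ofReal_eq_zero, not_le]
    positivity
  · refine absurd (nonpos_iff_eq_zero.1 ((hν (E ∩ A)).trans ?_)) hνEA
    rw [Measure.smul_apply, hH A hA, smul_zero]

variable (F) in
theorem exists_continuous_and_isPrevalent {Q s α : ℝ} (hX : LocallyAhlforsRegular μ Q)
    (hQ : 0 < Q) (hQp : Q < p) (hs : 0 < s) (hE : IsCompact E) (hHE : 0 < μH[s] E)
    (hα : 0 < α) (hαs : α * (p - Q + s) = p * s) (hF : α < finrank ℝ F) :
    (∃ f : X → F, Continuous f ∧ (∃ g : X → ℝ≥0∞, IsUpperGradient f g ∧ FiniteLp μ p g) ∧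
      ENNReal.ofReal α ≤ dimH (f '' E)) ∧
    IsPrevalent (largeImageClasses μ p F E s α) := by
  obtain ⟨ν, hνf, hνE, hν0, C, hC, hν⟩ := exists_frostman_measure hs hE hHE
  have hνn : NullSingletonClass ν := nullSingletonClass_of_closedBall_le hs hν
  have hF1 : 1 ≤ finrank ℝ F := by
    have : (0 : ℝ) < finrank ℝ F := hα.trans hF
    exact_mod_cast this
  obtain ⟨S, hS⟩ := exists_bumpSystem_controlledBy F hX hQ hQp hs hE ν hν hF1
  have hκ : ∀ k, ∃ κ : X → X → ℝ≥0∞, ∫⁻ x, ∫⁻ y, κ x y ∂ν ∂ν ≠ ∞ ∧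
      S.ControlledBy F E (exponent α k) κ := fun k => by
    refine hS _ (exponent_pos hα k) ?_ ((exponent_lt hα k).trans hF)
    rw [← hαs]
    exact mul_lt_mul_of_pos_right (exponent_lt hα k) (by linarith)
  obtain ⟨ω, hω⟩ := S.exists_energy_ne_top hνE hκ
  have mE : MeasurableSet E := hE.isClosed.measurableSet
  have hmω := S.measurable_toFun ω
  refine ⟨⟨S.toFun ω, S.continuous_toFun.comp (Continuous.prodMk_right ω), ⟨_,
    S.isUpperGradient_toFun ω, S.finiteLp_tsum_grad⟩,
    ofReal_le_dimH_image hmω hα hω mE hν0⟩, ?_⟩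
  -- The random map ω found above also serves as f₀ in the second case.
  by_cases hcap : ∀ A, IsExceptional μ p A → ν A = 0
  · exact isPrevalent_of_forall_isExceptional mE hνE hν0 hα hκ hcap
  · push Not at hcap
    obtain ⟨A, hA, hνA⟩ := hcap
    have hνH : ν ≤ C • μH[s] := measure_le_smul_hausdorffMeasure (G := univ) hC
      (fun t _ ht => by
        rw [disjoint_univ.1 ht, measure_empty]) fun z _ r hr => hν z r hr
    exact isPrevalent_of_isExceptional hX hQ hE hνE hν0 hνH hα hκ hmω hω hA hνA

end Conclusion

/-! ### The case s = 0. -/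

section Degenerate

theorem isPrevalent_univ {B : Type*} [AddCommGroup B] [TopologicalSpace B] [T1Space B] :
    IsPrevalent (univ : Set B) := by
  let _ : MeasurableSpace B := borel B
  have : BorelSpace B := ⟨rfl⟩
  refine ⟨∅, by simp, MeasurableSet.empty, Measure.dirac 0, measure_univ, ⟨{0},
    isCompact_singleton, ?_⟩, fun x => by simp⟩
  rw [Measure.dirac_apply' _ (measurableSet_singleton 0).compl]
  simp

end Degenerate

end Auxiliary

theorem theorem1p2 {X : Type*} [MetricSpace X] [ProperSpace X] [MeasurableSpace X] [BorelSpace X]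
    (μ : Measure X) [IsLocallyFiniteMeasure μ] [μ.IsOpenPosMeasure]
    (Q p s : ℝ) (hQ : 0 < Q) (hX : LocallyAhlforsRegular μ Q)
    (hs : 0 ≤ s) (hsQ : s ≤ Q) (hQp : Q < p) [Fact (0 < p)]
    (E : Set X) (hE : IsCompact E) (hHE : 0 < μH[s] E)
    (N : ℕ) (hN : p * s / (p - Q + s) < N) :
    (∃ f : X → EuclideanSpace ℝ (Fin N), Continuous f ∧
      (∃ g : X → ℝ≥0∞, IsUpperGradient f g ∧ FiniteLp μ p g) ∧
      ENNReal.ofReal (p * s / (p - Q + s)) ≤ dimH (f '' E)) ∧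
    IsPrevalent {u : NewtonianSpace μ p (EuclideanSpace ℝ (Fin N)) |
      (∃ f : NewtonianFunction μ p (EuclideanSpace ℝ (Fin N)), Represents f u ∧
        ENNReal.ofReal (p * s / (p - Q + s)) ≤ dimH (f '' E)) ∧
      (∀ f : NewtonianFunction μ p (EuclideanSpace ℝ (Fin N)), Represents f u → Continuous f →
        ENNReal.ofReal (p * s / (p - Q + s)) ≤ dimH (f '' E)) ∧
      ((∀ A : Set X, IsExceptional μ p A → μH[s] (E ∩ A) = 0) →
        ∀ f : NewtonianFunction μ p (EuclideanSpace ℝ (Fin N)), Represents f u →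
          ENNReal.ofReal (p * s / (p - Q + s)) ≤ dimH (f '' E))} := by
  -- For s = 0 also α = 0: the dimension bounds are void, and only the existence of representatives
  -- remains.
  rcases hs.eq_or_lt with rfl | hs
  · simp only [mul_zero, zero_div, ENNReal.ofReal_zero, zero_le, implies_true, and_true]
    refine ⟨⟨0, continuous_const, _, IsUpperGradient.zero, ?_⟩, ?_⟩
    · simp [FiniteLp, ENNReal.zero_rpow_of_pos (hQ.trans hQp)]
    · have h : {u : NewtonianSpace μ p (EuclideanSpace ℝ (Fin N)) |
          ∃ f : NewtonianFunction μ p (EuclideanSpace ℝ (Fin N)), Represents f u} = univ :=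
        eq_univ_of_forall fun u => ⟨u.rep, u.represents_rep⟩
      rw [h]
      exact isPrevalent_univ
  · have h0 : 0 < p - Q + s := by linarith
    have hp : 0 < p := hQ.trans hQp
    exact exists_continuous_and_isPrevalent (EuclideanSpace ℝ (Fin N)) hX hQ hQp hs hE hHE
      (by positivity) (div_mul_cancel₀ _ h0.ne') (by simpa using hN)
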